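/- Let $\pi : X \to S$ be a surjective proper holomorphic submersion of complex manifolds of relative dimension one, $\Omega^1_{X/S}$ the line bundle of relative holomorphic 1-forms, $E$ a holomorphic vector bundle on $X$, and $k \ge 1$. Let $J^m_{X/S}(E)$ denote the relative jet bundle of order $m$: its fibre at $x$ is $E_x/(\mathfrak m_x^{m+1}+\mathfrak m_{S,\pi(x)}\mathcal O_{X,x})E_x$, where $E_x$ is the stalk of the sheaf of sections, and its sections are the $\mathcal O_X$-linear combinations of jets $j^m s$ of sections $s$ of $E$ ($J^{-1}=0$). Let $P : E \to \mathrm{Sym}^k\Omega^1_{X/S}\otimes E$ be a relative ($\pi^{-1}\mathcal O_S$-linear) differential operator of order $k$ whose symbol is the identity, i.e. $[\dots[[P,f_1],f_2],\dots,f_k]\,s = df_1\odot\cdots\odot df_k\otimes s$ for all local functions $f_a$ and sections $s$, where $d = d_{X/S}$. Let $\varphi_P : J^k_{X/S}(E)\to \mathrm{Sym}^k\Omega^1_{X/S}\otimes E$ be the bundle map with $\varphi_P\circ j^k = P$, let $\Psi_P : J^{k-1}_{X/S}(E)\to J^k_{X/S}(E)$ be the section of the projection with $\varphi_P\circ\Psi_P=0$,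 and let $\theta : J^k_{X/S}(E)\to J^1_{X/S}(J^{k-1}_{X/S}(E))$ be the bundle map with $\theta(j^k s)=j^1(j^{k-1}s)$. Then there is a unique relative holomorphic connection $\nabla_P$ on $J^{k-1}_{X/S}(E)$ (a $\pi^{-1}\mathcal O_S$-linear map to $\Omega^1_{X/S}\otimes J^{k-1}_{X/S}(E)$ with $\nabla_P(fu)=f\nabla_P u+df\otimes u$) for which the bundle map $\chi$ with $\nabla_P=\chi\circ j^1$ satisfies $\chi\circ\theta\circ\Psi_P=0$. For $0\le i\le k$ let $\mathcal K_i$ be the kernel of the projection $J^{k-1}_{X/S}(E)\to J^{k-1-i}_{X/S}(E)$. Include $\mathrm{Sym}^{j}\Omega^1_{X/S}\otimes E$ in $J^{j}_{X/S}(E)$ by sending $df_1\odot\cdots\odot df_j\otimes s$ at $x$ to the jet at $x$ of $(f_1(x)-f_1)\cdots(f_j(x)-f_j)\,s$. Set $F_0=0$, let $F_1\subset J^{k-1}_{X/S}(E)$ be $\mathrm{Sym}^{k-1}\Omega^1_{X/S}\otimes E$, and for $i\ge1$ let $F_{i+1}$ be the inverse image in $J^{k-1}_{X/S}(E)$ of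 the torsion subsheaf of the cokernel of the map $T_{X/S}\otimes F_i\to J^{k-1}_{X/S}(E)/F_i$ given by the second fundamental form of $F_i$ with respect to $\nabla_P$. Then: 1. $F_i=\mathcal K_i$ for $0\le i\le k$; in particular $F_k=J^{k-1}_{X/S}(E)$. If $E_x\ne 0$, the fibres at $x$ of the $\mathcal K_i$ are strictly increasing in $i$. 2. The inclusions above induce isomorphisms $\mathrm{Sym}^{k-i}\Omega^1_{X/S}\otimes E\cong\mathcal K_i/\mathcal K_{i-1}$ for $1\le i\le k$. With these identifications, and with the polarization isomorphism $\mathrm{Sym}^{k-i}\Omega^1_{X/S}\cong\Omega^1_{X/S}\otimes\mathrm{Sym}^{k-i-1}\Omega^1_{X/S}$, $\eta_1\odot\cdots\odot\eta_{k-i}\mapsto\sum_a\eta_a\otimes\bigodot_{b\ne a}\eta_b$, the map $\alpha_i:\mathcal K_i/\mathcal K_{i-1}\to\Omega^1_{X/S}\otimes(\mathcal K_{i+1}/\mathcal K_i)$ induced by $\nabla_P$ is the identity of $\mathrm{Sym}^{k-i}\Omega^1_{X/S}\otimes E$, for $1\le i\le k-1$. 3. $(J^{k-1}_{X/S}(E),\nabla_P,\{\mathcal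 K_i\})$ is a relative oper of length $k$, associated with the second fundamental form of $\mathrm{Sym}^{k-1}\Omega^1_{X/S}\otimes E$: $J^{k-1}_{X/S}(E)$ is a holomorphic vector bundle, the $\mathcal K_i$ are an increasing sequence of subbundles from $0$ to $J^{k-1}_{X/S}(E)$, $\nabla_P(\mathcal K_i)\subset\Omega^1_{X/S}\otimes\mathcal K_{i+1}$ and $\alpha_i$ is an isomorphism for $1\le i\le k-1$, and the filtration is the one of part 1. -/

import Mathlib

open scoped Manifold ContDiff Topology TensorProduct
open Bundle

noncomputable section

namespace RelOper

universe uB uX uC uS uF w w'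

/-! ### Holomorphic functions and families of compact complex manifolds

A complex manifold `X` is a manifold modelled on a finite-dimensional complex normed space `B`, with
an atlas that is analytic over `ℂ`.  A holomorphic function, vector field or section "near `x`" is
always represented by a globally defined, possibly discontinuous, field together with a condition
which only concerns its values near `x`. -/

section Functions

variable (B : Type uB) [NormedAddCommGroup B] [NormedSpace ℂ B]
  {X : Type uX} [TopologicalSpace X] [ChartedSpace B X]

/-- `f` is holomorphic in a neighbourhood of `x`. -/
def HolAt (f : X → ℂ) (x : X) : Prop := ContMDiffAt 𝓘(ℂ, B) 𝓘(ℂ, ℂ) ω f x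

/-- (Representatives of) germs of holomorphic functions at `x`. -/
abbrev FunGerm (x : X) : Type uX := {f : X → ℂ // HolAt B f x}

end Functions

/-- A surjective proper holomorphic submersion `π : X → S` of complex manifolds. -/
structure Family (B : Type uB) [NormedAddCommGroup B] [NormedSpace ℂ B]
    (X : Type uX) [TopologicalSpace X] [ChartedSpace B X]
    (C : Type uC) [NormedAddCommGroup C] [NormedSpace ℂ C]
    (S : Type uS) [TopologicalSpace S] [ChartedSpace C S] where
  /-- the projection `π : X → S` -/
  proj : X → S
  submersion : Manifold.IsSubmersion 𝓘(ℂ, B) 𝓘(ℂ, C) ω proj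
  surjective : Function.Surjective proj
  proper : IsProperMap proj

/-! ### Sheaves of sections -/

/-- A sheaf of `𝒪_X`-modules of fields of vectors `x ↦ s x ∈ Fib x`.  `Hol s x` means that `s`
restricts to a section of the sheaf on some neighbourhood of `x`; the sections over an open set `U`
are the fields with `Hol s x` for all `x ∈ U`, two fields being the same section over `U` when they
agree on `U`. -/
structure SectionSheaf (B : Type uB) [NormedAddCommGroup B] [NormedSpace ℂ B]
    (X : Type uX) [TopologicalSpace X] [ChartedSpace B X] where
  /-- the fibres -/
  Fib : X → Type w
  [addCommGroup : ∀ x, AddCommGroup (Fib x)]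
  [module : ∀ x, Module ℂ (Fib x)]
  /-- being a section near a point -/
  Hol : (∀ x, Fib x) → X → Prop
  congr : ∀ {s t : ∀ x, Fib x} {x : X}, Hol s x → (∀ᶠ y in 𝓝 x, s y = t y) → Hol t x
  eventually : ∀ {s : ∀ x, Fib x} {x : X}, Hol s x → ∀ᶠ y in 𝓝 x, Hol s y
  zero : ∀ x : X, Hol (fun _ => 0) x
  add : ∀ {s t : ∀ x, Fib x} {x : X}, Hol s x → Hol t x → Hol (fun y => s y + t y) x
  smul : ∀ {f : X → ℂ} {s : ∀ x, Fib x} {x : X},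
    HolAt B f x → Hol s x → Hol (fun y => f y • s y) x

attribute [instance] SectionSheaf.addCommGroup SectionSheaf.module

section Functions

variable {B : Type uB} [NormedAddCommGroup B] [NormedSpace ℂ B]
  {X : Type uX} [TopologicalSpace X] [ChartedSpace B X]

theorem HolAt.const (c : ℂ) (x : X) : HolAt B (fun _ : X => c) x := contMDiffAt_const

theorem HolAt.mul {f g : X → ℂ} {x : X} (hf : HolAt B f x) (hg : HolAt B g x) :
    HolAt B (fun y => f y * g y) x :=
  ContMDiffAt.smul hf hg

theorem HolAt.sub {f g : X → ℂ} {x : X} (hf : HolAt B f x) (hg : HolAt B g x) :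
    HolAt B (fun y => f y - g y) x :=
  ContMDiffAt.sub hf hg

theorem HolAt.prod {n : ℕ} {f : Fin n → X → ℂ} {x : X} (hf : ∀ a, HolAt B (f a) x) :
    HolAt B (fun y => ∏ a, f a y) x := by
  induction n with
  | zero => simpa using HolAt.const 1 x
  | succ n ih =>
    simp only [Fin.prod_univ_succ]
    exact (hf 0).mul (ih fun a => hf a.succ)

theorem HolAt.eventually [IsManifold 𝓘(ℂ, B) ω X] {f : X → ℂ} {x : X} (hf : HolAt B f x) :
    ∀ᶠ y in 𝓝 x, HolAt B f y :=
  (contMDiffAt_iff_contMDiffAt_nhds (by simp)).1 hf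

end Functions

namespace SectionSheaf

variable {B : Type uB} [NormedAddCommGroup B] [NormedSpace ℂ B]
  {X : Type uX} [TopologicalSpace X] [ChartedSpace B X]

/-- (Representatives of) germs at `x` of sections of `A`. -/
def germs (A : SectionSheaf.{uB, uX, w} B X) (x : X) : Submodule ℂ (∀ y, A.Fib y) where
  carrier := {s | A.Hol s x}
  zero_mem' := A.zero x
  add_mem' := A.add
  smul_mem' c _ hs := A.smul (HolAt.const c x) hs

/-- Multiplication of a germ of a section by a germ of a holomorphic function. -/
def mulGerm (A : SectionSheaf.{uB, uX, w} B X) {x : X} (f : FunGerm B x) (s : A.germs x) :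
    A.germs x :=
  ⟨fun y => f.1 y • s.1 y, A.smul f.2 s.2⟩

/-- The sheaf of fields which are locally finite `𝒪_X`-linear combinations of fields belonging to
given families `G x` of fields "defined near `x`". -/
abbrev generate [IsManifold 𝓘(ℂ, B) ω X] (Fib : X → Type w) [∀ x, AddCommGroup (Fib x)]
    [∀ x, Module ℂ (Fib x)]
    (G : X → Set (∀ y, Fib y)) (hG : ∀ x, ∀ s ∈ G x, ∀ᶠ y in 𝓝 x, s ∈ G y) :
    SectionSheaf.{uB, uX, w} B X where
  Fib := Fib
  Hol s x := ∃ (m : ℕ) (f : Fin m → X → ℂ) (g : Fin m → ∀ y, Fib y),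
    (∀ i, HolAt B (f i) x) ∧ (∀ i, g i ∈ G x) ∧ ∀ᶠ y in 𝓝 x, s y = ∑ i, f i y • g i y
  congr := by
    rintro s t x ⟨m, f, g, hf, hg, h⟩ hst
    refine ⟨m, f, g, hf, hg, ?_⟩
    filter_upwards [h, hst] with y h1 h2
    rw [← h2, h1]
  eventually := by
    rintro s x ⟨m, f, g, hf, hg, h⟩
    have h1 : ∀ᶠ y in 𝓝 x, ∀ i, HolAt B (f i) y :=
      Filter.eventually_all.2 fun i => (hf i).eventually
    have h2 : ∀ᶠ y in 𝓝 x, ∀ i, g i ∈ G y :=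
      Filter.eventually_all.2 fun i => hG x _ (hg i)
    filter_upwards [h1, h2, eventually_eventually_nhds.2 h] with y a b c
    exact ⟨m, f, g, a, b, c⟩
  zero x := ⟨0, fun i => i.elim0, fun i => i.elim0, fun i => i.elim0, fun i => i.elim0, by simp⟩
  add := by
    rintro s t x ⟨m, f, g, hf, hg, h⟩ ⟨m', f', g', hf', hg', h'⟩
    refine ⟨m + m', Fin.append f f', Fin.append g g', ?_, ?_, ?_⟩
    · intro i
      refine Fin.addCases (fun i => ?_) (fun i => ?_) i
      · simpa using hf i
      · simpa using hf' i
    · intro i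
      refine Fin.addCases (fun i => ?_) (fun i => ?_) i
      · simpa using hg i
      · simpa using hg' i
    · filter_upwards [h, h'] with y a b
      rw [a, b, Fin.sum_univ_add]
      simp
  smul := by
    rintro f₀ s x hf₀ ⟨m, f, g, hf, hg, h⟩
    refine ⟨m, fun i y => f₀ y * f i y, g, fun i => hf₀.mul (hf i), hg, ?_⟩
    filter_upwards [h] with y a
    rw [a, Finset.smul_sum]
    simp only [mul_smul]

/-- The sheaf of holomorphic sections of a holomorphic vector bundle `V` over `X`. -/
abbrev ofBundle [IsManifold 𝓘(ℂ, B) ω X]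
    (F : Type uF) [NormedAddCommGroup F] [NormedSpace ℂ F]
    (V : X → Type w) [TopologicalSpace (TotalSpace F V)] [∀ x, AddCommGroup (V x)]
    [∀ x, Module ℂ (V x)] [∀ x, TopologicalSpace (V x)] [FiberBundle F V] [VectorBundle ℂ F V]
    [ContMDiffVectorBundle ω F V 𝓘(ℂ, B)] : SectionSheaf.{uB, uX, w} B X where
  Fib := V
  Hol s x := ContMDiffAt 𝓘(ℂ, B) (𝓘(ℂ, B).prod 𝓘(ℂ, F)) ω (fun y => TotalSpace.mk' F y (s y)) x
  congr := by
    intro s t x hs h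
    refine hs.congr_of_eventuallyEq ?_
    filter_upwards [h] with y hy
    rw [hy]
  eventually := by
    intro s x hs
    exact (contMDiffAt_iff_contMDiffAt_nhds (by simp)).1 hs
  zero x := contMDiff_zeroSection ℂ V x
  add := fun hs ht => ContMDiffAt.add_section hs ht
  smul := fun hf hs => ContMDiffAt.smul_section hf hs

/-- `e` is a holomorphic frame of `A` on a neighbourhood of `x`. -/
def IsFrameNear (A : SectionSheaf.{uB, uX, w} B X) (x : X) {r : ℕ} (e : Fin r → ∀ y, A.Fib y) :
    Prop :=
  ∀ᶠ y in 𝓝 x, LinearIndependent ℂ (fun i => e i y) ∧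
    Submodule.span ℂ (Set.range fun i => e i y) = ⊤ ∧
    ∀ s : ∀ z, A.Fib z, A.Hol s y ↔ ∃ c : Fin r → X → ℂ, (∀ i, HolAt B (c i) y) ∧
      ∀ᶠ z in 𝓝 y, s z = ∑ i, c i z • e i z

/-- `A` is the sheaf of holomorphic sections of a holomorphic vector bundle with fibres
`A.Fib x`. -/
def IsVectorBundle (A : SectionSheaf.{uB, uX, w} B X) : Prop :=
  ∀ x, ∃ (r : ℕ) (e : Fin r → ∀ y, A.Fib y), A.IsFrameNear x e

/-- The subspaces `W x` of the fibres form a holomorphic subbundle: near every point there is a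
holomorphic frame of `A` of which a part spans `W`. -/
def IsSubbundle (A : SectionSheaf.{uB, uX, w} B X) (W : ∀ x, Submodule ℂ (A.Fib x)) : Prop :=
  ∀ x, ∃ (r : ℕ) (e : Fin r → ∀ y, A.Fib y) (I : Set (Fin r)), A.IsFrameNear x e ∧
    ∀ᶠ y in 𝓝 x, W y = Submodule.span ℂ ((fun i => e i y) '' I)

/-- The sections near `x` of the subsheaf of `A` of sections with values in `W`. -/
def sectionsIn (A : SectionSheaf.{uB, uX, w} B X) (W : ∀ x, Submodule ℂ (A.Fib x)) (x : X) :
    Set (∀ y, A.Fib y) :=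
  {s | A.Hol s x ∧ ∀ᶠ y in 𝓝 x, s y ∈ W y}

end SectionSheaf

/-! ### Morphisms -/

section Morphisms

variable {B : Type uB} [NormedAddCommGroup B] [NormedSpace ℂ B]
  {X : Type uX} [TopologicalSpace X] [ChartedSpace B X]

/-- A holomorphic homomorphism of vector bundles: a fibrewise linear map that maps holomorphic
sections to holomorphic sections. -/
structure BundleHom (A : SectionSheaf.{uB, uX, w} B X) (A' : SectionSheaf.{uB, uX, w'} B X) where
  /-- the map on fibres -/
  map : ∀ x, A.Fib x →ₗ[ℂ] A'.Fib x
  hol : ∀ (s : ∀ x, A.Fib x) (x : X), A.Hol s x → A'.Hol (fun y => map y (s y)) x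

open Classical in
/-- Given linear maps `val x` on the germs of sections, the field `y ↦ val y (s)`; it has the junk
value `0` at the points near which `s` is not a section. -/
def applyField {A : SectionSheaf.{uB, uX, w} B X} {M : X → Type w'} [∀ x, AddCommGroup (M x)]
    [∀ x, Module ℂ (M x)] (val : ∀ x, A.germs x →ₗ[ℂ] M x) (s : ∀ y, A.Fib y) : ∀ y, M y :=
  fun y => if h : A.Hol s y then val y ⟨s, h⟩ else 0

/-- A morphism `P : A → A'` of sheaves of complex vector spaces (not necessarily `𝒪_X`-linear),
given by the linear maps which send a germ `s` of a section at `x` to the value `(P s)(x)`. -/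
@[ext] structure Operator (A : SectionSheaf.{uB, uX, w} B X) (A' : SectionSheaf.{uB, uX, w'} B X)
    where
  /-- the value at `x` of the image of a germ at `x` -/
  val : ∀ x, A.germs x →ₗ[ℂ] A'.Fib x
  val_eq_zero : ∀ (x : X) (s : A.germs x), (∀ᶠ y in 𝓝 x, s.1 y = 0) → val x s = 0
  hol : ∀ (x : X) (s : A.germs x), A'.Hol (applyField val s.1) x

/-- The section `P s`. -/
def Operator.app {A : SectionSheaf.{uB, uX, w} B X} {A' : SectionSheaf.{uB, uX, w'} B X}
    (P : Operator A A') (s : ∀ y, A.Fib y) : ∀ y, A'.Fib y :=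
  applyField P.val s

/-- The commutator `[φ, f] = φ ∘ f - f ∘ φ`. -/
def comm (A : SectionSheaf.{uB, uX, w} B X) {x : X} {M : Type w'} [AddCommGroup M] [Module ℂ M]
    (f : FunGerm B x) (φ : A.germs x → M) : A.germs x → M :=
  fun s => φ (A.mulGerm f s) - f.1 x • φ s

/-- `φ`, seen as an operator at the point `x`, has order at most `k`: for `k = 0` it is
`𝒪_X`-linear, and for `k > 0` all its commutators with holomorphic functions have order at most
`k - 1`. -/
def HasOrder (A : SectionSheaf.{uB, uX, w} B X) {x : X} {M : Type w'} [AddCommGroup M]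
    [Module ℂ M] : ℕ → (A.germs x → M) → Prop
  | 0, φ => ∀ (f : FunGerm B x) (s : A.germs x), φ (A.mulGerm f s) = f.1 x • φ s
  | k + 1, φ => ∀ f : FunGerm B x, HasOrder A k (comm A f φ)

/-- The iterated commutator `[…[[φ, f₀], f₁], …, f_{k-1}]`. -/
def iterComm (A : SectionSheaf.{uB, uX, w} B X) {x : X} {M : Type w'} [AddCommGroup M]
    [Module ℂ M] : (k : ℕ) → (Fin k → FunGerm B x) → (A.germs x → M) → (A.germs x → M)
  | 0, _, φ => φ
  | k + 1, f, φ => iterComm A k (fun a => f a.succ) (comm A (f 0) φ)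

end Morphisms

/-! ### Relative differential forms, operators and connections -/

section Relative

variable {B : Type uB} [NormedAddCommGroup B] [NormedSpace ℂ B]
  {X : Type uX} [TopologicalSpace X] [ChartedSpace B X]
  {C : Type uC} [NormedAddCommGroup C] [NormedSpace ℂ C]
  {S : Type uS} [TopologicalSpace S] [ChartedSpace C S]
  (p : Family B X C S)

/-- The fibre at `x` of the relative tangent bundle: the kernel of the differential of `π`. -/
abbrev RelTangent (x : X) : Submodule ℂ (TangentSpace 𝓘(ℂ, B) x) :=
  LinearMap.ker (mfderiv 𝓘(ℂ, B) 𝓘(ℂ, C) p.proj x).toLinearMap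

/-- The fibre at `x` of `Ω¹_{X/S}`. -/
abbrev RelCotangent (x : X) : Type uB := Module.Dual ℂ (RelTangent p x)

/-- The value at `x` of the relative differential `d_{X/S} f`. -/
def relDiff (f : X → ℂ) (x : X) : RelCotangent p x :=
  (mfderiv 𝓘(ℂ, B) 𝓘(ℂ, ℂ) f x).toLinearMap ∘ₗ (RelTangent p x).subtype

/-- `v` is a holomorphic relative vector field near `x`. -/
def HolVectorField (v : ∀ y, RelTangent p y) (x : X) : Prop :=
  ∀ f : X → ℂ, HolAt B f x → HolAt B (fun y => relDiff p f y (v y)) x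

/-- The contraction `ω ⊗ a ↦ ω(v) a`. -/
def contract {x : X} (M : Type w) [AddCommGroup M] [Module ℂ M] (v : RelTangent p x) :
    RelCotangent p x ⊗[ℂ] M →ₗ[ℂ] M :=
  (TensorProduct.lid ℂ M).toLinearMap ∘ₗ
    LinearMap.rTensor M (Module.Dual.eval ℂ (RelTangent p x) v)

variable [IsManifold 𝓘(ℂ, B) ω X]

/-- The sheaf `Ω¹_{X/S} ⊗ A`, generated by the sections `d_{X/S} f ⊗ s`. -/
abbrev formsTensor (A : SectionSheaf.{uB, uX, w} B X) : SectionSheaf.{uB, uX, max uB w} B X :=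
  SectionSheaf.generate (fun x => RelCotangent p x ⊗[ℂ] A.Fib x)
    (fun x => {σ | ∃ (f : X → ℂ) (s : ∀ y, A.Fib y), HolAt B f x ∧ A.Hol s x ∧
      σ = fun y => relDiff p f y ⊗ₜ[ℂ] s y})
    (by
      rintro x _ ⟨f, s, hf, hs, rfl⟩
      filter_upwards [hf.eventually, A.eventually hs] with y h1 h2
      exact ⟨f, s, h1, h2, rfl⟩)

/-- The sheaf `Symᵏ Ω¹_{X/S} ⊗ A`, generated by the sections
`d_{X/S} f₀ ⊙ ⋯ ⊙ d_{X/S} f_{k-1} ⊗ s`. -/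
abbrev symFormsTensor (k : ℕ) (A : SectionSheaf.{uB, uX, w} B X) :
    SectionSheaf.{uB, uX, max uB w} B X :=
  SectionSheaf.generate (fun x => SymmetricPower ℂ (Fin k) (RelCotangent p x) ⊗[ℂ] A.Fib x)
    (fun x => {σ | ∃ (f : Fin k → X → ℂ) (s : ∀ y, A.Fib y), (∀ a, HolAt B (f a) x) ∧ A.Hol s x ∧
      σ = fun y => SymmetricPower.tprod ℂ (fun a => relDiff p (f a) y) ⊗ₜ[ℂ] s y})
    (by
      rintro x _ ⟨f, s, hf, hs, rfl⟩
      filter_upwards [Filter.eventually_all.2 fun a => (hf a).eventually, A.eventually hs]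
        with y h1 h2
      exact ⟨f, s, h1, h2, rfl⟩)


/-- `P` is `π⁻¹𝒪_S`-linear. -/
def IsRelLinear {A : SectionSheaf.{uB, uX, w} B X} {A' : SectionSheaf.{uB, uX, w'} B X}
    (P : Operator A A') : Prop :=
  ∀ (x : X) (g : S → ℂ) (_ : HolAt C g (p.proj x)) (h : HolAt B (g ∘ p.proj) x) (s : A.germs x),
    P.val x (A.mulGerm ⟨g ∘ p.proj, h⟩ s) = g (p.proj x) • P.val x s

/-- `P` is a relative differential operator of order (at most) `k`. -/
def IsRelDiffOp {A : SectionSheaf.{uB, uX, w} B X} {A' : SectionSheaf.{uB, uX, w'} B X}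
    (k : ℕ) (P : Operator A A') : Prop :=
  IsRelLinear p P ∧ ∀ x, HasOrder A k (P.val x)

/-- The order `k` symbol of `P : A → Symᵏ Ω¹_{X/S} ⊗ A`, which sends `d f₀ ⊙ ⋯ ⊙ d f_{k-1} ⊗ s` to
`[…[P, f₀], …, f_{k-1}] s`, is the identity. -/
def HasIdentitySymbol {A : SectionSheaf.{uB, uX, w} B X} (k : ℕ)
    (P : Operator A (symFormsTensor p k A)) : Prop :=
  ∀ (x : X) (f : Fin k → FunGerm B x) (s : A.germs x),
    iterComm A k f (P.val x) s =
      SymmetricPower.tprod ℂ (fun a => relDiff p (f a).1 x) ⊗ₜ[ℂ] s.1 x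

/-- `D` is a relative holomorphic connection: a `π⁻¹𝒪_S`-linear map `A → Ω¹_{X/S} ⊗ A` which
satisfies the Leibniz identity. -/
def IsRelConnection {A : SectionSheaf.{uB, uX, w} B X} (D : Operator A (formsTensor p A)) : Prop :=
  IsRelLinear p D ∧ ∀ (x : X) (f : FunGerm B x) (s : A.germs x),
    D.val x (A.mulGerm f s) = f.1 x • D.val x s + relDiff p f.1 x ⊗ₜ[ℂ] s.1 x

/-! ### Relative jets -/

/-- The germs at `x` in `(𝔪_x ^ n + 𝔪_{S, π x} 𝒪_{X, x}) A_x`, that is, those that vanish on the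
`(n - 1)`-th infinitesimal neighbourhood of `x` in the fibre of `π` through `x`. -/
def vanishing (A : SectionSheaf.{uB, uX, w} B X) (n : ℕ) (x : X) : Submodule ℂ (A.germs x) :=
  Submodule.span ℂ
    ({s | ∃ (f : Fin n → FunGerm B x) (t : A.germs x), (∀ a, (f a).1 x = 0) ∧
        ∀ᶠ y in 𝓝 x, s.1 y = (∏ a, (f a).1 y) • t.1 y} ∪
      {s | ∃ (g : S → ℂ) (t : A.germs x), HolAt C g (p.proj x) ∧ g (p.proj x) = 0 ∧
        ∀ᶠ y in 𝓝 x, s.1 y = g (p.proj y) • t.1 y})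

/-- Jets at `x`, along the fibre of `π`, of order `n - 1`. -/
abbrev JetFib (A : SectionSheaf.{uB, uX, w} B X) (n : ℕ) (x : X) : Type (max uX w) :=
  A.germs x ⧸ vanishing p A n x

/-- The jet at `x` of the germ of a section. -/
def jetAt (A : SectionSheaf.{uB, uX, w} B X) (n : ℕ) (x : X) : A.germs x →ₗ[ℂ] JetFib p A n x :=
  (vanishing p A n x).mkQ

/-- The relative jet bundle `J^{n-1}_{X/S}(A)` of order `n - 1` (so `jets p A 0 = 0`,
`jets p A 1 ≅ A`, and `Jᵐ_{X/S}(A)` is `jets p A (m + 1)`).  Its fibre at `x` is the space of jets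
of order `n - 1` at `x` along the fibre of `π`, and its sections are the `𝒪_X`-linear combinations
of the jets `y ↦ jetAt y s` of sections `s` of `A`. -/
abbrev jets (A : SectionSheaf.{uB, uX, w} B X) (n : ℕ) : SectionSheaf.{uB, uX, max uX w} B X :=
  SectionSheaf.generate (fun x => JetFib p A n x)
    (fun x => {σ | ∃ s : ∀ y, A.Fib y, A.Hol s x ∧ σ = applyField (jetAt p A n) s})
    (by
      rintro x _ ⟨s, hs, rfl⟩
      filter_upwards [A.eventually hs] with y h
      exact ⟨s, h, rfl⟩)

/-- The universal operator `A → J^{n-1}_{X/S}(A)`, which sends a section to its jet. -/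
def jetOp (A : SectionSheaf.{uB, uX, w} B X) (n : ℕ) : Operator A (jets p A n) where
  val := jetAt p A n
  val_eq_zero x s hs := by
    refine (Submodule.Quotient.mk_eq_zero _).2 (Submodule.subset_span (Or.inr ?_))
    refine ⟨fun _ => 0, 0, HolAt.const 0 _, rfl, ?_⟩
    filter_upwards [hs] with y hy
    rw [hy, zero_smul]
  hol x s := ⟨1, fun _ _ => 1, fun _ => applyField (jetAt p A n) s.1, fun _ => HolAt.const 1 x,
    fun _ => ⟨s.1, s.2, rfl⟩,
    Filter.Eventually.of_forall fun y => by simp⟩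

set_option linter.unusedSectionVars false in
theorem vanishing_anti (A : SectionSheaf.{uB, uX, w} B X) {m n : ℕ} (h : n ≤ m) (x : X) :
    vanishing p A m x ≤ vanishing p A n x := by
  obtain ⟨d, rfl⟩ := Nat.exists_eq_add_of_le h
  refine Submodule.span_mono (Set.union_subset_union_left _ ?_)
  rintro s ⟨f, t, hf, hs⟩
  refine ⟨fun a => f (Fin.castAdd d a),
    A.mulGerm ⟨fun y => ∏ b : Fin d, (f (Fin.natAdd n b)).1 y, HolAt.prod fun b => (f _).2⟩ t,
    fun a => hf _, ?_⟩
  filter_upwards [hs] with y hy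
  rw [hy, Fin.prod_univ_add, mul_smul]
  rfl

/-- The projection `J^{m-1}_{X/S}(A) → J^{n-1}_{X/S}(A)` for `n ≤ m`, on the fibres at `x`. -/
def jetProj (A : SectionSheaf.{uB, uX, w} B X) {m n : ℕ} (h : n ≤ m) (x : X) :
    (jets p A m).Fib x →ₗ[ℂ] (jets p A n).Fib x :=
  Submodule.factor (vanishing_anti p A h x)

/-- The kernel `K_i` of the projection `J^{k-1}_{X/S}(A) → J^{k-1-i}_{X/S}(A)`; in particular
`K_k = J^{k-1}_{X/S}(A)`. -/
def jetKernel (A : SectionSheaf.{uB, uX, w} B X) (k i : ℕ) (x : X) :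
    Submodule ℂ ((jets p A k).Fib x) :=
  LinearMap.ker (jetProj p A (Nat.sub_le k i) x)

/-- The germ `(f₀(x) - f₀) ⋯ (f_{j-1}(x) - f_{j-1}) s` at `x`. -/
def shiftGerm (A : SectionSheaf.{uB, uX, w} B X) {x : X} {j : ℕ} (f : Fin j → FunGerm B x)
    (s : A.germs x) : A.germs x :=
  A.mulGerm ⟨fun y => ∏ a, ((f a).1 x - (f a).1 y),
    HolAt.prod fun a => (HolAt.const _ x).sub (f a).2⟩ s

/-- The subbundle `Symʲ Ω¹_{X/S} ⊗ A` of `J^{k-1}_{X/S}(A)`, where `j = k - 1`.  It is spanned by the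
images `jetAt x ((f₀(x) - f₀) ⋯ (f_{j-1}(x) - f_{j-1}) s)` of the elements
`d f₀ ⊙ ⋯ ⊙ d f_{j-1} ⊗ s(x)`. -/
def symSubbundle (A : SectionSheaf.{uB, uX, w} B X) (k j : ℕ) (x : X) :
    Submodule ℂ ((jets p A k).Fib x) :=
  Submodule.span ℂ (Set.range fun q : (Fin j → FunGerm B x) × A.germs x =>
    jetAt p A k x (shiftGerm A q.1 q.2))

/-- `D` is the relative connection on `J^{k-1}_{X/S}(A)` induced by an order `k` operator `P` with
identity symbol.  Here `φ : Jᵏ(A) → Symᵏ Ω¹ ⊗ A` is the bundle map that represents `P`,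
`Ψ : J^{k-1}(A) → Jᵏ(A)` is the splitting of the projection with image `ker φ`,
`θ : Jᵏ(A) → J¹(J^{k-1}(A))` is the canonical map, and `D` is represented by the bundle map
`χ : J¹(J^{k-1}(A)) → Ω¹ ⊗ J^{k-1}(A)` which corresponds to the splitting `θ ∘ Ψ` of
`J¹(J^{k-1}(A)) → J^{k-1}(A)`. -/
def IsInducedConnection {A : SectionSheaf.{uB, uX, w} B X} (k : ℕ)
    (P : Operator A (symFormsTensor p k A))
    (D : Operator (jets p A k) (formsTensor p (jets p A k))) : Prop :=
  IsRelConnection p D ∧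
  ∃ (φ : BundleHom (jets p A (k + 1)) (symFormsTensor p k A))
    (Ψ : BundleHom (jets p A k) (jets p A (k + 1)))
    (θ : BundleHom (jets p A (k + 1)) (jets p (jets p A k) 2))
    (χ : BundleHom (jets p (jets p A k) 2) (formsTensor p (jets p A k))),
    (∀ x s, φ.map x ((jetOp p A (k + 1)).val x s) = P.val x s) ∧
    (∀ x u, jetProj p A (Nat.le_succ k) x (Ψ.map x u) = u) ∧
    (∀ x u, φ.map x (Ψ.map x u) = 0) ∧
    (∀ x s, θ.map x ((jetOp p A (k + 1)).val x s) =
      (jetOp p (jets p A k) 2).val x ⟨(jetOp p A k).app s.1, (jetOp p A k).hol x s⟩) ∧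
    (∀ x s, χ.map x ((jetOp p (jets p A k) 2).val x s) = D.val x s) ∧
    (∀ x u, χ.map x (θ.map x (Ψ.map x u)) = 0)

/-! ### Second fundamental forms and relative opers -/

/-- Given a subsheaf of `A` with sections `G x` near `x`, say `G`, the sections near `x` of the
smallest subsheaf that contains `G`, that contains the image of `T_{X/S} ⊗ G` under the second
fundamental form of `G`, and for which the quotient of `A` is torsion free: the inverse image of the
torsion of the cokernel of `T_{X/S} ⊗ G → A / G`. -/
def sffStep {A : SectionSheaf.{uB, uX, w} B X} (D : Operator A (formsTensor p A))
    (G : X → Set (∀ y, A.Fib y)) (x : X) : Set (∀ y, A.Fib y) :=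
  {s | A.Hol s x ∧ ∃ f : X → ℂ, HolAt B f x ∧ ¬ (∀ᶠ y in 𝓝 x, f y = 0) ∧
    ∃ t ∈ G x, ∃ (m : ℕ) (v : Fin m → ∀ y, RelTangent p y) (u : Fin m → ∀ y, A.Fib y),
      (∀ i, HolVectorField p (v i) x) ∧ (∀ i, u i ∈ G x) ∧
      ∀ᶠ y in 𝓝 x, f y • s y = t y + ∑ i, contract p (A.Fib y) (v i y) (D.app (u i) y)}

/-- The filtration `0 = F_0 ⊂ F_1 = F ⊂ F_2 ⊂ ⋯` of `A` generated by the second fundamental form of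
the subbundle `F` with respect to `D`. -/
def sffFiltration {A : SectionSheaf.{uB, uX, w} B X} (D : Operator A (formsTensor p A))
    (F : ∀ x, Submodule ℂ (A.Fib x)) : ℕ → ∀ _ : X, Set (∀ y, A.Fib y)
  | 0 => A.sectionsIn fun _ => ⊥
  | 1 => A.sectionsIn F
  | i + 2 => sffStep p D (sffFiltration D F (i + 1))

/-- The fibre at `x` of `W (i + 1) / W i`. -/
abbrev Graded {A : SectionSheaf.{uB, uX, w} B X} (W : ℕ → ∀ x, Submodule ℂ (A.Fib x)) (i : ℕ)
    (x : X) : Type w :=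
  W (i + 1) x ⧸ (W i x).submoduleOf (W (i + 1) x)

/-- `D` maps sections of `W` to sections of `Ω¹_{X/S} ⊗ W'`. -/
def MapsInto {A : SectionSheaf.{uB, uX, w} B X} (D : Operator A (formsTensor p A))
    (W W' : ∀ x, Submodule ℂ (A.Fib x)) : Prop :=
  ∀ (x : X) (s : A.germs x), s.1 ∈ A.sectionsIn W x →
    D.val x s ∈ LinearMap.range (LinearMap.lTensor (RelCotangent p x) (W' x).subtype)

/-- `α` is the map `W (i + 1) / W i → Ω¹_{X/S} ⊗ (W (i + 2) / W (i + 1))` induced by `D`, that is, by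
the second fundamental form of `W (i + 1)`. -/
def IsGradedMap {A : SectionSheaf.{uB, uX, w} B X} (D : Operator A (formsTensor p A))
    (W : ℕ → ∀ x, Submodule ℂ (A.Fib x)) (i : ℕ)
    (α : ∀ x, Graded W i x →ₗ[ℂ] RelCotangent p x ⊗[ℂ] Graded W (i + 1) x) : Prop :=
  ∀ (x : X) (s : A.germs x), s.1 ∈ A.sectionsIn (W (i + 1)) x → ∀ h : s.1 x ∈ W (i + 1) x,
    ∀ τ : RelCotangent p x ⊗[ℂ] W (i + 2) x,
      LinearMap.lTensor (RelCotangent p x) (W (i + 2) x).subtype τ = D.val x s →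
      α x (Submodule.Quotient.mk ⟨s.1 x, h⟩) =
        LinearMap.lTensor (RelCotangent p x)
          ((W (i + 1) x).submoduleOf (W (i + 2) x)).mkQ τ

/-- `(A, D, W)` is a relative oper of length `n`. -/
structure IsRelativeOper (A : SectionSheaf.{uB, uX, w} B X) (D : Operator A (formsTensor p A))
    (n : ℕ) (W : ℕ → ∀ x, Submodule ℂ (A.Fib x)) : Prop where
  isVectorBundle : A.IsVectorBundle
  isRelConnection : IsRelConnection p D
  isSubbundle : ∀ i ≤ n, A.IsSubbundle (W i)
  bot : ∀ x, W 0 x = ⊥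
  top : ∀ x, W n x = ⊤
  mono : ∀ i < n, ∀ x, W i x ≤ W (i + 1) x
  mapsInto : ∀ i, i + 2 ≤ n → MapsInto p D (W (i + 1)) (W (i + 2))
  graded_bijective : ∀ i, i + 2 ≤ n → ∃ α, IsGradedMap p D W i α ∧ ∀ x, Function.Bijective (α x)

/-- `(A, D, W)` is the relative oper of length `n` associated with the second fundamental form of
the subbundle `F` with respect to `D`. -/
structure IsOperOfSFF (A : SectionSheaf.{uB, uX, w} B X) (D : Operator A (formsTensor p A))
    (F : ∀ x, Submodule ℂ (A.Fib x)) (n : ℕ) (W : ℕ → ∀ x, Submodule ℂ (A.Fib x)) : Prop where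
  isRelativeOper : IsRelativeOper p A D n W
  isSubbundle : A.IsSubbundle F
  filtration : ∀ i ≤ n, ∀ x, sffFiltration p D F i x = A.sectionsIn (W i) x

/-- `ι` is the canonical identification at `x` of `Symʲ Ω¹_{X/S} ⊗ A` with `K_{i+1} / K_i` (for
`i + 1 + j = k`), induced by the inclusion of `Symʲ Ω¹_{X/S} ⊗ A` in `Jʲ_{X/S}(A)`: it maps
`d f₀ ⊙ ⋯ ⊙ d f_{j-1} ⊗ s(x)` to the class of the jet at `x` of
`(f₀(x) - f₀) ⋯ (f_{j-1}(x) - f_{j-1}) s`. -/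
def IsGradedIdentification (A : SectionSheaf.{uB, uX, w} B X) (k i j : ℕ) (x : X)
    (ι : (SymmetricPower ℂ (Fin j) (RelCotangent p x) ⊗[ℂ] A.Fib x) ≃ₗ[ℂ]
      Graded (A := jets p A k) (jetKernel p A k) i x) : Prop :=
  ∀ (f : Fin j → FunGerm B x) (s : A.germs x),
    ∃ h : jetAt p A k x (shiftGerm A f s) ∈ jetKernel p A k (i + 1) x,
      ι (SymmetricPower.tprod ℂ (fun a => relDiff p (f a).1 x) ⊗ₜ[ℂ] s.1 x) =
        Submodule.Quotient.mk ⟨jetAt p A k x (shiftGerm A f s), h⟩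

end Relative

end RelOper

end

/-!
Everything is local on `X`, and near a point the situation is completely explicit.  As the fibres
of `π` are curves, there is a fibre coordinate `t` on an open set `U`, with a dual relative vector
field `v` (`FibreCoord`, `exists_fibreCoord`); let `D f = df(v)`.  Iterating Hadamard's lemma, a
function whose derivatives `f, D f, …, Dⁿ⁻¹ f` vanish at `y` is in the ideal generated by
`(t - t(y))ⁿ` and the functions of the base that vanish at `π(y)` (`Flat.exists_eq_pow_mul`).  With
a holomorphic frame of `E` over `U`, the jet of a section is therefore the same thing as the list of
the derivatives of its coordinates: these are the coordinates of a frame of the jet bundle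
(`mem_vanishing_iff`, `jetFrame`).  All the rest is linear algebra in these frames.

*The connection.*  In the top order the bundle map `φ` of `P` is `1 / k!` times the identity, since
the symbol is.  So `φ` together with the projection to `Jᵏ⁻¹` is an isomorphism, which gives the
splitting `Ψ` (`projSymbol_bijective`, `splitting`).  The condition on a connection `∇` means that
`∇ (jᵏ⁻¹ s)` vanishes at every point at which `P s` does (`IsInducedAt`).  Every element of the
fibre of `Jᵏ⁻¹` at `x` is the jet of such an `s`, so the Leibniz identity leaves just one
possibility: `∇` subtracts from the derivative of each coordinate of `u` the next coordinate of
`Ψ u` (`IsInducedAt.co_eq`).  This formula defines `∇` (`inducedConnection`).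

*The oper.*  The subbundle `K_i` is cut out by the vanishing of the coordinates of order less than
`k - i` (`mem_jetKernel_iff`), and `Ψ` does not change the coordinates of order less than `k`.  So
`∇` moves the coordinates of order `j + 1` into those of order `j`, with a sign, up to
differentiation (`ShiftsCoordinates`).  Hence `∇` maps `K_i` to `Ω¹ ⊗ K_{i+1}` and induces minus the
identity, in these coordinates, between consecutive graded pieces.  In the same coordinates the
identification of `Symʲ Ω¹ ⊗ E` with a graded piece is `(-1)ʲ j!` times the identity
(`IsGradedIdentification.gradedEquiv_apply`), and the quotient of the factors for `j + 1` and `j`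
is `-(j + 1)`: the sign is that of the connection, and `j + 1` is the number of terms in the
polarization (`ShiftsCoordinates.gradedMap_eq`).

*The filtration.*  Each step of the filtration generated by the second fundamental form of `K_1`
stays in the next kernel, also after adding torsion, because the germs of holomorphic functions at a
point form a domain and the kernels are cut out by coordinates (`sffStep_subset_sectionsIn`).
Conversely, a section `s` of `K_{i+2}` is, up to a section of `K_{i+1}`, of the form `-∇_v u`, where
`u` in `K_{i+1}` has the lowest coordinates of `s`, raised by one order
(`ShiftsCoordinates.subset_sffStep`).
-/

noncomputable section

namespace RelOper

universe uB uX uC uS uF w w' w''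

/-! ### Division and zeros of analytic functions of several variables -/

section Analytic

variable {B : Type*} [NormedAddCommGroup B] [NormedSpace ℂ B]

/-- Hadamard's lemma for analytic functions: the quotient is the shifted power series. -/
theorem analyticAt_hadamard {f : B → ℂ} {a : B} (hf : AnalyticAt ℂ f a) :
    ∃ g : B → B →L[ℂ] ℂ, AnalyticAt ℂ g a ∧ ∀ᶠ y in 𝓝 a, f y = f a + g y (y - a) := by
  obtain ⟨q, r, hq⟩ := hf
  have hrad : r ≤ q.shift.radius := by
    rw [FormalMultilinearSeries.radius_shift]
    exact hq.r_le
  have hg := (q.shift.hasFPowerSeriesOnBall (hq.r_pos.trans_le hrad)).comp_sub a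
  rw [zero_add] at hg
  refine ⟨fun z => q.shift.sum (z - a), hg.analyticAt, ?_⟩
  have hqq : q.shift.unshift (f a) = q := by
    ext n v
    cases n with
    | zero =>
      have := hq.coeff_zero v
      simp [FormalMultilinearSeries.unshift, this]
    | succ n => simp [FormalMultilinearSeries.unshift, FormalMultilinearSeries.shift]
  have h2 := (hg.mono hq.r_pos hrad).unshift (z := f a)
  rw [hqq] at h2
  filter_upwards [Metric.eball_mem_nhds a hq.r_pos] with y hy
  exact hq.unique h2 hy

/-- The germs of analytic functions at a point form a domain. -/
theorem AnalyticAt.eventually_eq_zero_of_mul_eq_zero {f g : B → ℂ} {a : B}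
    (hf : AnalyticAt ℂ f a) (hg : AnalyticAt ℂ g a) (hfg : ∀ᶠ y in 𝓝 a, f y * g y = 0)
    (hf0 : ¬ ∀ᶠ y in 𝓝 a, f y = 0) : ∀ᶠ y in 𝓝 a, g y = 0 := by
  obtain ⟨r, hr, hball⟩ := Metric.eventually_nhds_iff_ball.1
    ((hf.eventually_analyticAt.and hg.eventually_analyticAt).and hfg)
  have hnot : ¬ ∀ y ∈ Metric.ball a r, f y = 0 := fun h =>
    hf0 (Metric.eventually_nhds_iff_ball.2 ⟨r, hr, h⟩)
  push Not at hnot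
  obtain ⟨z, hz, hfz⟩ := hnot
  have hgz : g =ᶠ[𝓝 z] 0 := by
    filter_upwards [(hball z hz).1.1.continuousAt.eventually_ne hfz,
      Metric.isOpen_ball.mem_nhds hz] with y h1 h2
    exact (mul_eq_zero.1 (hball y h2).2).resolve_left h1
  have := AnalyticOnNhd.eqOn_zero_of_preconnected_of_eventuallyEq_zero
    (fun y hy => (hball y hy).1.2) (convex_ball a r).isPreconnected hz hgz
  exact Metric.eventually_nhds_iff_ball.2 ⟨r, hr, this⟩

end Analytic

section Charts

variable {B : Type uB} [NormedAddCommGroup B] [NormedSpace ℂ B]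
  {X : Type uX} [TopologicalSpace X] [ChartedSpace B X]

theorem holAt_iff_analyticAt [FiniteDimensional ℂ B] {φ : OpenPartialHomeomorph X B}
    (hφ : φ ∈ IsManifold.maximalAtlas 𝓘(ℂ, B) ω X) {z : X} (hz : z ∈ φ.source) {f : X → ℂ} :
    HolAt B f z ↔ AnalyticAt ℂ (f ∘ φ.symm) (φ z) := by
  have h1 : AnalyticAt ℂ (f ∘ φ.symm) (φ z) ↔
      ContMDiffAt 𝓘(ℂ, B) 𝓘(ℂ, ℂ) ω (f ∘ φ.symm) (φ z) := by
    rw [contMDiffAt_iff_contDiffAt, ← contDiffWithinAt_univ,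
      contDiffWithinAt_omega_iff_analyticWithinAt, analyticWithinAt_univ]
  rw [h1]
  have hz' := φ.map_source hz
  constructor
  · intro h
    refine ContMDiffAt.comp (φ z) ?_ (contMDiffAt_symm_of_mem_maximalAtlas hφ hz')
    rwa [φ.left_inv hz]
  · intro h
    have h2 : ContMDiffAt 𝓘(ℂ, B) 𝓘(ℂ, ℂ) ω ((f ∘ φ.symm) ∘ φ) z :=
      ContMDiffAt.comp z h (contMDiffAt_of_mem_maximalAtlas hφ hz)
    refine h2.congr_of_eventuallyEq ?_
    filter_upwards [φ.open_source.mem_nhds hz] with y hy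
    simp [φ.left_inv hy]

/-- The germs of holomorphic functions at a point of a manifold form a domain. -/
theorem HolAt.eventually_eq_zero_of_mul_eq_zero [FiniteDimensional ℂ B] [IsManifold 𝓘(ℂ, B) ω X]
    {f g : X → ℂ} {x : X} (hf : HolAt B f x) (hg : HolAt B g x) (hfg : ∀ᶠ y in 𝓝 x, f y * g y = 0)
    (hf0 : ¬ ∀ᶠ y in 𝓝 x, f y = 0) : ∀ᶠ y in 𝓝 x, g y = 0 := by
  have hφ := IsManifold.chart_mem_maximalAtlas (I := 𝓘(ℂ, B)) (n := ω) x
  set φ := chartAt B x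
  have hx : x ∈ φ.source := mem_chart_source B x
  have key : ∀ h : X → ℂ, (∀ᶠ y in 𝓝 x, h y = 0) ↔ ∀ᶠ b in 𝓝 (φ x), (h ∘ φ.symm) b = 0 := by
    intro h
    have := φ.symm.map_nhds_eq (φ.map_source hx)
    rw [φ.left_inv hx] at this
    rw [← this]
    exact Filter.eventually_map
  rw [key] at hf0 ⊢
  exact AnalyticAt.eventually_eq_zero_of_mul_eq_zero ((holAt_iff_analyticAt hφ hx).1 hf)
    ((holAt_iff_analyticAt hφ hx).1 hg) ((key _).1 hfg) hf0

end Charts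

/-! ### Fibre coordinates of a submersion of relative dimension one -/

section FibreCoord

variable {B : Type uB} [NormedAddCommGroup B] [NormedSpace ℂ B]
  {X : Type uX} [TopologicalSpace X] [ChartedSpace B X]
  {C : Type uC} [NormedAddCommGroup C] [NormedSpace ℂ C]
  {S : Type uS} [TopologicalSpace S] [ChartedSpace C S]

/-- The functions near `y` in the ideal generated by the functions `b ∘ π` with `b` holomorphic
near `π y` and `b (π y) = 0`. -/
def BaseIdeal (p : Family B X C S) (y : X) (q : X → ℂ) : Prop :=
  ∃ (n : ℕ) (b : Fin n → S → ℂ) (h : Fin n → X → ℂ),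
    (∀ i, HolAt C (b i) (p.proj y) ∧ b i (p.proj y) = 0) ∧ (∀ i, HolAt B (h i) y) ∧
    ∀ᶠ z in 𝓝 y, q z = ∑ i, b i (p.proj z) * h i z

/-- A holomorphic coordinate `t` along the fibres of `π` on an open set `U`, together with the dual
relative vector field `v`, the basis of `T_{X/S}` on `U` with `dt(v) = 1`.  That `t` completes a
system of coordinates of the base to one of `X` enters only through Hadamard's lemma: a function
that vanishes at `y ∈ U` is in the ideal generated by `t - t(y)` and by the functions of the base
that vanish at `π(y)`. -/
structure FibreCoord (p : Family B X C S) (U : Set X) where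
  /-- the coordinate -/
  t : X → ℂ
  /-- the dual vector field -/
  v : ∀ y, RelTangent p y
  isOpen : IsOpen U
  t_hol : ∀ y ∈ U, HolAt B t y
  v_hol : ∀ y ∈ U, HolVectorField p v y
  relDiff_t : ∀ y ∈ U, relDiff p t y (v y) = 1
  eq_smul_v : ∀ y ∈ U, ∀ a : RelTangent p y, a = relDiff p t y a • v y
  hadamard : ∀ y ∈ U, ∀ f : X → ℂ, HolAt B f y → ∃ g : X → ℂ, HolAt B g y ∧
    BaseIdeal p y fun z => f z - f y - (t z - t y) * g z

theorem Family.contMDiff (p : Family B X C S) : ContMDiff 𝓘(ℂ, B) 𝓘(ℂ, C) ω p.proj :=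
  p.submersion.contMDiff

variable [IsManifold 𝓘(ℂ, B) ω X]

/-- The coordinate of the line that complements the base directions in the charts of a submersion
is a fibre coordinate. -/
theorem exists_fibreCoord [FiniteDimensional ℂ B] [FiniteDimensional ℂ C] (p : Family B X C S)
    (hdim : Module.finrank ℂ B = Module.finrank ℂ C + 1) (x : X) :
    ∃ U : Set X, x ∈ U ∧ Nonempty (FibreCoord p U) := by
  obtain ⟨L, _, _, hsub⟩ := p.submersion
  replace hsub := hsub x
  obtain ⟨φ, hφdef⟩ : ∃ φ, φ = hsub.domChart := ⟨_, rfl⟩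
  obtain ⟨ψ, hψdef⟩ : ∃ ψ, ψ = hsub.codChart := ⟨_, rfl⟩
  have hφ : φ ∈ IsManifold.maximalAtlas 𝓘(ℂ, B) ω X := hφdef ▸ hsub.domChart_mem_maximalAtlas
  have hψ : ψ ∈ IsManifold.maximalAtlas 𝓘(ℂ, C) ω S := hψdef ▸ hsub.codChart_mem_maximalAtlas
  have hx : x ∈ φ.source := hφdef ▸ hsub.mem_domChart_source
  have hsrc : ∀ z ∈ φ.source, p.proj z ∈ ψ.source := by
    rw [hφdef, hψdef]
    exact hsub.mapsto_domChart_source_codChart_source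
  obtain ⟨e, he⟩ : ∃ e : B ≃L[ℂ] (C × L), ∀ z ∈ φ.source, ψ (p.proj z) = (e (φ z)).1 := by
    refine ⟨hsub.equiv, fun z hz => ?_⟩
    have hz' := hz
    rw [hφdef] at hz'
    have := hsub.writtenInCharts
      (show hsub.domChart z ∈ _ by simpa using hsub.domChart.map_source hz')
    simpa [hφdef, hψdef, hsub.domChart.left_inv hz'] using this
  clear hφdef hψdef
  -- the complement of the base directions is a line
  have hL : Module.finrank ℂ L = 1 := by
    have : FiniteDimensional ℂ (C × L) := e.toLinearEquiv.finiteDimensional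
    have : FiniteDimensional ℂ L :=
      Module.Finite.of_surjective (LinearMap.snd ℂ C L) LinearMap.snd_surjective
    have := e.toLinearEquiv.finrank_eq
    rw [Module.finrank_prod, hdim] at this
    omega
  have : FiniteDimensional ℂ L := Module.finite_of_finrank_eq_succ hL
  obtain ⟨w⟩ : Nonempty (L ≃L[ℂ] ℂ) :=
    FiniteDimensional.nonempty_continuousLinearEquiv_of_finrank_eq (by simp [hL])
  set n₀ : B := e.symm (0, w.symm 1) with hn₀
  let τ : B →L[ℂ] ℂ := (w : L →L[ℂ] ℂ) ∘L ContinuousLinearMap.snd ℂ C L ∘L (e : B →L[ℂ] C × L)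
  have hτ : ∀ b, τ b = w (e b).2 := fun _ => rfl
  have hτn : τ n₀ = 1 := by simp [hτ, hn₀]
  have hdec : ∀ b : B, (e b).1 = 0 → b = τ b • n₀ := by
    intro b hb
    apply e.injective
    rw [map_smul, hn₀, e.apply_symm_apply, hτ]
    refine Prod.ext (by simpa using hb) ?_
    apply w.injective
    simp
  -- differentials in the charts
  have hφd : ∀ z ∈ φ.source, MDifferentiableAt 𝓘(ℂ, B) 𝓘(ℂ, B) φ z := fun z hz =>
    (contMDiffAt_of_mem_maximalAtlas hφ hz).mdifferentiableAt (by simp)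
  have hφm : φ.MDifferentiable 𝓘(ℂ, B) 𝓘(ℂ, B) :=
    ⟨fun z hz => (hφd z hz).mdifferentiableWithinAt, fun z hz =>
      ((contMDiffAt_symm_of_mem_maximalAtlas hφ hz).mdifferentiableAt
        (by simp)).mdifferentiableWithinAt⟩
  have hψm : ψ.MDifferentiable 𝓘(ℂ, C) 𝓘(ℂ, C) :=
    ⟨fun z hz => ((contMDiffAt_of_mem_maximalAtlas hψ hz).mdifferentiableAt
        (by simp)).mdifferentiableWithinAt, fun z hz =>
      ((contMDiffAt_symm_of_mem_maximalAtlas hψ hz).mdifferentiableAt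
        (by simp)).mdifferentiableWithinAt⟩
  -- differentials of functions and of `π` in terms of the differential of the chart
  have hfun : ∀ z ∈ φ.source, ∀ f : X → ℂ, HolAt B f z → ∀ a : TangentSpace 𝓘(ℂ, B) z,
      mfderiv 𝓘(ℂ, B) 𝓘(ℂ, ℂ) f z a =
        fderiv ℂ (f ∘ φ.symm) (φ z) (mfderiv 𝓘(ℂ, B) 𝓘(ℂ, B) φ z a) := by
    intro z hz f hf a
    have h1 : f =ᶠ[𝓝 z] (f ∘ φ.symm) ∘ φ := by
      filter_upwards [φ.open_source.mem_nhds hz] with y hy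
      simp [φ.left_inv hy]
    have h2 := ((holAt_iff_analyticAt hφ hz).1 hf).differentiableAt
    rw [h1.mfderiv_eq, mfderiv_comp z h2.mdifferentiableAt (hφd z hz), mfderiv_eq_fderiv]
    rfl
  have hker : ∀ z ∈ φ.source, ∀ a : TangentSpace 𝓘(ℂ, B) z,
      a ∈ RelTangent p z ↔ (e (mfderiv 𝓘(ℂ, B) 𝓘(ℂ, B) φ z a)).1 = 0 := by
    intro z hz a
    have h1 : ψ ∘ p.proj =ᶠ[𝓝 z] (fun b => (e b).1) ∘ φ := by
      filter_upwards [φ.open_source.mem_nhds hz] with y hy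
      exact he y hy
    have h2 : mfderiv 𝓘(ℂ, B) 𝓘(ℂ, C) (ψ ∘ p.proj) z a =
        mfderiv 𝓘(ℂ, C) 𝓘(ℂ, C) ψ (p.proj z) (mfderiv 𝓘(ℂ, B) 𝓘(ℂ, C) p.proj z a) := by
      rw [mfderiv_comp z (hψm.mdifferentiableAt (hsrc z hz))
        ((p.contMDiff z).mdifferentiableAt (by simp))]
      rfl
    let fe : B →L[ℂ] C := ContinuousLinearMap.fst ℂ C L ∘L (e : B →L[ℂ] C × L)
    have h3 : mfderiv 𝓘(ℂ, B) 𝓘(ℂ, C) (ψ ∘ p.proj) z a =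
        (e (mfderiv 𝓘(ℂ, B) 𝓘(ℂ, B) φ z a)).1 := by
      have h4 : mfderiv 𝓘(ℂ, B) 𝓘(ℂ, C) (fun b => (e b).1) (φ z) = fe := by
        rw [mfderiv_eq_fderiv]
        exact fe.fderiv
      have h5 : MDifferentiableAt 𝓘(ℂ, B) 𝓘(ℂ, C) (fun b => (e b).1) (φ z) :=
        fe.differentiableAt.mdifferentiableAt
      rw [h1.mfderiv_eq, mfderiv_comp z h5 (hφd z hz), h4]
      rfl
    rw [← h3, h2]
    exact (map_eq_zero_iff _ (hψm.mfderiv_injective (hsrc z hz))).symm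
  -- the vector field dual to the coordinate
  have hvex : ∀ z : X, ∃ a : RelTangent p z, z ∈ φ.source →
      mfderiv 𝓘(ℂ, B) 𝓘(ℂ, B) φ z a.1 = n₀ := by
    intro z
    by_cases hz : z ∈ φ.source
    · obtain ⟨a, ha⟩ := hφm.mfderiv_surjective hz n₀
      refine ⟨⟨a, (hker z hz a).2 ?_⟩, fun _ => ha⟩
      rw [ha]
      simp [hn₀]
    · exact ⟨0, fun h => absurd h hz⟩
  choose v hv using hvex
  have hlin : ∀ z ∈ φ.source, HolAt B (fun y => τ (φ y)) z := fun z hz =>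
    ContMDiffAt.comp z (g := fun b => τ b) τ.contDiff.contMDiff.contMDiffAt
      (contMDiffAt_of_mem_maximalAtlas hφ hz)
  have htd : ∀ z ∈ φ.source, ∀ a : RelTangent p z,
      relDiff p (fun y => τ (φ y)) z a = τ (mfderiv 𝓘(ℂ, B) 𝓘(ℂ, B) φ z a.1) := by
    intro z hz a
    have h1 : (fun y => τ (φ y)) ∘ φ.symm =ᶠ[𝓝 (φ z)] τ := by
      filter_upwards [φ.open_target.mem_nhds (φ.map_source hz)] with b hb
      simp [φ.right_inv hb]
    have := hfun z hz _ (hlin z hz) a.1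
    rw [h1.fderiv_eq, τ.fderiv] at this
    exact this
  refine ⟨φ.source, hx, ⟨?_⟩⟩
  refine
    { t := fun y => τ (φ y)
      v := v
      isOpen := φ.open_source
      t_hol := hlin
      v_hol := ?_
      relDiff_t := ?_
      eq_smul_v := ?_
      hadamard := ?_ }
  · intro z hz f hf
    have hev : (fun y => relDiff p f y (v y)) =ᶠ[𝓝 z]
        fun y => fderiv ℂ (f ∘ φ.symm) (φ y) n₀ := by
      filter_upwards [φ.open_source.mem_nhds hz, hf.eventually] with y hy hfy
      have := hfun y hy f hfy (v y).1
      rw [hv y hy] at this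
      exact this
    have h1 : AnalyticAt ℂ (fun b => fderiv ℂ (f ∘ φ.symm) b n₀) (φ z) :=
      (ContinuousLinearMap.apply ℂ ℂ n₀).analyticAt _ |>.comp
        ((holAt_iff_analyticAt hφ hz).1 hf).fderiv
    refine ContMDiffAt.congr_of_eventuallyEq ?_ hev
    exact ContMDiffAt.comp z (g := fun b => fderiv ℂ (f ∘ φ.symm) b n₀)
      h1.contDiffAt.contMDiffAt (contMDiffAt_of_mem_maximalAtlas hφ hz)
  · intro z hz
    rw [htd z hz, hv z hz, hτn]
  · intro z hz a
    rw [htd z hz]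
    apply Subtype.ext
    apply hφm.mfderiv_injective hz
    have h1 := hdec _ ((hker z hz a.1).1 a.2)
    rw [Submodule.coe_smul, map_smul, hv z hz]
    exact h1
  -- Hadamard's lemma in the chart, with the increment split into its components along the fibre and
  -- along the base
  · intro y hy f hf
    obtain ⟨g, hg, hfg⟩ := analyticAt_hadamard ((holAt_iff_analyticAt hφ hy).1 hf)
    have hgc : ∀ b : B, HolAt B (fun z => g (φ z) b) y := fun b =>
      ContMDiffAt.comp y (g := fun b' => g b' b)
        ((ContinuousLinearMap.apply ℂ ℂ b).analyticAt _ |>.comp hg).contDiffAt.contMDiffAt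
        (contMDiffAt_of_mem_maximalAtlas hφ hy)
    let bs := Module.finBasis ℂ C
    refine ⟨fun z => g (φ z) n₀, hgc n₀, Module.finrank ℂ C,
      fun i s => bs.coord i (ψ s - ψ (p.proj y)), fun i z => g (φ z) (e.symm (bs i, 0)),
      fun i => ⟨?_, by simp⟩, fun i => hgc _, ?_⟩
    · have h1 : ContDiff ℂ ω (fun c => (bs.coord i).toContinuousLinearMap (c - ψ (p.proj y))) :=
        (bs.coord i).toContinuousLinearMap.contDiff.comp (contDiff_id.sub contDiff_const)
      exact ContMDiffAt.comp (p.proj y) (g := fun c => bs.coord i (c - ψ (p.proj y)))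
        h1.contMDiff.contMDiffAt (contMDiffAt_of_mem_maximalAtlas hψ (hsrc y hy))
    · have hcont := (contMDiffAt_of_mem_maximalAtlas hφ hy).continuousAt.eventually hfg
      filter_upwards [hcont, φ.open_source.mem_nhds hy] with z hz hzs
      simp only [Function.comp_apply, φ.left_inv hzs, φ.left_inv hy] at hz
      rw [hz, add_sub_cancel_left, sub_eq_iff_eq_add']
      have hsplit : φ z - φ y = (τ (φ z) - τ (φ y)) • n₀ +
          ∑ i, bs.coord i (ψ (p.proj z) - ψ (p.proj y)) • e.symm (bs i, 0) := by
        apply e.injective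
        simp only [map_add, map_smul, map_sum, hn₀, e.apply_symm_apply, map_sub]
        refine Prod.ext ?_ ?_
        · simp only [Prod.fst_add, Prod.smul_fst, smul_zero, zero_add, Prod.fst_sum, he z hzs,
            he y hy]
          simp only [← map_sub (bs.coord _)]
          exact (bs.sum_repr _).symm
        · simp only [Prod.snd_add, Prod.smul_snd, smul_zero, Prod.snd_sum,
            Finset.sum_const_zero, add_zero, Prod.snd_sub]
          apply w.injective
          simp [hτ]
      conv_lhs => rw [hsplit]
      simp [map_add, map_sum]

end FibreCoord

/-! ### Rules for holomorphic functions and relative differentials -/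

section Rules

variable {B : Type uB} [NormedAddCommGroup B] [NormedSpace ℂ B]
  {X : Type uX} [TopologicalSpace X] [ChartedSpace B X]
  {C : Type uC} [NormedAddCommGroup C] [NormedSpace ℂ C]
  {S : Type uS} [TopologicalSpace S] [ChartedSpace C S]

theorem HolAt.add {f g : X → ℂ} {x : X} (hf : HolAt B f x) (hg : HolAt B g x) :
    HolAt B (fun y => f y + g y) x :=
  ContMDiffAt.add hf hg

theorem HolAt.neg {f : X → ℂ} {x : X} (hf : HolAt B f x) : HolAt B (fun y => - f y) x := by
  simpa using (HolAt.const (-1) x).mul hf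

theorem HolAt.congr {f g : X → ℂ} {x : X} (hf : HolAt B f x) (h : f =ᶠ[𝓝 x] g) : HolAt B g x :=
  ContMDiffAt.congr_of_eventuallyEq hf h.symm

theorem HolAt.finsetSum {ι : Type*} (s : Finset ι) {f : ι → X → ℂ} {x : X}
    (hf : ∀ i, HolAt B (f i) x) : HolAt B (fun y => ∑ i ∈ s, f i y) x := by
  classical
  induction s using Finset.induction_on with
  | empty => simpa using HolAt.const 0 x
  | insert a s ha ih =>
    simp only [Finset.sum_insert ha]
    exact (hf a).add ih

theorem HolAt.pow {f : X → ℂ} {x : X} (hf : HolAt B f x) (n : ℕ) :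
    HolAt B (fun y => f y ^ n) x := by
  induction n with
  | zero => simpa using HolAt.const 1 x
  | succ n ih =>
    simp only [pow_succ]
    exact ih.mul hf

theorem HolAt.mdifferentiableAt {f : X → ℂ} {x : X} (hf : HolAt B f x) :
    MDifferentiableAt 𝓘(ℂ, B) 𝓘(ℂ, ℂ) f x :=
  ContMDiffAt.mdifferentiableAt hf (by simp)

variable (p : Family B X C S)

theorem HolAt.comp_proj {p : Family B X C S} {b : S → ℂ} {y : X} (hb : HolAt C b (p.proj y)) :
    HolAt B (fun z => b (p.proj z)) y :=
  ContMDiffAt.comp y hb (p.contMDiff y)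

theorem relDiff_congr {f g : X → ℂ} {x : X} (h : f =ᶠ[𝓝 x] g) :
    relDiff p f x = relDiff p g x := by
  unfold relDiff
  rw [h.mfderiv_eq]

theorem relDiff_const (a : ℂ) (x : X) : relDiff p (fun _ => a) x = 0 := by
  unfold relDiff
  rw [mfderiv_const]
  rfl

theorem relDiff_add {f g : X → ℂ} {x : X} (hf : HolAt B f x) (hg : HolAt B g x) :
    relDiff p (fun y => f y + g y) x = relDiff p f x + relDiff p g x := by
  have h := (hf.mdifferentiableAt.hasMFDerivAt.add hg.mdifferentiableAt.hasMFDerivAt).mfderiv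
  ext a
  exact congrArg (fun L => L a.1) h

theorem relDiff_mul {f g : X → ℂ} {x : X} (hf : HolAt B f x) (hg : HolAt B g x) :
    relDiff p (fun y => f y * g y) x = f x • relDiff p g x + g x • relDiff p f x := by
  have h := (hf.mdifferentiableAt.hasMFDerivAt.mul hg.mdifferentiableAt.hasMFDerivAt).mfderiv
  ext a
  exact congrArg (fun L => L a.1) h

/-- The relative differential annihilates the functions of the base. -/
theorem relDiff_comp_proj {b : S → ℂ} {x : X} (hb : HolAt C b (p.proj x)) :
    relDiff p (fun z => b (p.proj z)) x = 0 := by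
  have h : mfderiv 𝓘(ℂ, B) 𝓘(ℂ, ℂ) (b ∘ p.proj) x =
      (mfderiv 𝓘(ℂ, C) 𝓘(ℂ, ℂ) b (p.proj x)).comp (mfderiv 𝓘(ℂ, B) 𝓘(ℂ, C) p.proj x) :=
    mfderiv_comp x hb.mdifferentiableAt ((p.contMDiff x).mdifferentiableAt (by simp))
  ext a
  have h2 := congrArg (fun L => L a.1) h
  have h3 : mfderiv 𝓘(ℂ, B) 𝓘(ℂ, C) p.proj x a.1 = 0 := a.2
  change mfderiv 𝓘(ℂ, B) 𝓘(ℂ, ℂ) (b ∘ p.proj) x a.1 = 0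
  rw [h]
  change (mfderiv 𝓘(ℂ, C) 𝓘(ℂ, ℂ) b (p.proj x)) (mfderiv 𝓘(ℂ, B) 𝓘(ℂ, C) p.proj x a.1) = 0
  rw [h3, map_zero]

theorem BaseIdeal.congr {p : Family B X C S} {y : X} {q q' : X → ℂ} (h : BaseIdeal p y q)
    (hq : q =ᶠ[𝓝 y] q') : BaseIdeal p y q' := by
  obtain ⟨n, b, g, hb, hg, hs⟩ := h
  refine ⟨n, b, g, hb, hg, ?_⟩
  filter_upwards [hs, hq] with z h1 h2
  rw [← h2, h1]

theorem BaseIdeal.add {p : Family B X C S} {y : X} {q q' : X → ℂ} (h : BaseIdeal p y q)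
    (h' : BaseIdeal p y q') : BaseIdeal p y fun z => q z + q' z := by
  obtain ⟨n, b, g, hb, hg, hs⟩ := h
  obtain ⟨n', b', g', hb', hg', hs'⟩ := h'
  refine ⟨n + n', Fin.append b b', Fin.append g g', ?_, ?_, ?_⟩
  · intro i
    refine Fin.addCases (fun i => ?_) (fun i => ?_) i
    · simpa using hb i
    · simpa using hb' i
  · intro i
    refine Fin.addCases (fun i => ?_) (fun i => ?_) i
    · simpa using hg i
    · simpa using hg' i
  · filter_upwards [hs, hs'] with z h1 h2
    rw [h1, h2, Fin.sum_univ_add]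
    simp

theorem BaseIdeal.mul {p : Family B X C S} {y : X} {f q : X → ℂ} (hf : HolAt B f y)
    (h : BaseIdeal p y q) : BaseIdeal p y fun z => f z * q z := by
  obtain ⟨n, b, g, hb, hg, hs⟩ := h
  refine ⟨n, b, fun i z => f z * g i z, hb, fun i => hf.mul (hg i), ?_⟩
  filter_upwards [hs] with z h1
  rw [h1, Finset.mul_sum]
  exact Finset.sum_congr rfl fun i _ => by ring

end Rules

/-! ### Derivatives along the fibres and Taylor expansions -/

namespace FibreCoord

variable {B : Type uB} [NormedAddCommGroup B] [NormedSpace ℂ B]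
  {X : Type uX} [TopologicalSpace X] [ChartedSpace B X]
  {C : Type uC} [NormedAddCommGroup C] [NormedSpace ℂ C]
  {S : Type uS} [TopologicalSpace S] [ChartedSpace C S]
  {p : Family B X C S} {U : Set X} (c : FibreCoord p U)

/-- The derivative of a function with respect to the fibre coordinate. -/
def D (f : X → ℂ) : X → ℂ := fun z => relDiff p f z (c.v z)

/-- The function `(t - w) ^ m / m!`. -/
def mono (w : ℂ) (m : ℕ) : X → ℂ := fun z => ((m.factorial : ℂ)⁻¹) * (c.t z - w) ^ m

/-- The first `n` derivatives of `f` along the fibre, those of order `0, …, n - 1`, vanish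
at `y`. -/
def Flat (n : ℕ) (f : X → ℂ) (y : X) : Prop := ∀ m < n, c.D^[m] f y = 0

theorem mem_nhds (c : FibreCoord p U) {y : X} (hy : y ∈ U) : U ∈ 𝓝 y := c.isOpen.mem_nhds hy

theorem D_congr {f g : X → ℂ} {y : X} (h : f =ᶠ[𝓝 y] g) : c.D f =ᶠ[𝓝 y] c.D g := by
  filter_upwards [eventually_eventually_nhds.2 h] with z hz
  exact congrArg (fun L => L (c.v z)) (relDiff_congr p hz)

theorem iter_congr {f g : X → ℂ} {y : X} (h : f =ᶠ[𝓝 y] g) (n : ℕ) :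
    c.D^[n] f =ᶠ[𝓝 y] c.D^[n] g := by
  induction n generalizing f g with
  | zero => exact h
  | succ n ih => exact ih (c.D_congr h)

theorem D_hol {f : X → ℂ} {y : X} (hy : y ∈ U) (hf : HolAt B f y) : HolAt B (c.D f) y :=
  c.v_hol y hy f hf

theorem iter_hol {f : X → ℂ} {y : X} (hy : y ∈ U) (hf : HolAt B f y) (n : ℕ) :
    HolAt B (c.D^[n] f) y := by
  induction n generalizing f with
  | zero => exact hf
  | succ n ih => exact ih (c.D_hol hy hf)

theorem mono_hol {y : X} (hy : y ∈ U) (w : ℂ) (m : ℕ) : HolAt B (c.mono w m) y :=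
  (HolAt.const _ y).mul (((c.t_hol y hy).sub (HolAt.const w y)).pow m)

theorem D_const (a : ℂ) : c.D (fun _ => a) = fun _ => 0 := by
  funext z
  simp [D, relDiff_const]

theorem iter_zero (n : ℕ) : c.D^[n] (fun _ => 0) = fun _ => 0 := by
  induction n with
  | zero => rfl
  | succ n ih => rw [Function.iterate_succ_apply, D_const, ih]

theorem D_t {y : X} (hy : y ∈ U) : c.D c.t =ᶠ[𝓝 y] fun _ => 1 := by
  filter_upwards [c.mem_nhds hy] with z hz using c.relDiff_t z hz

theorem cotangent_eq {y : X} (hy : y ∈ U) (η : RelCotangent p y) :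
    η = η (c.v y) • relDiff p c.t y := by
  ext a
  conv_lhs => rw [c.eq_smul_v y hy a]
  simp [mul_comm]

variable [IsManifold 𝓘(ℂ, B) ω X]

theorem D_add {f g : X → ℂ} {y : X} (hf : HolAt B f y) (hg : HolAt B g y) :
    c.D (fun z => f z + g z) =ᶠ[𝓝 y] fun z => c.D f z + c.D g z := by
  filter_upwards [hf.eventually, hg.eventually] with z h1 h2
  simp [D, relDiff_add p h1 h2]

theorem D_mul {f g : X → ℂ} {y : X} (hf : HolAt B f y) (hg : HolAt B g y) :
    c.D (fun z => f z * g z) =ᶠ[𝓝 y] fun z => c.D f z * g z + f z * c.D g z := by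
  filter_upwards [hf.eventually, hg.eventually] with z h1 h2
  simp [D, relDiff_mul p h1 h2]
  ring

theorem D_const_mul {f : X → ℂ} {y : X} (a : ℂ) (hf : HolAt B f y) :
    c.D (fun z => a * f z) =ᶠ[𝓝 y] fun z => a * c.D f z := by
  filter_upwards [c.D_mul (HolAt.const a y) hf] with z h
  rw [h, D_const]
  ring

theorem D_comp_proj_mul [IsManifold 𝓘(ℂ, C) ω S] {b : S → ℂ} {f : X → ℂ} {y : X}
    (hb : HolAt C b (p.proj y)) (hf : HolAt B f y) :
    c.D (fun z => b (p.proj z) * f z) =ᶠ[𝓝 y] fun z => b (p.proj z) * c.D f z := by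
  filter_upwards [c.D_mul hb.comp_proj hf,
    ((p.contMDiff y).continuousAt.eventually hb.eventually)] with z h1 h2
  rw [h1]
  simp [D, relDiff_comp_proj p h2]

theorem iter_add {f g : X → ℂ} {y : X} (hy : y ∈ U) (hf : HolAt B f y) (hg : HolAt B g y)
    (n : ℕ) : c.D^[n] (fun z => f z + g z) =ᶠ[𝓝 y] fun z => c.D^[n] f z + c.D^[n] g z := by
  induction n generalizing f g with
  | zero => rfl
  | succ n ih =>
    exact (c.iter_congr (c.D_add hf hg) n).trans (ih (c.D_hol hy hf) (c.D_hol hy hg))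

theorem iter_const_mul {f : X → ℂ} {y : X} (hy : y ∈ U) (a : ℂ) (hf : HolAt B f y)
    (n : ℕ) : c.D^[n] (fun z => a * f z) =ᶠ[𝓝 y] fun z => a * c.D^[n] f z := by
  induction n generalizing f with
  | zero => rfl
  | succ n ih => exact (c.iter_congr (c.D_const_mul a hf) n).trans (ih (c.D_hol hy hf))

theorem iter_sum {ι : Type*} (s : Finset ι) {f : ι → X → ℂ} {y : X} (hy : y ∈ U)
    (hf : ∀ i, HolAt B (f i) y) (n : ℕ) :
    c.D^[n] (fun z => ∑ i ∈ s, f i z) =ᶠ[𝓝 y] fun z => ∑ i ∈ s, c.D^[n] (f i) z := by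
  classical
  induction s using Finset.induction_on with
  | empty => simp [iter_zero]
  | insert a s ha ih =>
    simp only [Finset.sum_insert ha]
    refine (c.iter_add hy (hf a) (HolAt.finsetSum s hf) n).trans ?_
    filter_upwards [ih] with z hz
    rw [hz]

/-! #### Orders of vanishing along the fibre -/

section Flat

variable {y : X} {f g : X → ℂ} {n : ℕ}

omit [IsManifold 𝓘(ℂ, B) ω X]

theorem flat_succ : c.Flat (n + 1) f y ↔ f y = 0 ∧ c.Flat n (c.D f) y := by
  constructor
  · intro h
    exact ⟨h 0 (Nat.succ_pos n), fun m hm => h (m + 1) (Nat.succ_lt_succ hm)⟩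
  · rintro ⟨h0, h1⟩ m hm
    cases m with
    | zero => exact h0
    | succ m => exact h1 m (Nat.lt_of_succ_lt_succ hm)

theorem flat_zero : c.Flat 0 f y := fun _ h => absurd h (Nat.not_lt_zero _)

theorem Flat.mono {c : FibreCoord p U} {m : ℕ} (h : c.Flat n f y) (hmn : m ≤ n) : c.Flat m f y :=
  fun i hi => h i (hi.trans_le hmn)

theorem Flat.congr {c : FibreCoord p U} (h : c.Flat n f y) (hfg : f =ᶠ[𝓝 y] g) : c.Flat n g y :=
  fun m hm => by rw [← (c.iter_congr hfg m).eq_of_nhds, h m hm]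

end Flat

theorem Flat.add {c : FibreCoord p U} {y : X} {f g : X → ℂ} {n : ℕ} (hy : y ∈ U)
    (hf : HolAt B f y) (hg : HolAt B g y) (hf' : c.Flat n f y) (hg' : c.Flat n g y) :
    c.Flat n (fun z => f z + g z) y := fun m hm => by
  rw [(c.iter_add hy hf hg m).eq_of_nhds, hf' m hm, hg' m hm, add_zero]

theorem Flat.mul {c : FibreCoord p U} {y : X} {f g : X → ℂ} {n : ℕ} (hy : y ∈ U)
    (hg : HolAt B g y) (hf : HolAt B f y) (h : c.Flat n f y) :
    c.Flat n (fun z => g z * f z) y := by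
  induction n generalizing f g with
  | zero => exact c.flat_zero
  | succ n ih =>
    have h' := (c.flat_succ).1 h
    refine (c.flat_succ).2 ⟨by simp [h'.1], ?_⟩
    refine Flat.congr ?_ (c.D_mul hg hf).symm
    exact Flat.add hy ((c.D_hol hy hg).mul hf) (hg.mul (c.D_hol hy hf))
      (ih (c.D_hol hy hg) hf (h.mono n.le_succ)) (ih hg (c.D_hol hy hf) h'.2)

/-- The product with a function that vanishes at `y` raises the order of vanishing by one. -/
theorem Flat.mul_of_eq_zero {c : FibreCoord p U} {y : X} {f g : X → ℂ} {n : ℕ} (hy : y ∈ U)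
    (hg : HolAt B g y) (hg0 : g y = 0) (hf : HolAt B f y) (h : c.Flat n f y) :
    c.Flat (n + 1) (fun z => g z * f z) y := by
  induction n generalizing f with
  | zero => exact (c.flat_succ).2 ⟨by simp [hg0], c.flat_zero⟩
  | succ n ih =>
    refine (c.flat_succ).2 ⟨by simp [hg0], ?_⟩
    refine Flat.congr ?_ (c.D_mul hg hf).symm
    exact Flat.add hy ((c.D_hol hy hg).mul hf) (hg.mul (c.D_hol hy hf))
      (Flat.mul hy (c.D_hol hy hg) hf h) (ih (c.D_hol hy hf) ((c.flat_succ).1 h).2)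

theorem Flat.comp_proj_mul [IsManifold 𝓘(ℂ, C) ω S] {c : FibreCoord p U} {y : X} {b : S → ℂ}
    {f : X → ℂ} (hy : y ∈ U) (hb : HolAt C b (p.proj y)) (hb0 : b (p.proj y) = 0)
    (hf : HolAt B f y) (n : ℕ) : c.Flat n (fun z => b (p.proj z) * f z) y := by
  induction n generalizing f with
  | zero => exact c.flat_zero
  | succ n ih =>
    exact (c.flat_succ).2 ⟨by simp [hb0],
      Flat.congr (ih (c.D_hol hy hf)) (c.D_comp_proj_mul hb hf).symm⟩

theorem iter_mul_of_flat {y : X} {f g : X → ℂ} {n : ℕ} (hy : y ∈ U) (hg : HolAt B g y)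
    (hf : HolAt B f y) (h : c.Flat n f y) :
    c.D^[n] (fun z => g z * f z) y = g y * c.D^[n] f y := by
  induction n generalizing f g with
  | zero => rfl
  | succ n ih =>
    rw [Function.iterate_succ_apply, Function.iterate_succ_apply,
      (c.iter_congr (c.D_mul hg hf) n).eq_of_nhds,
      (c.iter_add hy ((c.D_hol hy hg).mul hf) (hg.mul (c.D_hol hy hf)) n).eq_of_nhds,
      Flat.mul hy (c.D_hol hy hg) hf h n n.lt_succ_self, zero_add,
      ih hg (c.D_hol hy hf) ((c.flat_succ).1 h).2]

/-- The first derivative of a product that need not vanish: one derivative falls on `g`, in one of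
`n + 1` ways. -/
theorem iter_mul_of_flat_of_eq_zero {y : X} {f g : X → ℂ} {n : ℕ} (hy : y ∈ U) (hg : HolAt B g y)
    (hg0 : g y = 0) (hf : HolAt B f y) (h : c.Flat n f y) :
    c.D^[n + 1] (fun z => g z * f z) y = (n + 1) * (c.D g y * c.D^[n] f y) := by
  induction n generalizing f with
  | zero =>
    simp [(c.D_mul hg hf).eq_of_nhds, hg0]
  | succ n ih =>
    rw [Function.iterate_succ_apply, (c.iter_congr (c.D_mul hg hf) (n + 1)).eq_of_nhds,
      (c.iter_add hy ((c.D_hol hy hg).mul hf) (hg.mul (c.D_hol hy hf)) (n + 1)).eq_of_nhds,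
      c.iter_mul_of_flat hy (c.D_hol hy hg) hf h,
      ih (c.D_hol hy hf) ((c.flat_succ).1 h).2, ← Function.iterate_succ_apply]
    push_cast
    ring

theorem flat_prod_mul {y : X} {n : ℕ} {g : Fin n → X → ℂ} {f : X → ℂ} (hy : y ∈ U)
    (hg : ∀ a, HolAt B (g a) y) (hg0 : ∀ a, g a y = 0) (hf : HolAt B f y) :
    c.Flat n (fun z => (∏ a, g a z) * f z) y := by
  induction n with
  | zero => exact c.flat_zero
  | succ n ih =>
    simp only [Fin.prod_univ_succ, mul_assoc]
    exact Flat.mul_of_eq_zero hy (hg 0) (hg0 0) ((HolAt.prod fun a => hg a.succ).mul hf)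
      (ih (fun a => hg a.succ) (fun a => hg0 a.succ))

/-- In the derivative of order `n` of a product with `n` factors vanishing at `y`, only the `n!`
terms survive in which every such factor is differentiated once. -/
theorem iter_prod_mul {y : X} {n : ℕ} {g : Fin n → X → ℂ} {f : X → ℂ} (hy : y ∈ U)
    (hg : ∀ a, HolAt B (g a) y) (hg0 : ∀ a, g a y = 0) (hf : HolAt B f y) :
    c.D^[n] (fun z => (∏ a, g a z) * f z) y =
      n.factorial * ((∏ a, c.D (g a) y) * f y) := by
  induction n with
  | zero => simp
  | succ n ih =>
    simp only [Fin.prod_univ_succ, mul_assoc]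
    rw [c.iter_mul_of_flat_of_eq_zero hy (hg 0) (hg0 0) ((HolAt.prod fun a => hg a.succ).mul hf)
      (c.flat_prod_mul hy (fun a => hg a.succ) (fun a => hg0 a.succ) hf),
      ih (fun a => hg a.succ) (fun a => hg0 a.succ), Nat.factorial_succ]
    push_cast
    ring

/-! #### Taylor expansion -/

theorem D_mono_succ {y : X} (hy : y ∈ U) (w : ℂ) (m : ℕ) :
    c.D (c.mono w (m + 1)) =ᶠ[𝓝 y] c.mono w m := by
  have ht : HolAt B (fun z => c.t z - w) y := (c.t_hol y hy).sub (HolAt.const w y)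
  have hDt : c.D (fun z => c.t z - w) =ᶠ[𝓝 y] fun _ => 1 := by
    have h := c.D_add (c.t_hol y hy) (HolAt.const (-w) y)
    filter_upwards [h, c.D_t hy] with z h1 h2
    simp only [← sub_eq_add_neg] at h1
    rw [h1, h2, D_const, add_zero]
  have hpow : ∀ m : ℕ, c.D (fun z => (c.t z - w) ^ (m + 1)) =ᶠ[𝓝 y]
      fun z => (m + 1) * (c.t z - w) ^ m := by
    intro m
    induction m with
    | zero => simpa using hDt
    | succ m ih =>
      filter_upwards [c.D_mul (ht.pow (m + 1)) ht, ih, hDt] with z h1 h2 h3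
      simp only [← pow_succ] at h1
      rw [h1, h2, h3]
      push_cast
      ring
  have h4 := c.D_const_mul (((m + 1).factorial : ℂ)⁻¹) (ht.pow (m + 1))
  filter_upwards [h4, hpow m] with z h5 h6
  have h7 : ((m + 1 : ℕ) : ℂ) ≠ 0 := Nat.cast_ne_zero.2 m.succ_ne_zero
  have h8 : (m.factorial : ℂ) ≠ 0 := Nat.cast_ne_zero.2 m.factorial_ne_zero
  unfold mono
  rw [h5, h6, Nat.factorial_succ]
  push_cast at h7 ⊢
  field_simp

theorem iter_mono {y : X} (hy : y ∈ U) (m j : ℕ) :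
    c.D^[j] (c.mono (c.t y) m) y = if j = m then 1 else 0 := by
  induction j generalizing m with
  | zero =>
    cases m with
    | zero => simp [mono]
    | succ m => simp [mono]
  | succ j ih =>
    rw [Function.iterate_succ_apply]
    cases m with
    | zero =>
      have : c.D (c.mono (c.t y) 0) = fun _ => 0 := by
        unfold mono
        simp [D_const]
      rw [this, iter_zero]
      simp
    | succ m =>
      rw [(c.iter_congr (c.D_mono_succ hy _ m) j).eq_of_nhds, ih]
      simp

omit [IsManifold 𝓘(ℂ, B) ω X] in
/-- The Taylor expansion along the fibre, by iteration of Hadamard's lemma. -/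
theorem exists_taylor {y : X} (hy : y ∈ U) {f : X → ℂ} (hf : HolAt B f y) (n : ℕ) :
    ∃ (a : ℕ → ℂ) (h : X → ℂ), HolAt B h y ∧ BaseIdeal p y fun z =>
      f z - ∑ m ∈ Finset.range n, a m * c.mono (c.t y) m z - (c.t z - c.t y) ^ n * h z := by
  induction n with
  | zero =>
    refine ⟨0, f, hf, 0, fun i => i.elim0, fun i => i.elim0, fun i => i.elim0, fun i => i.elim0, ?_⟩
    simp
  | succ n ih =>
    obtain ⟨a, h, hh, hI⟩ := ih
    obtain ⟨g, hg, hJ⟩ := c.hadamard y hy h hh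
    refine ⟨fun m => if m = n then n.factorial * h y else a m, g, hg, ?_⟩
    have ht : HolAt B (fun z => (c.t z - c.t y) ^ n) y :=
      ((c.t_hol y hy).sub (HolAt.const _ y)).pow n
    refine (hI.add (hJ.mul ht)).congr (Filter.Eventually.of_forall fun z => ?_)
    have h8 : (n.factorial : ℂ) ≠ 0 := Nat.cast_ne_zero.2 n.factorial_ne_zero
    have hsum : ∑ m ∈ Finset.range n, (if m = n then n.factorial * h y else a m) *
        c.mono (c.t y) m z = ∑ m ∈ Finset.range n, a m * c.mono (c.t y) m z :=
      Finset.sum_congr rfl fun m hm => by rw [if_neg (Finset.mem_range.1 hm).ne]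
    beta_reduce
    rw [Finset.sum_range_succ, hsum, if_pos rfl]
    simp only [mono]
    field_simp
    ring

/-- A function all of whose derivatives of order less than `n` along the fibre vanish at `y` is a
multiple of `(t - t(y)) ^ n` up to the ideal of the base point. -/
theorem Flat.exists_eq_pow_mul [IsManifold 𝓘(ℂ, C) ω S] {c : FibreCoord p U} {y : X} (hy : y ∈ U)
    {f : X → ℂ} (hf : HolAt B f y) {n : ℕ} (h : c.Flat n f y) :
    ∃ g : X → ℂ, HolAt B g y ∧ BaseIdeal p y fun z => f z - (c.t z - c.t y) ^ n * g z := by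
  obtain ⟨a, g, hg, hI⟩ := c.exists_taylor hy hf n
  obtain ⟨N, b, q, hb, hq, hs⟩ := id hI
  have ht : HolAt B (fun z => c.t z - c.t y) y := (c.t_hol y hy).sub (HolAt.const _ y)
  have hm : ∀ m, HolAt B (fun z => a m * c.mono (c.t y) m z) y := fun m =>
    (HolAt.const _ y).mul (c.mono_hol hy _ m)
  have hbq : ∀ i, HolAt B (fun z => b i (p.proj z) * q i z) y := fun i =>
    (hb i).1.comp_proj.mul (hq i)
  -- comparing derivatives at `y` shows that the Taylor coefficients vanish
  have ha : ∀ j < n, a j = 0 := by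
    intro j hj
    have hpn : c.Flat n (fun z => (c.t z - c.t y) ^ n * g z) y := by
      simpa using c.flat_prod_mul (n := n) (g := fun _ z => c.t z - c.t y) hy (fun _ => ht)
        (fun _ => sub_self _) hg
    have heq : f =ᶠ[𝓝 y] fun z => (∑ m ∈ Finset.range n, a m * c.mono (c.t y) m z) +
        ((c.t z - c.t y) ^ n * g z + ∑ i, b i (p.proj z) * q i z) := by
      filter_upwards [hs] with z hz
      rw [← hz]
      ring
    have h1 := h j hj
    rw [(c.iter_congr heq j).eq_of_nhds,
      (c.iter_add hy (HolAt.finsetSum _ hm) (((ht.pow n).mul hg).add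
        (HolAt.finsetSum _ hbq)) j).eq_of_nhds,
      (c.iter_add hy ((ht.pow n).mul hg) (HolAt.finsetSum _ hbq) j).eq_of_nhds,
      (c.iter_sum _ hy hm j).eq_of_nhds, (c.iter_sum _ hy hbq j).eq_of_nhds, hpn j hj,
      Finset.sum_eq_zero (f := fun i => c.D^[j] (fun z => b i (p.proj z) * q i z) y)
        (fun i _ => Flat.comp_proj_mul hy (hb i).1 (hb i).2 (hq i) (j + 1) j j.lt_succ_self),
      add_zero, add_zero] at h1
    rw [Finset.sum_congr rfl (fun m _ => by
      rw [(c.iter_const_mul hy (a m) (c.mono_hol hy (c.t y) m) j).eq_of_nhds, c.iter_mono hy m j]),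
      Finset.sum_eq_single j (fun m _ hmj => by simp [hmj.symm])
        (fun hj' => absurd (Finset.mem_range.2 hj) hj')] at h1
    simpa using h1
  refine ⟨g, hg, hI.congr (Filter.Eventually.of_forall fun z => ?_)⟩
  simp only
  rw [Finset.sum_eq_zero fun m hm => by rw [ha m (Finset.mem_range.1 hm), zero_mul], sub_zero]

end FibreCoord

/-! ### Local frames -/

section Frames

variable {B : Type uB} [NormedAddCommGroup B] [NormedSpace ℂ B]
  {X : Type uX} [TopologicalSpace X] [ChartedSpace B X]

/-- A holomorphic frame of `A` over `U`, together with the linear coordinates that it defines on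
the fibres.  Nothing is required of `e` and `co` outside of `U`. -/
structure Frame (A : SectionSheaf.{uB, uX, w} B X) (U : Set X) (ι : Type*) [Fintype ι] where
  /-- the sections of the frame -/
  e : ι → ∀ y, A.Fib y
  /-- the coordinates -/
  co : ∀ y, A.Fib y →ₗ[ℂ] (ι → ℂ)
  co_sum : ∀ y ∈ U, ∀ a : ι → ℂ, co y (∑ i, a i • e i y) = a
  sum_co : ∀ y ∈ U, ∀ a : A.Fib y, ∑ i, co y a i • e i y = a
  hol_iff : ∀ y ∈ U, ∀ s : ∀ z, A.Fib z, A.Hol s y ↔ ∀ i, HolAt B (fun z => co z (s z) i) y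

variable {A : SectionSheaf.{uB, uX, w} B X} {U : Set X} {ι : Type*} [Fintype ι]

theorem SectionSheaf.hol_sum (A : SectionSheaf.{uB, uX, w} B X) {κ : Type*} (t : Finset κ)
    {s : κ → ∀ y, A.Fib y} {x : X} (h : ∀ i, A.Hol (s i) x) :
    A.Hol (fun y => ∑ i ∈ t, s i y) x := by
  classical
  induction t using Finset.induction_on with
  | empty => simpa using A.zero x
  | insert a t ha ih =>
    simp only [Finset.sum_insert ha]
    exact A.add (h a) ih

theorem applyField_of_hol {M : X → Type w'} [∀ x, AddCommGroup (M x)] [∀ x, Module ℂ (M x)]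
    (val : ∀ x, A.germs x →ₗ[ℂ] M x) {s : ∀ y, A.Fib y} {y : X} (h : A.Hol s y) :
    applyField val s y = val y ⟨s, h⟩ := by
  rw [applyField, dif_pos h]

namespace Frame

/-- The restriction of a frame to a smaller set. -/
def restrict (fr : Frame A U ι) {V : Set X} (h : V ⊆ U) : Frame A V ι where
  e := fr.e
  co := fr.co
  co_sum y hy := fr.co_sum y (h hy)
  sum_co y hy := fr.sum_co y (h hy)
  hol_iff y hy := fr.hol_iff y (h hy)

variable (fr : Frame A U ι) {y : X}

theorem co_injective (hy : y ∈ U) {a b : A.Fib y} (h : ∀ i, fr.co y a i = fr.co y b i) :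
    a = b := by
  rw [← fr.sum_co y hy a, ← fr.sum_co y hy b]
  simp only [h]

theorem co_e [DecidableEq ι] (hy : y ∈ U) (i : ι) : fr.co y (fr.e i y) = Pi.single i 1 := by
  have h := fr.co_sum y hy (Pi.single i 1)
  rwa [Finset.sum_eq_single i (fun j _ hj => by simp [hj]) (by simp), Pi.single_eq_same,
    one_smul] at h

theorem linearMap_ext {M : Type*} [AddCommGroup M] [Module ℂ M] (hy : y ∈ U)
    {f g : A.Fib y →ₗ[ℂ] M} (h : ∀ i, f (fr.e i y) = g (fr.e i y)) : f = g := by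
  ext a
  rw [← fr.sum_co y hy a]
  simp only [map_sum, map_smul, h]

theorem hol_co {s : ∀ z, A.Fib z} (hy : y ∈ U) (hs : A.Hol s y) (i : ι) :
    HolAt B (fun z => fr.co z (s z) i) y :=
  (fr.hol_iff y hy s).1 hs i

theorem hol_of_eventually {s : ∀ z, A.Fib z} (hy : y ∈ U) {f : ι → X → ℂ}
    (hf : ∀ i, HolAt B (f i) y) (h : ∀ᶠ z in 𝓝 y, ∀ i, fr.co z (s z) i = f i z) : A.Hol s y := by
  refine (fr.hol_iff y hy s).2 fun i => (hf i).congr ?_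
  filter_upwards [h] with z hz using (hz i).symm

theorem hol_e (hU : IsOpen U) (hy : y ∈ U) (i : ι) : A.Hol (fr.e i) y := by
  classical
  refine fr.hol_of_eventually hy (f := fun j _ => (Pi.single i 1 : ι → ℂ) j)
    (fun j => HolAt.const _ _) ?_
  filter_upwards [hU.mem_nhds hy] with z hz j
  rw [fr.co_e hz]

theorem hol_sum_smul_e (hU : IsOpen U) (hy : y ∈ U) {f : ι → X → ℂ} (hf : ∀ i, HolAt B (f i) y) :
    A.Hol (fun z => ∑ i, f i z • fr.e i z) y :=
  A.hol_sum _ fun i => A.smul (hf i) (fr.hol_e hU hy i)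

theorem span_e (hy : y ∈ U) : Submodule.span ℂ (Set.range fun i => fr.e i y) = ⊤ := by
  rw [eq_top_iff]
  rintro a -
  rw [← fr.sum_co y hy a]
  exact Submodule.sum_mem _ fun i _ =>
    Submodule.smul_mem _ _ (Submodule.subset_span (Set.mem_range_self i))

theorem linearIndependent_e (hy : y ∈ U) : LinearIndependent ℂ fun i => fr.e i y := by
  rw [Fintype.linearIndependent_iff]
  intro g hg i
  have h := fr.co_sum y hy g
  rw [hg, map_zero] at h
  rw [← h]
  rfl

theorem isFrameNear (hU : IsOpen U) (hy : y ∈ U) {r : ℕ} (σ : Fin r ≃ ι) :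
    A.IsFrameNear y fun j => fr.e (σ j) := by
  filter_upwards [hU.mem_nhds hy] with z hz
  refine ⟨(fr.linearIndependent_e hz).comp σ σ.injective, ?_, fun s => ⟨fun hs => ?_, ?_⟩⟩
  · rw [← fr.span_e hz, ← σ.surjective.range_comp]
    rfl
  · refine ⟨fun j w => fr.co w (s w) (σ j), fun j => fr.hol_co hz hs _, ?_⟩
    filter_upwards [hU.mem_nhds hz] with w hw
    rw [Equiv.sum_comp σ fun i => fr.co w (s w) i • fr.e i w, fr.sum_co w hw]
  · rintro ⟨f, hf, hs⟩
    refine A.congr (A.hol_sum Finset.univ fun j => A.smul (hf j) (fr.hol_e hU hz (σ j))) ?_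
    filter_upwards [hs] with w hw using hw.symm

/-- The elements of a frame whose indices lie in `I` span the subspace of vectors with vanishing
coordinates outside of `I`. -/
theorem mem_span_image_iff (hy : y ∈ U) (I : Set ι) (a : A.Fib y) :
    a ∈ Submodule.span ℂ ((fun i => fr.e i y) '' I) ↔ ∀ i ∉ I, fr.co y a i = 0 := by
  classical
  constructor
  · intro h i hi
    induction h using Submodule.span_induction with
    | mem b hb =>
      obtain ⟨j, hj, rfl⟩ := hb
      have hij : i ≠ j := fun h => hi (h ▸ hj)
      simp [fr.co_e hy, hij]
    | zero => simp
    | add b b' _ _ h1 h2 => simp [h1, h2]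
    | smul r b _ h1 => simp [h1]
  · intro h
    rw [← fr.sum_co y hy a]
    refine Submodule.sum_mem _ fun i _ => ?_
    by_cases hi : i ∈ I
    · exact Submodule.smul_mem _ _ (Submodule.subset_span ⟨i, hi, rfl⟩)
    · rw [h i hi, zero_smul]
      exact Submodule.zero_mem _

end Frame

variable [IsManifold 𝓘(ℂ, B) ω X]

/-- A local trivialization of a holomorphic vector bundle defines a holomorphic frame. -/
theorem exists_frame_ofBundle (F : Type uF) [NormedAddCommGroup F] [NormedSpace ℂ F]
    [FiniteDimensional ℂ F]
    (V : X → Type w) [TopologicalSpace (TotalSpace F V)] [∀ x, AddCommGroup (V x)]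
    [∀ x, Module ℂ (V x)] [∀ x, TopologicalSpace (V x)] [FiberBundle F V] [VectorBundle ℂ F V]
    [ContMDiffVectorBundle ω F V 𝓘(ℂ, B)] (x : X) :
    ∃ U : Set X, IsOpen U ∧ x ∈ U ∧ Nonempty
      (Frame (SectionSheaf.ofBundle (B := B) F V) U (Fin (Module.finrank ℂ F))) := by
  have : ContMDiffVectorBundle 1 F V 𝓘(ℂ, B) := ContMDiffVectorBundle.of_le (n := ω) le_top
  let T := trivializationAt F V x
  let b := Module.finBasis ℂ F
  refine ⟨T.baseSet, T.open_baseSet, FiberBundle.mem_baseSet_trivializationAt' x, ⟨?_⟩⟩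
  refine
    { e := T.localFrame b
      co := fun y => LinearMap.pi fun i => T.localFrameCoeff 𝓘(ℂ, B) b i y
      co_sum := ?_
      sum_co := ?_
      hol_iff := ?_ }
  · intro y hy a
    funext i
    have h := Trivialization.localFrameCoeff_apply_of_mem_baseSet (I := 𝓘(ℂ, B)) T b hy
      (fun z => ∑ i, a i • T.localFrame b i z) i
    simp only [LinearMap.pi_apply]
    rw [h]
    simp only [Trivialization.localFrame_apply_of_mem_baseSet (b := b) T hy]
    rw [Module.Basis.repr_sum_self]
  · intro y hy a
    classical
    have h := Trivialization.eq_sum_localFrameCoeff_smul (I := 𝓘(ℂ, B)) (b := b)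
      (s := fun z => if hz : z = y then hz ▸ a else 0) hy
    simpa using h.symm
  · intro y hy s
    exact contMDiffAt_iff_localFrameCoeff b hy

end Frames

/-! ### Powers of the cotangent line -/

section Sym

variable {M : Type*} [AddCommGroup M] [Module ℂ M]

/-- Evaluation of a symmetric tensor on copies of a fixed vector, that is, at a linear form
`ev` on the module of which the symmetric power is taken. -/
def symEval (k : ℕ) (ev : M →ₗ[ℂ] ℂ) : SymmetricPower ℂ (Fin k) M →ₗ[ℂ] ℂ :=
  let φ : (PiTensorProduct ℂ fun _ : Fin k => M) →ₗ[ℂ] ℂ :=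
    PiTensorProduct.lift ((MultilinearMap.mkPiAlgebra ℂ (Fin k) ℂ).compLinearMap fun _ => ev)
  { toFun := AddCon.lift (addConGen (SymmetricPower.Rel ℂ (Fin k) M)) φ.toAddMonoidHom (by
      refine AddCon.addConGen_le.2 ?_
      rintro _ _ ⟨σ, f⟩
      change φ (PiTensorProduct.tprod ℂ f) = φ (PiTensorProduct.tprod ℂ fun i => f (σ i))
      simpa [φ] using (Equiv.prod_comp σ fun i => ev (f i)).symm)
    map_add' := map_add _
    map_smul' := fun r σ => by
      induction σ using AddCon.induction_on with
      | H σ => exact map_smul φ r σ }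

theorem symEval_tprod (k : ℕ) (ev : M →ₗ[ℂ] ℂ) (η : Fin k → M) :
    symEval k ev (SymmetricPower.tprod ℂ η) = ∏ a, ev (η a) := by
  have h : symEval k ev (SymmetricPower.tprod ℂ η) =
    PiTensorProduct.lift ((MultilinearMap.mkPiAlgebra ℂ (Fin k) ℂ).compLinearMap fun _ => ev)
      (PiTensorProduct.tprod ℂ η) := rfl
  rw [h]
  simp

/-- The symmetric powers of a line with basis `m` and dual basis `ev` are lines. -/
theorem symPower_eq_smul (k : ℕ) (ev : M →ₗ[ℂ] ℂ) (m : M) (h : ∀ η, η = ev η • m)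
    (σ : SymmetricPower ℂ (Fin k) M) :
    σ = symEval k ev σ • SymmetricPower.tprod ℂ fun _ => m := by
  have hσ : σ ∈ Submodule.span ℂ (Set.range (SymmetricPower.tprod ℂ (ι := Fin k) (M := M))) := by
    rw [SymmetricPower.span_tprod_eq_top]
    trivial
  induction hσ using Submodule.span_induction with
  | mem σ hσ =>
    obtain ⟨η, rfl⟩ := hσ
    rw [symEval_tprod]
    conv_lhs => rw [funext fun a => h (η a)]
    rw [MultilinearMap.map_smul_univ]
  | zero => simp
  | add σ τ _ _ h1 h2 => rw [map_add, add_smul, ← h1, ← h2]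
  | smul r σ _ h1 => rw [map_smul, smul_assoc, ← h1]

end Sym

section TensorFrames

variable {B : Type uB} [NormedAddCommGroup B] [NormedSpace ℂ B]
  {X : Type uX} [TopologicalSpace X] [ChartedSpace B X]
  {C : Type uC} [NormedAddCommGroup C] [NormedSpace ℂ C]
  {S : Type uS} [TopologicalSpace S] [ChartedSpace C S]
  {p : Family B X C S} {U : Set X} (c : FibreCoord p U)
  {A : SectionSheaf.{uB, uX, w} B X} {ι : Type*} [Fintype ι] (fr : Frame A U ι)

theorem generate_hol [IsManifold 𝓘(ℂ, B) ω X] {Fib : X → Type w} [∀ x, AddCommGroup (Fib x)]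
    [∀ x, Module ℂ (Fib x)] {G : X → Set (∀ y, Fib y)}
    {hG : ∀ x, ∀ s ∈ G x, ∀ᶠ y in 𝓝 x, s ∈ G y} {x : X} {s : ∀ y, Fib y} (hs : s ∈ G x) :
    (SectionSheaf.generate (B := B) Fib G hG).Hol s x :=
  ⟨1, fun _ _ => 1, fun _ => s, fun _ => HolAt.const 1 x, fun _ => hs,
    Filter.Eventually.of_forall fun y => by simp⟩

/-- The evaluation of relative 1-forms on the vector field of a fibre coordinate. -/
def FibreCoord.ev (y : X) : RelCotangent p y →ₗ[ℂ] ℂ := Module.Dual.eval ℂ (RelTangent p y) (c.v y)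

theorem FibreCoord.ev_t {y : X} (hy : y ∈ U) : c.ev y (relDiff p c.t y) = 1 := c.relDiff_t y hy

/-- The coordinates on `L ⊗ A_y` given by a linear form on `L` and coordinates on `A_y`. -/
def tensorCo {L : Type*} [AddCommMonoid L] [Module ℂ L] (ev : L →ₗ[ℂ] ℂ) (y : X) :
    L ⊗[ℂ] A.Fib y →ₗ[ℂ] (ι → ℂ) :=
  (TensorProduct.lid ℂ (ι → ℂ)).toLinearMap ∘ₗ TensorProduct.map ev (fr.co y)

theorem tensorCo_tmul {L : Type*} [AddCommMonoid L] [Module ℂ L] (ev : L →ₗ[ℂ] ℂ) (y : X) (η : L)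
    (a : A.Fib y) (i : ι) : tensorCo fr ev y (η ⊗ₜ a) i = ev η * fr.co y a i := by
  simp [tensorCo]

theorem tensorCo_sum {L : Type*} [AddCommMonoid L] [Module ℂ L] (ev : L →ₗ[ℂ] ℂ) {y : X}
    (hy : y ∈ U) {m : L} (hm : ev m = 1) (a : ι → ℂ) :
    tensorCo fr ev y (∑ i, a i • (m ⊗ₜ[ℂ] fr.e i y)) = a := by
  simp only [← TensorProduct.tmul_smul, ← TensorProduct.tmul_sum]
  funext i
  rw [tensorCo_tmul, fr.co_sum y hy, hm, one_mul]

theorem sum_tensorCo {L : Type*} [AddCommMonoid L] [Module ℂ L] (ev : L →ₗ[ℂ] ℂ) {y : X}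
    (hy : y ∈ U) {m : L} (hm : ∀ η, η = ev η • m) (a : L ⊗[ℂ] A.Fib y) :
    ∑ i, tensorCo fr ev y a i • (m ⊗ₜ[ℂ] fr.e i y) = a := by
  induction a using TensorProduct.induction_on with
  | zero => simp
  | add a b h1 h2 =>
    simp only [map_add, Pi.add_apply, add_smul, Finset.sum_add_distrib]
    rw [h1, h2]
  | tmul η a =>
    simp only [tensorCo_tmul, mul_smul, ← TensorProduct.tmul_smul, ← TensorProduct.tmul_sum,
      ← Finset.smul_sum]
    rw [fr.sum_co y hy, TensorProduct.tmul_smul, TensorProduct.smul_tmul', ← hm]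

variable [IsManifold 𝓘(ℂ, B) ω X]

/-- The frame `(d t) ⊗ e i` of `Ω¹_{X/S} ⊗ A`. -/
def formsFrame : Frame (formsTensor p A) U ι where
  e i y := relDiff p c.t y ⊗ₜ[ℂ] fr.e i y
  co y := tensorCo fr (c.ev y) y
  co_sum y hy a := tensorCo_sum fr (c.ev y) hy (c.ev_t hy) a
  sum_co y hy a := sum_tensorCo fr (c.ev y) hy (c.cotangent_eq hy) a
  hol_iff y hy s := by
    constructor
    · rintro ⟨m, f, g, hf, hg, hs⟩ i
      choose φ σ hφ hσ hgs using hg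
      refine (HolAt.finsetSum Finset.univ fun j =>
        (hf j).mul ((c.D_hol hy (hφ j)).mul (fr.hol_co hy (hσ j) i))).congr ?_
      filter_upwards [hs] with z hz
      simp only [hz, hgs, map_sum, map_smul, Finset.sum_apply, Pi.smul_apply, tensorCo_tmul,
        smul_eq_mul]
      rfl
    · intro h
      refine (formsTensor p A).congr ((formsTensor p A).hol_sum Finset.univ fun i =>
        (formsTensor p A).smul (h i) (generate_hol
          ⟨c.t, fr.e i, c.t_hol y hy, fr.hol_e c.isOpen hy i, rfl⟩)) ?_
      filter_upwards [c.mem_nhds hy] with z hz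
      exact sum_tensorCo fr (c.ev z) hz (c.cotangent_eq hz) (s z)

/-- The frame `(d t) ^ k ⊗ e i` of `Symᵏ Ω¹_{X/S} ⊗ A`. -/
def symFrame (k : ℕ) : Frame (symFormsTensor p k A) U ι where
  e i y := (SymmetricPower.tprod ℂ fun _ => relDiff p c.t y) ⊗ₜ[ℂ] fr.e i y
  co y := tensorCo fr (symEval k (c.ev y)) y
  co_sum y hy a := tensorCo_sum fr _ hy (by simp [symEval_tprod, c.ev_t hy]) a
  sum_co y hy a :=
    sum_tensorCo fr _ hy (symPower_eq_smul k (c.ev y) _ (c.cotangent_eq hy)) a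
  hol_iff y hy s := by
    constructor
    · rintro ⟨m, f, g, hf, hg, hs⟩ i
      choose φ σ hφ hσ hgs using hg
      refine (HolAt.finsetSum Finset.univ fun j => (hf j).mul
        ((HolAt.prod fun a => c.D_hol hy (hφ j a)).mul (fr.hol_co hy (hσ j) i))).congr ?_
      filter_upwards [hs] with z hz
      simp only [hz, hgs, map_sum, map_smul, Finset.sum_apply, Pi.smul_apply, tensorCo_tmul,
        smul_eq_mul, symEval_tprod]
      rfl
    · intro h
      refine (symFormsTensor p k A).congr ((symFormsTensor p k A).hol_sum Finset.univ fun i =>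
        (symFormsTensor p k A).smul (h i) (generate_hol
          ⟨fun _ => c.t, fr.e i, fun _ => c.t_hol y hy, fr.hol_e c.isOpen hy i, rfl⟩)) ?_
      filter_upwards [c.mem_nhds hy] with z hz
      exact sum_tensorCo fr _ hz (symPower_eq_smul k (c.ev z) _ (c.cotangent_eq hz)) (s z)

end TensorFrames

/-! ### Jets in coordinates -/

section Jets

variable {B : Type uB} [NormedAddCommGroup B] [NormedSpace ℂ B]
  {X : Type uX} [TopologicalSpace X] [ChartedSpace B X]
  {C : Type uC} [NormedAddCommGroup C] [NormedSpace ℂ C]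
  {S : Type uS} [TopologicalSpace S] [ChartedSpace C S]
  {p : Family B X C S} {U : Set X} (c : FibreCoord p U)
  {A : SectionSheaf.{uB, uX, w} B X} {ι : Type*} [Fintype ι] (fr : Frame A U ι)

theorem mem_vanishing_of_eventually_eq_zero {n : ℕ} {y : X} {s : A.germs y}
    (h : ∀ᶠ z in 𝓝 y, s.1 z = 0) : s ∈ vanishing p A n y := by
  refine Submodule.subset_span (Or.inr ⟨fun _ => 0, 0, HolAt.const 0 _, rfl, ?_⟩)
  filter_upwards [h] with z hz
  rw [hz, zero_smul]

theorem vanishing_congr {n : ℕ} {y : X} {s s' : A.germs y} (hs : s ∈ vanishing p A n y)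
    (h : ∀ᶠ z in 𝓝 y, s'.1 z = s.1 z) : s' ∈ vanishing p A n y := by
  rw [← sub_add_cancel s' s]
  refine Submodule.add_mem _ (mem_vanishing_of_eventually_eq_zero ?_) hs
  filter_upwards [h] with z hz
  exact sub_eq_zero.2 hz

theorem mulGerm_mem_vanishing_of_baseIdeal {n : ℕ} {y : X} {f : FunGerm B y}
    (hf : BaseIdeal p y f.1) (s : A.germs y) : A.mulGerm f s ∈ vanishing p A n y := by
  obtain ⟨N, b, h, hb, hh, hs⟩ := hf
  have h1 : ∀ i, A.mulGerm ⟨fun z => b i (p.proj z) * h i z, (hb i).1.comp_proj.mul (hh i)⟩ s ∈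
      vanishing p A n y := fun i => Submodule.subset_span (Or.inr
    ⟨b i, A.mulGerm ⟨h i, hh i⟩ s, (hb i).1, (hb i).2,
      Filter.Eventually.of_forall fun z => mul_smul _ _ _⟩)
  refine vanishing_congr (Submodule.sum_mem _ fun i (_ : i ∈ Finset.univ) => h1 i) ?_
  filter_upwards [hs] with z hz
  simp only [SectionSheaf.mulGerm, hz, Finset.sum_smul, Submodule.coe_sum, Finset.sum_apply]

theorem mulGerm_pow_mem_vanishing {n : ℕ} {y : X} {f g : FunGerm B y} (hf : f.1 y = 0)
    {q : FunGerm B y} (hq : ∀ᶠ z in 𝓝 y, q.1 z = f.1 z ^ n * g.1 z) (s : A.germs y) :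
    A.mulGerm q s ∈ vanishing p A n y := by
  refine Submodule.subset_span (Or.inl ⟨fun _ => f, A.mulGerm g s, fun _ => hf, ?_⟩)
  filter_upwards [hq] with z hz
  simp [SectionSheaf.mulGerm, hz, mul_smul]

/-- The germ `((t - w) ^ m / m!) e i` at `y`. -/
def monoGerm {y : X} (hy : y ∈ U) (w : ℂ) (m : ℕ) (i : ι) : A.germs y :=
  ⟨fun z => c.mono w m z • fr.e i z, A.smul (c.mono_hol hy w m) (fr.hol_e c.isOpen hy i)⟩

open Classical in
/-- The jets at `y` of the germs `((t - t y) ^ m / m!) e i`. -/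
def jetE (n : ℕ) (q : Fin n × ι) (y : X) : JetFib p A n y :=
  if hy : y ∈ U then jetAt p A n y (monoGerm c fr hy (c.t y) q.1 q.2) else 0

theorem jetE_of_mem (n : ℕ) (q : Fin n × ι) {y : X} (hy : y ∈ U) :
    jetE c fr n q y = jetAt p A n y (monoGerm c fr hy (c.t y) q.1 q.2) := by
  rw [jetE, dif_pos hy]

variable [IsManifold 𝓘(ℂ, B) ω X] [IsManifold 𝓘(ℂ, C) ω S]

/-- A germ vanishes to order `n` along the fibre if and only if the first `n` derivatives of its
coordinates vanish. -/
theorem mem_vanishing_iff {y : X} (hy : y ∈ U) (n : ℕ) (s : A.germs y) :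
    s ∈ vanishing p A n y ↔ ∀ i, c.Flat n (fun z => fr.co z (s.1 z) i) y := by
  constructor
  · intro hs i
    induction hs using Submodule.span_induction with
    | mem s hs =>
      obtain ⟨f, t, hf, hs⟩ | ⟨b, t, hb, hb0, hs⟩ := hs
      · refine (c.flat_prod_mul hy (fun a => (f a).2) hf (fr.hol_co hy t.2 i)).congr ?_
        filter_upwards [hs] with z hz
        simp [hz]
      · refine (FibreCoord.Flat.comp_proj_mul hy hb hb0 (fr.hol_co hy t.2 i) n).congr ?_
        filter_upwards [hs] with z hz
        simp [hz]
    | zero =>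
      intro m _
      simp [c.iter_zero]
    | add s s' _ _ h1 h2 =>
      simpa using FibreCoord.Flat.add hy (fr.hol_co hy s.2 i) (fr.hol_co hy s'.2 i) h1 h2
    | smul r s _ h1 =>
      simpa using FibreCoord.Flat.mul hy (HolAt.const r y) (fr.hol_co hy s.2 i) h1
  · intro h
    let co : ι → FunGerm B y := fun i => ⟨fun z => fr.co z (s.1 z) i, fr.hol_co hy s.2 i⟩
    let e : ι → A.germs y := fun i => ⟨fr.e i, fr.hol_e c.isOpen hy i⟩
    have h1 : ∀ i, A.mulGerm (co i) (e i) ∈ vanishing p A n y := by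
      intro i
      obtain ⟨g, hg, hI⟩ := (h i).exists_eq_pow_mul hy (fr.hol_co hy s.2 i)
      have ht : HolAt B (fun z => c.t z - c.t y) y := (c.t_hol y hy).sub (HolAt.const _ y)
      have hp := mulGerm_pow_mem_vanishing (p := p) (n := n) (f := ⟨_, ht⟩) (g := ⟨g, hg⟩)
        (sub_self _) (q := ⟨_, (ht.pow n).mul hg⟩) (Filter.Eventually.of_forall fun z => rfl) (e i)
      have hq := mulGerm_mem_vanishing_of_baseIdeal (n := n)
        (f := ⟨_, (fr.hol_co hy s.2 i).sub ((ht.pow n).mul hg)⟩) hI (e i)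
      refine vanishing_congr (Submodule.add_mem _ hp hq) (Filter.Eventually.of_forall fun z => ?_)
      simp [SectionSheaf.mulGerm, co, e, sub_smul]
    refine vanishing_congr (Submodule.sum_mem _ fun i (_ : i ∈ Finset.univ) => h1 i) ?_
    filter_upwards [c.mem_nhds hy] with z hz
    simp only [SectionSheaf.mulGerm, Submodule.coe_sum, Finset.sum_apply, co, e]
    rw [fr.sum_co z hz]

/-- The coordinates of the jet of a germ: the derivatives of its coordinates. -/
def taylor (n : ℕ) {y : X} (hy : y ∈ U) : A.germs y →ₗ[ℂ] (Fin n × ι → ℂ) where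
  toFun s q := c.D^[q.1] (fun z => fr.co z (s.1 z) q.2) y
  map_add' s s' := by
    funext q
    simpa using (c.iter_add hy (fr.hol_co hy s.2 q.2) (fr.hol_co hy s'.2 q.2) q.1).eq_of_nhds
  map_smul' r s := by
    funext q
    simpa using (c.iter_const_mul hy r (fr.hol_co hy s.2 q.2) q.1).eq_of_nhds

theorem taylor_eq_zero_iff (n : ℕ) {y : X} (hy : y ∈ U) (s : A.germs y) :
    taylor c fr n hy s = 0 ↔ s ∈ vanishing p A n y := by
  rw [mem_vanishing_iff c fr hy]
  constructor
  · intro h i m hm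
    exact congrFun h (⟨m, hm⟩, i)
  · intro h
    funext q
    exact h q.2 q.1 q.1.2

open Classical in
/-- The coordinates on the fibres of the jet bundle. -/
def jetCo (n : ℕ) (y : X) : JetFib p A n y →ₗ[ℂ] (Fin n × ι → ℂ) :=
  if hy : y ∈ U then (vanishing p A n y).liftQ (taylor c fr n hy)
    (fun s hs => (taylor_eq_zero_iff c fr n hy s).2 hs) else 0

theorem jetCo_jetAt (n : ℕ) {y : X} (hy : y ∈ U) (s : A.germs y) (q : Fin n × ι) :
    jetCo c fr n y (jetAt p A n y s) q = c.D^[q.1] (fun z => fr.co z (s.1 z) q.2) y := by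
  rw [jetCo, dif_pos hy]
  rfl

theorem jetCo_eq_zero (n : ℕ) {y : X} (hy : y ∈ U) {a : JetFib p A n y}
    (h : jetCo c fr n y a = 0) : a = 0 := by
  obtain ⟨s, rfl⟩ := Submodule.mkQ_surjective _ a
  refine (Submodule.Quotient.mk_eq_zero _).2 ((taylor_eq_zero_iff c fr n hy s).1 ?_)
  funext q
  exact (jetCo_jetAt c fr n hy s q).symm.trans (congrFun h q)

open Classical in
theorem jetCo_jetE (n : ℕ) {y : X} (hy : y ∈ U) (q q' : Fin n × ι) :
    jetCo c fr n y (jetE c fr n q y) q' = if q' = q then 1 else 0 := by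
  rw [jetE_of_mem c fr n q hy, jetCo_jetAt c fr n hy]
  have h : (fun z => fr.co z ((monoGerm c fr hy (c.t y) q.1 q.2).1 z) q'.2) =ᶠ[𝓝 y]
      fun z => (if q'.2 = q.2 then 1 else 0) * c.mono (c.t y) q.1 z := by
    filter_upwards [c.mem_nhds hy] with z hz
    simp [monoGerm, fr.co_e hz, Pi.single_apply]
  rw [(c.iter_congr h _).eq_of_nhds,
    (c.iter_const_mul hy _ (c.mono_hol hy _ _) _).eq_of_nhds, c.iter_mono hy]
  by_cases h1 : q'.2 = q.2 <;> by_cases h2 : q'.1 = q.1 <;>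
    simp [h1, h2, Prod.ext_iff, Fin.ext_iff.symm]

omit [IsManifold 𝓘(ℂ, C) ω S] in
/-- The sections `jetE` are holomorphic, although the germ of which they are the jet at `y` varies
with `y`: the dependence on `y` is through powers of the number `t y`. -/
theorem jetE_hol (n : ℕ) (q : Fin n × ι) {y : X} (hy : y ∈ U) :
    (jets p A n).Hol (jetE c fr n q) y := by
  obtain ⟨m, i⟩ := q
  -- binomial expansion of `(t - t z) ^ m` in powers of `t`
  let s : ℕ → ∀ z, A.Fib z := fun j z => c.mono 0 ((m : ℕ) - j) z • fr.e i z
  have hs : ∀ j, ∀ z ∈ U, A.Hol (s j) z := fun j z hz =>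
    A.smul (c.mono_hol hz 0 _) (fr.hol_e c.isOpen hz i)
  have hf : ∀ j : ℕ, HolAt B (fun z => (j.factorial : ℂ)⁻¹ * (- c.t z) ^ j) y := fun j =>
    (HolAt.const _ y).mul ((c.t_hol y hy).neg.pow j)
  refine (jets p A n).congr ((jets p A n).hol_sum (Finset.range (m + 1)) fun j =>
    (jets p A n).smul (hf j) ((jetOp p A n).hol y ⟨s j, hs j y hy⟩)) ?_
  filter_upwards [c.mem_nhds hy] with z hz
  rw [jetE_of_mem c fr n (m, i) hz]
  have h1 : ∀ j, applyField (jetOp p A n).val (s j) z = jetAt p A n z ⟨s j, hs j z hz⟩ :=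
    fun j => applyField_of_hol _ (hs j z hz)
  simp only [h1]
  simp only [← map_smul, ← map_sum]
  congr 1
  apply Subtype.ext
  funext x
  simp only [Submodule.coe_sum, Submodule.coe_smul, Finset.sum_apply, Pi.smul_apply, s, monoGerm,
    ← mul_smul, ← Finset.sum_smul]
  congr 1
  simp only [FibreCoord.mono, sub_zero]
  rw [sub_eq_neg_add, add_pow, Finset.mul_sum]
  refine Finset.sum_congr rfl fun j hj => ?_
  have hjm : j ≤ m := Nat.lt_succ_iff.1 (Finset.mem_range.1 hj)
  rw [Nat.cast_choose ℂ hjm]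
  have h2 : ((m : ℕ).factorial : ℂ) ≠ 0 := Nat.cast_ne_zero.2 (Nat.factorial_ne_zero _)
  have h3 : (j.factorial : ℂ) ≠ 0 := Nat.cast_ne_zero.2 (Nat.factorial_ne_zero _)
  have h4 : (((m : ℕ) - j).factorial : ℂ) ≠ 0 := Nat.cast_ne_zero.2 (Nat.factorial_ne_zero _)
  field_simp

/-- The frame of the jet bundle given by the jets at `y` of the germs `((t - t y) ^ m / m!) e i`,
for `m < n`.  The coordinates of the jet of a section are the derivatives of its coordinates. -/
def jetFrame (n : ℕ) : Frame (jets p A n) U (Fin n × ι) where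
  e := jetE c fr n
  co := jetCo c fr n
  co_sum y hy a := by
    classical
    funext q
    simp [jetCo_jetE c fr n hy]
  sum_co y hy a := by
    classical
    rw [← sub_eq_zero]
    refine jetCo_eq_zero c fr n hy ?_
    funext q
    simp [jetCo_jetE c fr n hy]
  hol_iff y hy s := by
    classical
    constructor
    · rintro ⟨m, f, g, hf, hg, hs⟩ q
      choose σ hσ hgs using hg
      refine (HolAt.finsetSum Finset.univ fun j =>
        (hf j).mul (c.iter_hol hy (fr.hol_co hy (hσ j) q.2) q.1)).congr ?_
      filter_upwards [hs, c.mem_nhds hy, Filter.eventually_all.2 fun j => A.eventually (hσ j)]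
        with z hz hzU hzσ
      simp only [hz, hgs, map_sum, map_smul, Finset.sum_apply, Pi.smul_apply, smul_eq_mul]
      refine Finset.sum_congr rfl fun j _ => ?_
      rw [applyField_of_hol _ (hzσ j), jetCo_jetAt c fr n hzU]
    · intro h
      refine (jets p A n).congr ((jets p A n).hol_sum Finset.univ fun q =>
        (jets p A n).smul (h q) (jetE_hol c fr n q hy)) ?_
      filter_upwards [c.mem_nhds hy] with z hz
      rw [← sub_eq_zero]
      refine jetCo_eq_zero c fr n hz ?_
      funext q
      simp [jetCo_jetE c fr n hz]

theorem jetFrame_co_jetAt (n : ℕ) {y : X} (hy : y ∈ U) (s : A.germs y) (q : Fin n × ι) :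
    (jetFrame c fr n).co y (jetAt p A n y s) q = c.D^[q.1] (fun z => fr.co z (s.1 z) q.2) y :=
  jetCo_jetAt c fr n hy s q

theorem jetFrame_e (n : ℕ) {y : X} (hy : y ∈ U) (q : Fin n × ι) :
    (jetFrame c fr n).e q y = jetAt p A n y (monoGerm c fr hy (c.t y) q.1 q.2) :=
  jetE_of_mem c fr n q hy

theorem jetFrame_co_jetProj {m n : ℕ} (h : n ≤ m) {y : X} (hy : y ∈ U) (a : JetFib p A m y)
    (q : Fin n × ι) : (jetFrame c fr n).co y (jetProj p A h y a) q =
      (jetFrame c fr m).co y a (Fin.castLE h q.1, q.2) := by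
  obtain ⟨s, rfl⟩ := Submodule.mkQ_surjective _ a
  exact (jetCo_jetAt c fr n hy s q).trans
    (jetCo_jetAt c fr m hy s (Fin.castLE h q.1, q.2)).symm

end Jets

/-! ### Bundle maps out of jet bundles -/

section OfOperator

variable {B : Type uB} [NormedAddCommGroup B] [NormedSpace ℂ B]
  {X : Type uX} [TopologicalSpace X] [ChartedSpace B X] [IsManifold 𝓘(ℂ, B) ω X]
  {C : Type uC} [NormedAddCommGroup C] [NormedSpace ℂ C]
  {S : Type uS} [TopologicalSpace S] [ChartedSpace C S]
  {p : Family B X C S}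
  {A : SectionSheaf.{uB, uX, w} B X} {A' : SectionSheaf.{uB, uX, w'} B X}

/-- An operator that annihilates the germs vanishing to order `n` factors through the jet
bundle. -/
def BundleHom.ofOperator (n : ℕ) (Q : Operator A A')
    (hQ : ∀ x, ∀ s ∈ vanishing p A n x, Q.val x s = 0) : BundleHom (jets p A n) A' where
  map x := (vanishing p A n x).liftQ (Q.val x) (hQ x)
  hol s x hs := by
    obtain ⟨m, f, g, hf, hg, hs⟩ := hs
    choose σ hσ hgs using hg
    refine A'.congr (A'.hol_sum Finset.univ fun j => A'.smul (hf j) (Q.hol x ⟨σ j, hσ j⟩)) ?_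
    filter_upwards [hs, Filter.eventually_all.2 fun j => A.eventually (hσ j)] with z hz hzσ
    simp only [hz, hgs, map_sum, map_smul]
    refine Finset.sum_congr rfl fun j _ => ?_
    rw [applyField_of_hol _ (hzσ j), applyField_of_hol _ (hzσ j)]
    rfl

omit [IsManifold 𝓘(ℂ, B) ω X] in
theorem Operator.val_congr (Q : Operator A A') {x : X} {s s' : A.germs x}
    (h : ∀ᶠ z in 𝓝 x, s.1 z = s'.1 z) : Q.val x s = Q.val x s' := by
  rw [← sub_eq_zero, ← map_sub]
  refine Q.val_eq_zero x _ ?_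
  filter_upwards [h] with z hz
  exact sub_eq_zero.2 hz

/-- The composite of two operators. -/
def Operator.comp {A'' : SectionSheaf.{uB, uX, w''} B X} (Q' : Operator A' A'')
    (Q : Operator A A') : Operator A A'' where
  val x :=
    { toFun := fun s => Q'.val x ⟨Q.app s.1, Q.hol x s⟩
      map_add' := fun s s' => by
        rw [← map_add]
        refine Q'.val_congr ?_
        filter_upwards [A.eventually s.2, A.eventually s'.2] with z h1 h2
        simp only [Operator.app, Submodule.coe_add, Pi.add_apply]
        rw [applyField_of_hol _ h1, applyField_of_hol _ h2, ← map_add]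
        exact applyField_of_hol _ (A.add h1 h2)
      map_smul' := fun r s => by
        rw [← map_smul]
        refine Q'.val_congr ?_
        filter_upwards [A.eventually s.2] with z h1
        simp only [Operator.app, Submodule.coe_smul, Pi.smul_apply, RingHom.id_apply]
        rw [applyField_of_hol _ h1, ← map_smul]
        exact applyField_of_hol _ (A.smul (HolAt.const r z) h1) }
  val_eq_zero x s hs := by
    refine Q'.val_eq_zero x _ ?_
    filter_upwards [A.eventually s.2, eventually_eventually_nhds.2 hs] with z h1 h2
    rw [Operator.app, applyField_of_hol _ h1]
    exact Q.val_eq_zero z _ h2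
  hol x s := by
    refine A''.congr (Q'.hol x ⟨Q.app s.1, Q.hol x s⟩) ?_
    filter_upwards [A.eventually s.2] with z h1
    rw [applyField_of_hol _ h1]
    exact applyField_of_hol _ (Q.hol z ⟨s.1, h1⟩)

end OfOperator

/-! ### Differential operators and their symbols -/

section Symbols

variable {B : Type uB} [NormedAddCommGroup B] [NormedSpace ℂ B]
  {X : Type uX} [TopologicalSpace X] [ChartedSpace B X]
  {C : Type uC} [NormedAddCommGroup C] [NormedSpace ℂ C]
  {S : Type uS} [TopologicalSpace S] [ChartedSpace C S]
  {p : Family B X C S} {A : SectionSheaf.{uB, uX, w} B X}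
  {A' : SectionSheaf.{uB, uX, w'} B X}
  {M : Type w'} [AddCommGroup M] [Module ℂ M]

/-- The product of finitely many germs of functions. -/
def FunGerm.prod {x : X} {n : ℕ} (f : Fin n → FunGerm B x) : FunGerm B x :=
  ⟨fun y => ∏ a, (f a).1 y, HolAt.prod fun a => (f a).2⟩

/-- The germ `f - f(x)`. -/
def FunGerm.centered {x : X} (f : FunGerm B x) : FunGerm B x :=
  ⟨fun y => f.1 y - f.1 x, f.2.sub (HolAt.const _ x)⟩

theorem FunGerm.centered_apply {x : X} (f : FunGerm B x) (y : X) :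
    f.centered.1 y = f.1 y - f.1 x := rfl

/-- Multiplication by a germ of a function, as a linear map. -/
def SectionSheaf.mulHom (A : SectionSheaf.{uB, uX, w} B X) {x : X} (f : FunGerm B x) :
    A.germs x →ₗ[ℂ] A.germs x where
  toFun := A.mulGerm f
  map_add' _ _ := Subtype.ext (funext fun _ => smul_add _ _ _)
  map_smul' _ _ := Subtype.ext (funext fun _ => smul_comm _ _ _)

/-- The commutator with `f` is the composite with the multiplication by `f - f(x)`. -/
theorem comm_eq_comp {x : X} (f : FunGerm B x) (φ : A.germs x →ₗ[ℂ] M) :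
    comm A f φ = φ ∘ₗ A.mulHom f.centered := by
  funext s
  have h : A.mulHom f.centered s = A.mulGerm f s - f.1 x • s :=
    Subtype.ext (funext fun y => sub_smul _ _ _)
  simp [comm, h]

theorem mulGerm_prod_succ {x : X} {n : ℕ} (f : Fin (n + 1) → FunGerm B x) (s : A.germs x) :
    A.mulGerm (FunGerm.prod f) s =
      A.mulHom (f 0) (A.mulGerm (FunGerm.prod fun a => f a.succ) s) := by
  apply Subtype.ext
  funext y
  simp [FunGerm.prod, SectionSheaf.mulHom, SectionSheaf.mulGerm, Fin.prod_univ_succ, mul_smul]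

theorem iterComm_eq {x : X} (k : ℕ) (f : Fin k → FunGerm B x) (φ : A.germs x →ₗ[ℂ] M)
    (s : A.germs x) :
    iterComm A k f φ s = φ (A.mulGerm (FunGerm.prod fun a => (f a).centered) s) := by
  induction k generalizing φ with
  | zero =>
    have h : A.mulGerm (FunGerm.prod fun a : Fin 0 => (f a).centered) s = s := by
      apply Subtype.ext
      funext y
      simp [FunGerm.prod, SectionSheaf.mulGerm]
    rw [h]
    rfl
  | succ k ih =>
    rw [iterComm, comm_eq_comp, ih, mulGerm_prod_succ]
    rfl

theorem HasOrder.map_prod_eq_zero {x : X} {k : ℕ} {φ : A.germs x →ₗ[ℂ] M} (h : HasOrder A k φ)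
    (f : Fin (k + 1) → FunGerm B x) (hf : ∀ a, (f a).1 x = 0) (s : A.germs x) :
    φ (A.mulGerm (FunGerm.prod f) s) = 0 := by
  induction k generalizing φ with
  | zero =>
    have h' := h (FunGerm.prod f) s
    rw [h']
    simp [FunGerm.prod, hf]
  | succ k ih =>
    have h' : HasOrder A k (comm A (f 0) φ) := h (f 0)
    rw [comm_eq_comp] at h'
    have hc : (f 0).centered = f 0 := Subtype.ext (funext fun y => by
      rw [FunGerm.centered_apply, hf 0, sub_zero])
    rw [mulGerm_prod_succ, ← hc]
    exact ih h' (fun a => f a.succ) fun a => hf a.succ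

/-- A relative differential operator of order `k` annihilates the germs that vanish to order
`k + 1` along the fibre. -/
theorem IsRelDiffOp.val_eq_zero {k : ℕ} {Q : Operator A A'} (hQ : IsRelDiffOp p k Q) (x : X)
    (s : A.germs x) (hs : s ∈ vanishing p A (k + 1) x) : Q.val x s = 0 := by
  induction hs using Submodule.span_induction with
  | mem s hs =>
    obtain ⟨f, t, hf, hs⟩ | ⟨g, t, hg, hg0, hs⟩ := hs
    · rw [Q.val_congr (s' := A.mulGerm (FunGerm.prod f) t) hs]
      exact (hQ.2 x).map_prod_eq_zero f hf t
    · rw [Q.val_congr (s' := A.mulGerm ⟨g ∘ p.proj, hg.comp_proj⟩ t) hs,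
        hQ.1 x g hg hg.comp_proj t, hg0, zero_smul]
  | zero => exact map_zero _
  | add s s' _ _ h1 h2 => rw [map_add, h1, h2, add_zero]
  | smul r s _ h1 => rw [map_smul, h1, smul_zero]

end Symbols

/-- The local structure that the argument uses: around every point there are a fibre coordinate and
a holomorphic frame. -/
def HasCharts {B : Type uB} [NormedAddCommGroup B] [NormedSpace ℂ B]
    {X : Type uX} [TopologicalSpace X] [ChartedSpace B X]
    {C : Type uC} [NormedAddCommGroup C] [NormedSpace ℂ C]
    {S : Type uS} [TopologicalSpace S] [ChartedSpace C S]
    (p : Family B X C S) (A : SectionSheaf.{uB, uX, w} B X) (ι : Type) [Fintype ι] : Prop :=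
  ∀ x : X, ∃ U : Set X, x ∈ U ∧ Nonempty (FibreCoord p U) ∧ Nonempty (Frame A U ι)

section Splitting

variable {B : Type uB} [NormedAddCommGroup B] [NormedSpace ℂ B]
  {X : Type uX} [TopologicalSpace X] [ChartedSpace B X]
  {C : Type uC} [NormedAddCommGroup C] [NormedSpace ℂ C]
  {S : Type uS} [TopologicalSpace S] [ChartedSpace C S]
  [IsManifold 𝓘(ℂ, B) ω X] [IsManifold 𝓘(ℂ, C) ω S]
  {p : Family B X C S} {A : SectionSheaf.{uB, uX, w} B X} {U : Set X} {ι : Type} [Fintype ι]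
  {k : ℕ} {P : Operator A (symFormsTensor p k A)}

/-! ### The bundle map of an operator and the splitting of the jet sequence -/

/-- The bundle map `Jᵏ(A) → Symᵏ Ω¹ ⊗ A` of a differential operator of order `k`. -/
def symbolMap (hP : IsRelDiffOp p k P) : BundleHom (jets p A (k + 1)) (symFormsTensor p k A) :=
  BundleHom.ofOperator (k + 1) P hP.val_eq_zero

variable (hP : IsRelDiffOp p k P) (hsymbol : HasIdentitySymbol p k P)
  (c : FibreCoord p U) (fr : Frame A U ι)

include hsymbol in
/-- The identity symbol determines the bundle map in the top order. -/
theorem symbolMap_jetFrame_last {y : X} (hy : y ∈ U) (i : ι) :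
    (symbolMap hP).map y ((jetFrame c fr (k + 1)).e (Fin.last k, i) y) =
      ((k.factorial : ℂ)⁻¹) • (symFrame c fr k).e i y := by
  let e : A.germs y := ⟨fr.e i, fr.hol_e c.isOpen hy i⟩
  let t : FunGerm B y := ⟨c.t, c.t_hol y hy⟩
  have h1 : monoGerm c fr hy (c.t y) k i =
      (k.factorial : ℂ)⁻¹ • A.mulGerm (FunGerm.prod fun _ : Fin k => t.centered) e := by
    apply Subtype.ext
    funext z
    simp [monoGerm, FibreCoord.mono, SectionSheaf.mulGerm, FunGerm.prod, FunGerm.centered, t, e,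
      mul_smul]
  rw [jetFrame_e c fr (k + 1) hy]
  change P.val y (monoGerm c fr hy (c.t y) k i) = _
  rw [h1, map_smul, ← iterComm_eq k (fun _ => t) (P.val y) e, hsymbol]
  rfl

include hsymbol in
theorem symFrame_co_symbolMap {y : X} (hy : y ∈ U) (a : JetFib p A (k + 1) y) (i : ι) :
    (symFrame c fr k).co y ((symbolMap hP).map y a) i =
      (k.factorial : ℂ)⁻¹ * (jetFrame c fr (k + 1)).co y a (Fin.last k, i) +
      ∑ q : Fin k × ι, (jetFrame c fr (k + 1)).co y a (q.1.castSucc, q.2) *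
        (symFrame c fr k).co y
          ((symbolMap hP).map y ((jetFrame c fr (k + 1)).e (q.1.castSucc, q.2) y)) i := by
  classical
  conv_lhs => rw [← (jetFrame c fr (k + 1)).sum_co y hy a]
  simp only [map_sum, map_smul, Finset.sum_apply, Pi.smul_apply, smul_eq_mul]
  rw [Fintype.sum_prod_type, Fin.sum_univ_castSucc, add_comm, Fintype.sum_prod_type]
  congr 1
  simp only [symbolMap_jetFrame_last hP hsymbol c fr hy, map_smul, (symFrame c fr k).co_e hy,
    Pi.smul_apply, Pi.single_apply, smul_eq_mul, mul_ite, mul_one, mul_zero]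
  rw [Finset.sum_ite_eq]
  simp [mul_comm]

/-- The projection of `Jᵏ(A)` to `J^{k-1}(A)` together with the bundle map of an operator. -/
def projSymbol (x : X) : JetFib p A (k + 1) x →ₗ[ℂ]
    JetFib p A k x × (symFormsTensor p k A).Fib x :=
  (jetProj p A (Nat.le_succ k) x).prod ((symbolMap hP).map x)

include hsymbol in
/-- In the jet frames this map is triangular, with the invertible entry `1 / k!` in the top
order. -/
theorem projSymbol_bijective (hloc : HasCharts p A ι) (x : X) :
    Function.Bijective (projSymbol hP x) := by
  obtain ⟨U, hx, ⟨c⟩, ⟨fr⟩⟩ := hloc x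
  have hk : (k.factorial : ℂ) ≠ 0 := Nat.cast_ne_zero.2 k.factorial_ne_zero
  have hlast : ∀ {f : Fin (k + 1) × ι → Prop}, (∀ q : Fin k × ι, f (q.1.castSucc, q.2)) →
      (∀ i, f (Fin.last k, i)) → ∀ q, f q := by
    rintro f h1 h2 ⟨m, i⟩
    induction m using Fin.lastCases with
    | last => exact h2 i
    | cast m => exact h1 (m, i)
  have hproj : ∀ (a : JetFib p A (k + 1) x) (q : Fin k × ι),
      (jetFrame c fr k).co x (jetProj p A (Nat.le_succ k) x a) q =
        (jetFrame c fr (k + 1)).co x a (q.1.castSucc, q.2) := fun a q =>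
    jetFrame_co_jetProj c fr (Nat.le_succ k) hx a q
  constructor
  · refine (injective_iff_map_eq_zero _).2 fun a ha => ?_
    have h1 : jetProj p A (Nat.le_succ k) x a = 0 := congrArg Prod.fst ha
    have h2 : (symbolMap hP).map x a = 0 := congrArg Prod.snd ha
    have h3 : ∀ q : Fin k × ι, (jetFrame c fr (k + 1)).co x a (q.1.castSucc, q.2) = 0 := by
      intro q
      rw [← hproj, h1, map_zero]
      rfl
    have h4 : ∀ i, (jetFrame c fr (k + 1)).co x a (Fin.last k, i) = 0 := by
      intro i
      have h5 := symFrame_co_symbolMap hP hsymbol c fr hx a i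
      rw [h2] at h5
      simpa [h3, hk] using h5.symm
    refine (jetFrame c fr (k + 1)).co_injective hx fun q => ?_
    rw [map_zero]
    exact hlast (f := fun q => (jetFrame c fr (k + 1)).co x a q = 0) h3 h4 q
  · rintro ⟨u, σ⟩
    let b : Fin k × ι → ι → ℂ := fun q => (symFrame c fr k).co x
      ((symbolMap hP).map x ((jetFrame c fr (k + 1)).e (q.1.castSucc, q.2) x))
    let r : Fin (k + 1) × ι → ℂ := fun q => Fin.lastCases (motive := fun _ => ℂ)
      (k.factorial * ((symFrame c fr k).co x σ q.2 -
        ∑ q' : Fin k × ι, (jetFrame c fr k).co x u q' * b q' q.2))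
      (fun m => (jetFrame c fr k).co x u (m, q.2)) q.1
    let a := ∑ q, r q • (jetFrame c fr (k + 1)).e q x
    have ha : (jetFrame c fr (k + 1)).co x a = r := (jetFrame c fr (k + 1)).co_sum x hx r
    refine ⟨a, Prod.ext ?_ ?_⟩
    · refine (jetFrame c fr k).co_injective hx fun q => ?_
      refine (hproj a q).trans ?_
      rw [ha]
      simp [r]
    · refine (symFrame c fr k).co_injective hx fun i => ?_
      refine (symFrame_co_symbolMap hP hsymbol c fr hx a i).trans ?_
      rw [ha]
      simp only [r, Fin.lastCases_last, Fin.lastCases_castSucc]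
      field_simp
      simp [b]

variable (hloc : HasCharts p A ι)

/-- The splitting of `Jᵏ(A) → J^{k-1}(A)` on the fibres at `x` with image the kernel of the bundle
map of the operator. -/
def splitMap (x : X) : JetFib p A k x →ₗ[ℂ] JetFib p A (k + 1) x :=
  (LinearEquiv.ofBijective _ (projSymbol_bijective hP hsymbol hloc x)).symm.toLinearMap ∘ₗ
    LinearMap.inl ℂ _ _

theorem projSymbol_splitMap (x : X) (u : JetFib p A k x) :
    projSymbol hP x (splitMap hP hsymbol hloc x u) = (u, 0) :=
  (LinearEquiv.ofBijective _ (projSymbol_bijective hP hsymbol hloc x)).apply_symm_apply (u, 0)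

theorem jetProj_splitMap (x : X) (u : JetFib p A k x) :
    jetProj p A (Nat.le_succ k) x (splitMap hP hsymbol hloc x u) = u :=
  congrArg Prod.fst (projSymbol_splitMap hP hsymbol hloc x u)

theorem symbolMap_splitMap (x : X) (u : JetFib p A k x) :
    (symbolMap hP).map x (splitMap hP hsymbol hloc x u) = 0 :=
  congrArg Prod.snd (projSymbol_splitMap hP hsymbol hloc x u)

theorem splitMap_eq {x : X} {u : JetFib p A k x} {a : JetFib p A (k + 1) x}
    (h1 : jetProj p A (Nat.le_succ k) x a = u) (h2 : (symbolMap hP).map x a = 0) :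
    splitMap hP hsymbol hloc x u = a := by
  apply (projSymbol_bijective hP hsymbol hloc x).1
  rw [projSymbol_splitMap]
  exact (Prod.ext h1 h2).symm

/-- A solution germ of the operator at `x` is lifted by the splitting to its own jet. -/
theorem splitMap_jetAt {x : X} {s : A.germs x} (hs : P.val x s = 0) :
    splitMap hP hsymbol hloc x (jetAt p A k x s) = jetAt p A (k + 1) x s :=
  splitMap_eq hP hsymbol hloc rfl hs

theorem jetFrame_co_splitMap_castSucc {y : X} (hy : y ∈ U) (u : JetFib p A k y) (m : Fin k)
    (i : ι) : (jetFrame c fr (k + 1)).co y (splitMap hP hsymbol hloc y u) (m.castSucc, i) =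
      (jetFrame c fr k).co y u (m, i) := by
  conv_rhs => rw [← jetProj_splitMap hP hsymbol hloc y u]
  exact (jetFrame_co_jetProj c fr (Nat.le_succ k) hy _ (m, i)).symm

theorem jetFrame_co_splitMap_last {y : X} (hy : y ∈ U) (u : JetFib p A k y) (i : ι) :
    (jetFrame c fr (k + 1)).co y (splitMap hP hsymbol hloc y u) (Fin.last k, i) =
      - k.factorial * ∑ q : Fin k × ι, (jetFrame c fr k).co y u q *
        (symFrame c fr k).co y
          ((symbolMap hP).map y ((jetFrame c fr (k + 1)).e (q.1.castSucc, q.2) y)) i := by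
  have hk : (k.factorial : ℂ) ≠ 0 := Nat.cast_ne_zero.2 k.factorial_ne_zero
  have h := symFrame_co_symbolMap hP hsymbol c fr hy (splitMap hP hsymbol hloc y u) i
  rw [symbolMap_splitMap, map_zero] at h
  simp only [jetFrame_co_splitMap_castSucc hP hsymbol c fr hloc hy, Pi.zero_apply] at h
  field_simp at h
  linear_combination -h

/-- The splitting `Ψ` of `Jᵏ(A) → J^{k-1}(A)` with image the kernel of the bundle map of the
operator. -/
def splitting : BundleHom (jets p A k) (jets p A (k + 1)) where
  map := splitMap hP hsymbol hloc
  hol s x hs := by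
    obtain ⟨U, hx, ⟨c⟩, ⟨fr⟩⟩ := hloc x
    refine ((jetFrame c fr (k + 1)).hol_iff x hx _).2 ?_
    rintro ⟨m, i⟩
    induction m using Fin.lastCases with
    | cast m =>
      refine ((jetFrame c fr k).hol_co hx hs (m, i)).congr ?_
      filter_upwards [c.mem_nhds hx] with z hz
      exact (jetFrame_co_splitMap_castSucc hP hsymbol c fr hloc hz (s z) m i).symm
    | last =>
      have h1 : ∀ q : Fin k × ι, HolAt B (fun z => (jetFrame c fr k).co z (s z) q *
          (symFrame c fr k).co z ((symbolMap hP).map z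
            ((jetFrame c fr (k + 1)).e (q.1.castSucc, q.2) z)) i) x := fun q =>
        ((jetFrame c fr k).hol_co hx hs q).mul ((symFrame c fr k).hol_co hx
          ((symbolMap hP).hol _ x ((jetFrame c fr (k + 1)).hol_e c.isOpen hx _)) i)
      refine ((HolAt.const (-(k.factorial : ℂ)) x).mul
        (HolAt.finsetSum Finset.univ h1)).congr ?_
      filter_upwards [c.mem_nhds hx] with z hz
      exact (jetFrame_co_splitMap_last hP hsymbol c fr hloc hz (s z) i).symm

end Splitting

/-! ### Relative connections in coordinates -/

section Connections

variable {B : Type uB} [NormedAddCommGroup B] [NormedSpace ℂ B]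
  {X : Type uX} [TopologicalSpace X] [ChartedSpace B X]
  {C : Type uC} [NormedAddCommGroup C] [NormedSpace ℂ C]
  {S : Type uS} [TopologicalSpace S] [ChartedSpace C S]
  {p : Family B X C S} {J : SectionSheaf.{uB, uX, w} B X} {U : Set X} {κ : Type} [Fintype κ]

/-- `L` is the value at `x` of a relative connection: it only depends on the germ of a section and
satisfies the Leibniz identity. -/
structure IsLeibnizAt (p : Family B X C S) (x : X)
    (L : J.germs x →ₗ[ℂ] RelCotangent p x ⊗[ℂ] J.Fib x) : Prop where
  eq_zero : ∀ u : J.germs x, (∀ᶠ y in 𝓝 x, u.1 y = 0) → L u = 0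
  leibniz : ∀ (f : FunGerm B x) (u : J.germs x),
    L (J.mulGerm f u) = f.1 x • L u + relDiff p f.1 x ⊗ₜ[ℂ] u.1 x

theorem IsLeibnizAt.congr {x : X} {L : J.germs x →ₗ[ℂ] RelCotangent p x ⊗[ℂ] J.Fib x}
    (hL : IsLeibnizAt p x L) {u u' : J.germs x} (h : ∀ᶠ y in 𝓝 x, u.1 y = u'.1 y) :
    L u = L u' := by
  rw [← sub_eq_zero, ← map_sub]
  refine hL.eq_zero _ ?_
  filter_upwards [h] with z hz
  exact sub_eq_zero.2 hz

theorem jetAt_eq_zero {n : ℕ} {x : X} {u : J.germs x} (hu : u ∈ vanishing p J n x) :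
    jetAt p J n x u = 0 :=
  (Submodule.Quotient.mk_eq_zero _).2 hu

/-- A connection maps a section that vanishes at `x` to its differential at `x`. -/
theorem IsLeibnizAt.co_of_apply_eq_zero [IsManifold 𝓘(ℂ, B) ω X] {x : X}
    {L : J.germs x →ₗ[ℂ] RelCotangent p x ⊗[ℂ] J.Fib x}
    (hL : IsLeibnizAt p x L) (c : FibreCoord p U) (fr : Frame J U κ) (hx : x ∈ U)
    (u : J.germs x) (hu : u.1 x = 0) (i : κ) :
    (formsFrame c fr).co x (L u) i = c.D (fun z => fr.co z (u.1 z) i) x := by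
  classical
  let f : κ → FunGerm B x := fun i => ⟨fun z => fr.co z (u.1 z) i, fr.hol_co hx u.2 i⟩
  let e : κ → J.germs x := fun i => ⟨fr.e i, fr.hol_e c.isOpen hx i⟩
  have h1 : L u = L (∑ i, J.mulGerm (f i) (e i)) := by
    refine hL.congr ?_
    filter_upwards [c.mem_nhds hx] with z hz
    simp only [Submodule.coe_sum, Finset.sum_apply]
    exact (fr.sum_co z hz _).symm
  have h2 : ∀ i, (f i).1 x = 0 := fun i => by
    change fr.co x (u.1 x) i = 0
    rw [hu, map_zero]
    rfl
  rw [h1, map_sum]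
  simp only [hL.leibniz, h2, zero_smul, zero_add, map_sum, Finset.sum_apply]
  have h3 : ∀ j, (formsFrame c fr).co x (relDiff p (f j).1 x ⊗ₜ[ℂ] (e j).1 x) i =
      if i = j then c.D (f j).1 x else 0 := by
    intro j
    refine (tensorCo_tmul fr (c.ev x) x _ _ i).trans ?_
    change _ * fr.co x (fr.e j x) i = _
    rw [fr.co_e hx, Pi.single_apply, mul_ite, mul_one, mul_zero]
    rfl
  simp only [h3, Finset.sum_ite_eq, Finset.mem_univ, if_true]
  rfl

/-- A connection is determined at `x` by a section with a prescribed value at `x` that is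
horizontal there. -/
theorem IsLeibnizAt.co_of_horizontal [IsManifold 𝓘(ℂ, B) ω X] {x : X}
    {L : J.germs x →ₗ[ℂ] RelCotangent p x ⊗[ℂ] J.Fib x}
    (hL : IsLeibnizAt p x L) (c : FibreCoord p U) (fr : Frame J U κ) (hx : x ∈ U)
    {u u' : J.germs x} (hu : u'.1 x = u.1 x) (hu' : L u' = 0) (i : κ) :
    (formsFrame c fr).co x (L u) i =
      c.D (fun z => fr.co z (u.1 z) i) x - c.D (fun z => fr.co z (u'.1 z) i) x := by
  have h1 : L u = L (u - u') := by rw [map_sub, hu', sub_zero]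
  have h2 : (fun z => fr.co z (u.1 z) i) =ᶠ[𝓝 x]
      fun z => fr.co z ((u - u').1 z) i + fr.co z (u'.1 z) i :=
    Filter.Eventually.of_forall fun z => by simp
  rw [h1, hL.co_of_apply_eq_zero c fr hx (u - u') (sub_eq_zero.2 hu.symm),
    (c.D_congr h2).eq_of_nhds,
    (c.D_add (fr.hol_co hx (u - u').2 i) (fr.hol_co hx u'.2 i)).eq_of_nhds, add_sub_cancel_right]

theorem IsRelConnection.isLeibnizAt [IsManifold 𝓘(ℂ, B) ω X] {D : Operator J (formsTensor p J)}
    (hD : IsRelConnection p D) (x : X) : IsLeibnizAt p x (D.val x) :=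
  ⟨D.val_eq_zero x, hD.2 x⟩

/-- A relative connection annihilates the germs that vanish to order two along the fibre. -/
theorem IsRelConnection.val_eq_zero [IsManifold 𝓘(ℂ, B) ω X] {D : Operator J (formsTensor p J)}
    (hD : IsRelConnection p D) (x : X) (u : J.germs x) (hu : u ∈ vanishing p J 2 x) :
    D.val x u = 0 := by
  induction hu using Submodule.span_induction with
  | mem u hu =>
    obtain ⟨f, t, hf, hs⟩ | ⟨g, t, hg, hg0, hs⟩ := hu
    · rw [D.val_congr (s' := J.mulGerm (FunGerm.prod f) t) hs, hD.2]
      have h1 : (FunGerm.prod f).1 = fun z => (f 0).1 z * (f 1).1 z := by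
        funext z
        simp [FunGerm.prod, Fin.prod_univ_two]
      rw [h1, relDiff_mul p (f 0).2 (f 1).2]
      simp [hf]
    · rw [D.val_congr (s' := J.mulGerm ⟨fun z => g (p.proj z), hg.comp_proj⟩ t) hs, hD.2,
        relDiff_comp_proj p hg]
      simp [hg0]
  | zero => exact map_zero _
  | add s s' _ _ h1 h2 => rw [map_add, h1, h2, add_zero]
  | smul r s _ h1 => rw [map_smul, h1, smul_zero]

end Connections

/-! ### The connection of an operator with identity symbol -/

section Induced

variable {B : Type uB} [NormedAddCommGroup B] [NormedSpace ℂ B]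
  {X : Type uX} [TopologicalSpace X] [ChartedSpace B X]
  {C : Type uC} [NormedAddCommGroup C] [NormedSpace ℂ C]
  {S : Type uS} [TopologicalSpace S] [ChartedSpace C S]
  [IsManifold 𝓘(ℂ, B) ω X] [IsManifold 𝓘(ℂ, C) ω S]
  {p : Family B X C S} {A : SectionSheaf.{uB, uX, w} B X} {U : Set X} {ι : Type} [Fintype ι]
  {k : ℕ} {P : Operator A (symFormsTensor p k A)}

/-- The germ of the section of the jet bundle defined by a germ of a section. -/
def jetGerm (p : Family B X C S) (k : ℕ) {x : X} (s : A.germs x) : (jets p A k).germs x :=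
  ⟨(jetOp p A k).app s.1, (jetOp p A k).hol x s⟩

omit [IsManifold 𝓘(ℂ, C) ω S] in
theorem jetGerm_apply {x : X} (s : A.germs x) {z : X} (hz : A.Hol s.1 z) :
    (jetGerm p k s).1 z = jetAt p A k z ⟨s.1, hz⟩ :=
  applyField_of_hol _ hz

theorem jetFrame_co_jetGerm (c : FibreCoord p U) (fr : Frame A U ι) {x : X} (hx : x ∈ U)
    (s : A.germs x) (q : Fin k × ι) :
    (fun z => (jetFrame c fr k).co z ((jetGerm p k s).1 z) q) =ᶠ[𝓝 x]
      c.D^[q.1] fun z => fr.co z (s.1 z) q.2 := by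
  filter_upwards [c.mem_nhds hx, A.eventually s.2] with z hz hsz
  rw [jetGerm_apply s hsz, jetFrame_co_jetAt c fr k hz]

/-- `L` is the value at `x` of the connection defined by `P`: the jets of the sections `s` such that
`P s` vanishes at `x` are horizontal at `x`. -/
structure IsInducedAt (P : Operator A (symFormsTensor p k A)) (x : X)
    (L : (jets p A k).germs x →ₗ[ℂ] RelCotangent p x ⊗[ℂ] JetFib p A k x) : Prop
    extends IsLeibnizAt p x L where
  flat : ∀ s : A.germs x, P.val x s = 0 → L (jetGerm p k s) = 0

variable (hP : IsRelDiffOp p k P) (hsymbol : HasIdentitySymbol p k P) (hloc : HasCharts p A ι)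

/-- In the frames defined by a fibre coordinate, the connection of `P` subtracts from the derivative
of each coordinate the next coordinate of the lift to `Jᵏ(A)`. -/
theorem IsInducedAt.co_eq {x : X}
    {L : (jets p A k).germs x →ₗ[ℂ] RelCotangent p x ⊗[ℂ] JetFib p A k x}
    (hL : IsInducedAt P x L) (c : FibreCoord p U) (fr : Frame A U ι) (hx : x ∈ U)
    (u : (jets p A k).germs x) (q : Fin k × ι) :
    (formsFrame c (jetFrame c fr k)).co x (L u) q =
      c.D (fun z => (jetFrame c fr k).co z (u.1 z) q) x -
      (jetFrame c fr (k + 1)).co x (splitMap hP hsymbol hloc x (u.1 x)) (q.1.succ, q.2) := by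
  obtain ⟨s, hs⟩ := Submodule.mkQ_surjective _ (splitMap hP hsymbol hloc x (u.1 x))
  replace hs : jetAt p A (k + 1) x s = splitMap hP hsymbol hloc x (u.1 x) := hs
  have hPs : P.val x s = 0 := by
    rw [← symbolMap_splitMap hP hsymbol hloc x (u.1 x), ← hs]
    rfl
  have hjs : (jetGerm p k s).1 x = u.1 x := by
    rw [jetGerm_apply s s.2, ← jetProj_splitMap hP hsymbol hloc x (u.1 x), ← hs]
    rfl
  rw [hL.toIsLeibnizAt.co_of_horizontal c (jetFrame c fr k) hx hjs (hL.flat s hPs), ← hs,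
    jetFrame_co_jetAt c fr (k + 1) hx, (c.D_congr (jetFrame_co_jetGerm c fr hx s q)).eq_of_nhds,
    Fin.val_succ, Function.iterate_succ_apply']

include hP hsymbol hloc in
/-- The formula of `IsInducedAt.co_eq` defines the connection of `P` at `x`. -/
theorem exists_isInducedAt (x : X) : ∃ L, IsInducedAt P x L := by
  obtain ⟨U, hx, ⟨c⟩, ⟨fr⟩⟩ := hloc x
  let Fr := jetFrame c fr k
  -- the coordinates of the connection
  let N : (jets p A k).germs x →ₗ[ℂ] (Fin k × ι → ℂ) :=
    { toFun := fun u q => c.D (fun z => Fr.co z (u.1 z) q) x -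
        (jetFrame c fr (k + 1)).co x (splitMap hP hsymbol hloc x (u.1 x)) (q.1.succ, q.2)
      map_add' := fun u u' => by
        funext q
        have h := (c.D_add (Fr.hol_co hx u.2 q) (Fr.hol_co hx u'.2 q)).eq_of_nhds
        simp only [Submodule.coe_add, Pi.add_apply, map_add]
        rw [h]
        ring
      map_smul' := fun r u => by
        funext q
        have h := (c.D_const_mul r (Fr.hol_co hx u.2 q)).eq_of_nhds
        simp only [Submodule.coe_smul, Pi.smul_apply, map_smul, RingHom.id_apply, smul_eq_mul]
        rw [h]
        ring }
  let L : (jets p A k).germs x →ₗ[ℂ] RelCotangent p x ⊗[ℂ] JetFib p A k x :=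
    (Fintype.linearCombination ℂ fun q => (formsFrame c Fr).e q x) ∘ₗ N
  have hL : ∀ u q, (formsFrame c Fr).co x (L u) q = N u q := fun u q =>
    congrFun ((formsFrame c Fr).co_sum x hx (N u)) q
  refine ⟨L, ⟨⟨fun u hu => ?_, fun f u => ?_⟩, fun s hs => ?_⟩⟩
  · refine (formsFrame c Fr).co_injective hx fun q => ?_
    rw [hL, map_zero]
    have h1 : (fun z => Fr.co z (u.1 z) q) =ᶠ[𝓝 x] fun _ => 0 := by
      filter_upwards [hu] with z hz
      rw [hz, map_zero]
      rfl
    change c.D (fun z => Fr.co z (u.1 z) q) x - _ = 0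
    rw [(c.D_congr h1).eq_of_nhds, c.D_const, hu.self_of_nhds, map_zero, map_zero]
    simp
  · refine (formsFrame c Fr).co_injective hx fun q => ?_
    have h2 : (formsFrame c Fr).co x (relDiff p f.1 x ⊗ₜ[ℂ] u.1 x) q =
      c.D f.1 x * Fr.co x (u.1 x) q := tensorCo_tmul Fr (c.ev x) x _ _ q
    rw [map_add, map_smul, Pi.add_apply, Pi.smul_apply, hL, hL, h2, smul_eq_mul]
    have h3 := (c.D_mul f.2 (Fr.hol_co hx u.2 q)).eq_of_nhds
    simp only [N, SectionSheaf.mulGerm, LinearMap.coe_mk, AddHom.coe_mk, map_smul, Pi.smul_apply,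
      smul_eq_mul]
    rw [h3]
    ring
  · refine (formsFrame c Fr).co_injective hx fun q => ?_
    rw [hL, map_zero]
    change c.D (fun z => Fr.co z ((jetGerm p k s).1 z) q) x -
      (jetFrame c fr (k + 1)).co x (splitMap hP hsymbol hloc x ((jetGerm p k s).1 x))
        (q.1.succ, q.2) = 0
    rw [jetGerm_apply s s.2, splitMap_jetAt hP hsymbol hloc hs, jetFrame_co_jetAt c fr (k + 1) hx,
      (c.D_congr (jetFrame_co_jetGerm c fr hx s q)).eq_of_nhds, Fin.val_succ,
      Function.iterate_succ_apply', sub_self]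

include hP hsymbol hloc in
theorem IsInducedAt.unique {x : X}
    {L L' : (jets p A k).germs x →ₗ[ℂ] RelCotangent p x ⊗[ℂ] JetFib p A k x}
    (hL : IsInducedAt P x L) (hL' : IsInducedAt P x L') : L = L' := by
  obtain ⟨U, hx, ⟨c⟩, ⟨fr⟩⟩ := hloc x
  ext1 u
  refine (formsFrame c (jetFrame c fr k)).co_injective hx fun q => ?_
  rw [hL.co_eq hP hsymbol hloc c fr hx u q, hL'.co_eq hP hsymbol hloc c fr hx u q]

/-- The relative connection on `J^{k-1}(A)` defined by an operator of order `k` with identity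
symbol. -/
def inducedConnection : Operator (jets p A k) (formsTensor p (jets p A k)) where
  val x := (exists_isInducedAt hP hsymbol hloc x).choose
  val_eq_zero x := (exists_isInducedAt hP hsymbol hloc x).choose_spec.eq_zero
  hol x u := by
    obtain ⟨U, hx, ⟨c⟩, ⟨fr⟩⟩ := hloc x
    refine (formsFrame c (jetFrame c fr k)).hol_of_eventually hx (f := fun q z =>
      c.D (fun y => (jetFrame c fr k).co y (u.1 y) q) z -
      (jetFrame c fr (k + 1)).co z (splitMap hP hsymbol hloc z (u.1 z)) (q.1.succ, q.2))
      (fun q => (c.D_hol hx ((jetFrame c fr k).hol_co hx u.2 q)).sub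
        ((jetFrame c fr (k + 1)).hol_co hx
          ((splitting hP hsymbol hloc).hol _ x u.2) (q.1.succ, q.2))) ?_
    filter_upwards [c.mem_nhds hx, (jets p A k).eventually u.2] with z hz huz q
    rw [applyField_of_hol _ huz]
    exact (exists_isInducedAt hP hsymbol hloc z).choose_spec.co_eq hP hsymbol hloc c fr hz
      ⟨u.1, huz⟩ q

theorem isInducedAt_inducedConnection (x : X) :
    IsInducedAt P x ((inducedConnection hP hsymbol hloc).val x) :=
  (exists_isInducedAt hP hsymbol hloc x).choose_spec

theorem isRelConnection_inducedConnection :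
    IsRelConnection p (inducedConnection hP hsymbol hloc) := by
  have hL := fun x => (isInducedAt_inducedConnection hP hsymbol hloc x).leibniz
  refine ⟨fun x g hg h s => ?_, hL⟩
  rw [hL x]
  have h1 : relDiff p (g ∘ p.proj) x = 0 := relDiff_comp_proj p hg
  simp [h1]

include hloc in
/-- The jet of order `k - 1` of a germ that vanishes to order `k + 1` vanishes to order two. -/
theorem jetGerm_mem_vanishing (x : X) (s : A.germs x) (hs : s ∈ vanishing p A (k + 1) x) :
    jetGerm p k s ∈ vanishing p (jets p A k) 2 x := by
  obtain ⟨U, hx, ⟨c⟩, ⟨fr⟩⟩ := hloc x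
  rw [mem_vanishing_iff c fr hx] at hs
  rw [mem_vanishing_iff c (jetFrame c fr k) hx]
  intro q
  refine FibreCoord.Flat.congr ?_ (jetFrame_co_jetGerm c fr hx s q).symm
  intro m hm
  rw [← Function.iterate_add_apply]
  exact hs q.2 _ (by have := q.1.2; omega)

/-- The canonical map `θ : Jᵏ(A) → J¹(J^{k-1}(A))`. -/
def jetJetMap : BundleHom (jets p A (k + 1)) (jets p (jets p A k) 2) :=
  BundleHom.ofOperator (k + 1) ((jetOp p (jets p A k) 2).comp (jetOp p A k)) fun x s hs =>
    jetAt_eq_zero (jetGerm_mem_vanishing hloc x s hs)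

theorem isInducedConnection_inducedConnection :
    IsInducedConnection p k P (inducedConnection hP hsymbol hloc) := by
  have hD := isRelConnection_inducedConnection hP hsymbol hloc
  refine ⟨hD, symbolMap hP, splitting hP hsymbol hloc, jetJetMap hloc,
    BundleHom.ofOperator 2 (inducedConnection hP hsymbol hloc) hD.val_eq_zero,
    fun x s => rfl, jetProj_splitMap hP hsymbol hloc, symbolMap_splitMap hP hsymbol hloc,
    fun x s => rfl, fun x s => rfl, fun x u => ?_⟩
  obtain ⟨s, hs⟩ := Submodule.mkQ_surjective _ (splitMap hP hsymbol hloc x u)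
  have hPs : P.val x s = 0 := by
    rw [← symbolMap_splitMap hP hsymbol hloc x u, ← hs]
    rfl
  have h := (isInducedAt_inducedConnection hP hsymbol hloc x).flat s hPs
  rw [← h]
  change _ = (BundleHom.ofOperator 2 (inducedConnection hP hsymbol hloc) hD.val_eq_zero).map x
    ((jetJetMap hloc).map x (jetAt p A (k + 1) x s))
  exact congrArg (fun a => (BundleHom.ofOperator 2 (inducedConnection hP hsymbol hloc)
    hD.val_eq_zero).map x ((jetJetMap hloc).map x a)) hs.symm

include hP hsymbol hloc in
/-- The condition `χ ∘ θ ∘ Ψ = 0` in terms of sections. -/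
theorem IsInducedConnection.isInducedAt {D : Operator (jets p A k) (formsTensor p (jets p A k))}
    (hD : IsInducedConnection p k P D) (x : X) : IsInducedAt P x (D.val x) := by
  obtain ⟨hconn, φ, Ψ, θ, χ, hφ, hΨ, hφΨ, hθ, hχ, h0⟩ := hD
  refine ⟨hconn.isLeibnizAt x, fun s hs => ?_⟩
  have hφ' : ∀ a, φ.map x a = (symbolMap hP).map x a := by
    intro a
    obtain ⟨t, rfl⟩ := Submodule.mkQ_surjective _ a
    exact hφ x t
  -- both `Ψ (jᵏ⁻¹ s)` and `jᵏ s` lift `jᵏ⁻¹ s` to the kernel of `φ`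
  have h1 : Ψ.map x (jetAt p A k x s) = jetAt p A (k + 1) x s := by
    rw [← splitMap_jetAt hP hsymbol hloc hs]
    exact (splitMap_eq hP hsymbol hloc (hΨ x _) (by rw [← hφ', hφΨ])).symm
  have h2 := h0 x (jetAt p A k x s)
  rw [h1] at h2
  have h3 := hθ x s
  have h4 := hχ x (jetGerm p k s)
  change θ.map x (jetAt p A (k + 1) x s) = _ at h3
  rw [h3] at h2
  exact h4.symm.trans h2

theorem IsInducedConnection.eq_inducedConnection
    {D : Operator (jets p A k) (formsTensor p (jets p A k))}
    (hD : IsInducedConnection p k P D) : D = inducedConnection hP hsymbol hloc := by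
  ext1
  funext x
  exact (hD.isInducedAt hP hsymbol hloc x).unique hP hsymbol hloc
    (isInducedAt_inducedConnection hP hsymbol hloc x)

end Induced

/-! ### Contraction with the vector field of a fibre coordinate -/

section Contract

variable {B : Type uB} [NormedAddCommGroup B] [NormedSpace ℂ B]
  {X : Type uX} [TopologicalSpace X] [ChartedSpace B X]
  {C : Type uC} [NormedAddCommGroup C] [NormedSpace ℂ C]
  {S : Type uS} [TopologicalSpace S] [ChartedSpace C S]
  {p : Family B X C S} {U : Set X} (c : FibreCoord p U)
  {M : Type w} [AddCommGroup M] [Module ℂ M] {M' : Type w'} [AddCommGroup M'] [Module ℂ M']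

theorem contract_tmul {x : X} (v : RelTangent p x) (η : RelCotangent p x) (a : M) :
    contract p M v (η ⊗ₜ a) = η v • a := by
  simp [contract]

theorem contract_lTensor {x : X} (v : RelTangent p x) (f : M →ₗ[ℂ] M')
    (τ : RelCotangent p x ⊗[ℂ] M) :
    contract p M' v (LinearMap.lTensor (RelCotangent p x) f τ) = f (contract p M v τ) := by
  induction τ using TensorProduct.induction_on with
  | zero => simp
  | tmul η a => simp [contract_tmul]
  | add τ τ' h1 h2 => simp only [map_add, h1, h2]

theorem contract_smul {x : X} (r : ℂ) (v : RelTangent p x) (τ : RelCotangent p x ⊗[ℂ] M) :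
    contract p M (r • v) τ = r • contract p M v τ := by
  induction τ using TensorProduct.induction_on with
  | zero => simp
  | tmul η a => simp [contract_tmul, mul_smul]
  | add τ τ' h1 h2 => simp only [map_add, h1, h2, smul_add]

theorem tmul_contract {x : X} (hx : x ∈ U) (τ : RelCotangent p x ⊗[ℂ] M) :
    relDiff p c.t x ⊗ₜ[ℂ] contract p M (c.v x) τ = τ := by
  induction τ using TensorProduct.induction_on with
  | zero => simp
  | tmul η a => rw [contract_tmul, ← TensorProduct.smul_tmul, ← c.cotangent_eq hx]
  | add τ τ' h1 h2 => rw [map_add, TensorProduct.tmul_add, h1, h2]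

theorem contract_injective {x : X} (hx : x ∈ U) {τ τ' : RelCotangent p x ⊗[ℂ] M}
    (h : contract p M (c.v x) τ = contract p M (c.v x) τ') : τ = τ' := by
  rw [← tmul_contract c hx τ, h, tmul_contract c hx]

/-- The contraction of a sum of simple tensors, in linear coordinates on the second factor. -/
theorem coordinate_contract_sum {ι κ : Type*} [Fintype κ] (g : M ≃ₗ[ℂ] (ι → ℂ)) {x : X}
    (v : RelTangent p x) (η : κ → RelCotangent p x) (a : κ → M) (l : ι) :
    g (contract p M v (∑ i, η i ⊗ₜ[ℂ] a i)) l = ∑ i, η i v * g (a i) l := by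
  simp only [map_sum, contract_tmul, map_smul, Finset.sum_apply, Pi.smul_apply, smul_eq_mul]

/-- As `Ω¹` has rank one, a linear isomorphism followed by the product with `dt` is bijective onto
`Ω¹ ⊗ M'`. -/
theorem exists_bijective_contract_eq {x : X} (hx : x ∈ U) (e : M ≃ₗ[ℂ] M') :
    ∃ α : M →ₗ[ℂ] RelCotangent p x ⊗[ℂ] M', (∀ g, contract p M' (c.v x) (α g) = e g) ∧
      Function.Bijective α := by
  have hα : ∀ g, contract p M' (c.v x) (relDiff p c.t x ⊗ₜ[ℂ] e g) = e g := fun g => by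
    rw [contract_tmul, c.relDiff_t x hx, one_smul]
  refine ⟨TensorProduct.mk ℂ (RelCotangent p x) M' (relDiff p c.t x) ∘ₗ e.toLinearMap, hα,
    fun g g' hg => e.injective ?_, fun σ => ⟨e.symm (contract p M' (c.v x) σ), ?_⟩⟩
  · rw [← hα g, ← hα g']
    exact congrArg (contract p M' (c.v x)) hg
  · exact (congrArg _ (e.apply_symm_apply _)).trans (tmul_contract c hx σ)

theorem formsFrame_co [IsManifold 𝓘(ℂ, B) ω X] {J : SectionSheaf.{uB, uX, w} B X} {κ : Type}
    [Fintype κ] (fr : Frame J U κ) (x : X) (τ : RelCotangent p x ⊗[ℂ] J.Fib x) :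
    (formsFrame c fr).co x τ = fr.co x (contract p (J.Fib x) (c.v x) τ) := by
  induction τ using TensorProduct.induction_on with
  | zero => simp
  | tmul η a =>
    rw [contract_tmul, map_smul]
    funext i
    exact tensorCo_tmul fr (c.ev x) x η a i
  | add τ τ' h1 h2 => rw [map_add, map_add, map_add, h1, h2]

end Contract

section Filtration

variable {B : Type uB} [NormedAddCommGroup B] [NormedSpace ℂ B]
  {X : Type uX} [TopologicalSpace X] [ChartedSpace B X]
  {C : Type uC} [NormedAddCommGroup C] [NormedSpace ℂ C]
  {S : Type uS} [TopologicalSpace S] [ChartedSpace C S]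
  [IsManifold 𝓘(ℂ, B) ω X] [IsManifold 𝓘(ℂ, C) ω S]
  {p : Family B X C S} {A : SectionSheaf.{uB, uX, w} B X} {U : Set X} {ι : Type} [Fintype ι]
  {k : ℕ}

/-! ### The filtration of the jet bundle by the kernels of the projections -/

section Kernels

variable (c : FibreCoord p U) (fr : Frame A U ι)

/-- The kernels are cut out by the coordinates of low order. -/
theorem mem_jetKernel_iff {x : X} (hx : x ∈ U) (i : ℕ) (a : JetFib p A k x) :
    a ∈ jetKernel p A k i x ↔
      ∀ q : Fin k × ι, q.1.1 < k - i → (jetFrame c fr k).co x a q = 0 := by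
  rw [jetKernel, LinearMap.mem_ker]
  constructor
  · intro h q hq
    have h1 := jetFrame_co_jetProj c fr (Nat.sub_le k i) hx a (⟨q.1.1, hq⟩, q.2)
    rw [h, map_zero] at h1
    exact h1.symm
  · intro h
    refine (jetFrame c fr (k - i)).co_injective hx fun q => ?_
    rw [map_zero]
    exact (jetFrame_co_jetProj c fr (Nat.sub_le k i) hx a q).trans (h _ q.1.2)

theorem jetKernel_eq_span {x : X} (hx : x ∈ U) (i : ℕ) :
    jetKernel p A k i x = Submodule.span ℂ
      ((fun q => (jetFrame c fr k).e q x) '' {q : Fin k × ι | k - i ≤ q.1.1}) := by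
  ext a
  rw [(jetFrame c fr k).mem_span_image_iff hx, mem_jetKernel_iff c fr hx]
  simp only [Set.mem_ofPred_eq, not_le]

theorem jetFrame_e_mem_jetKernel {x : X} (hx : x ∈ U) {i : ℕ} {q : Fin k × ι}
    (h : k - i ≤ q.1.1) : (jetFrame c fr k).e q x ∈ jetKernel p A k i x := by
  rw [jetKernel_eq_span c fr hx]
  exact Submodule.subset_span ⟨q, h, rfl⟩

end Kernels

omit [IsManifold 𝓘(ℂ, C) ω S] in
theorem jetKernel_zero (x : X) : jetKernel p A k 0 x = ⊥ := by
  refine (Submodule.eq_bot_iff _).2 fun a ha => ?_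
  obtain ⟨s, rfl⟩ := Submodule.mkQ_surjective _ a
  exact ha

theorem jetKernel_self (hloc : HasCharts p A ι) (x : X) : jetKernel p A k k x = ⊤ := by
  obtain ⟨U, hx, ⟨c⟩, ⟨fr⟩⟩ := hloc x
  refine Submodule.eq_top_iff'.2 fun a => (mem_jetKernel_iff c fr hx k a).2 fun q hq => ?_
  omega

theorem jetKernel_mono (hloc : HasCharts p A ι) {i i' : ℕ} (h : i ≤ i') (x : X) :
    jetKernel p A k i x ≤ jetKernel p A k i' x := by
  obtain ⟨U, hx, ⟨c⟩, ⟨fr⟩⟩ := hloc x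
  intro a ha
  rw [mem_jetKernel_iff c fr hx] at ha ⊢
  exact fun q hq => ha q (by omega)

theorem jetKernel_lt (hloc : HasCharts p A ι) {i : ℕ} (h : i < k) (x : X)
    [Nontrivial (A.Fib x)] : jetKernel p A k i x < jetKernel p A k (i + 1) x := by
  classical
  obtain ⟨U, hx, ⟨c⟩, ⟨fr⟩⟩ := hloc x
  obtain ⟨l⟩ : Nonempty ι := by
    by_contra hι
    rw [not_nonempty_iff] at hι
    obtain ⟨a, b, hab⟩ := exists_pair_ne (A.Fib x)
    exact hab (fr.co_injective hx fun l => hι.elim l)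
  refine lt_of_le_of_ne (jetKernel_mono hloc i.le_succ x) fun heq => ?_
  let q : Fin k × ι := (⟨k - (i + 1), by omega⟩, l)
  have h1 : (jetFrame c fr k).e q x ∈ jetKernel p A k (i + 1) x :=
    jetFrame_e_mem_jetKernel c fr hx le_rfl
  rw [← heq, mem_jetKernel_iff c fr hx] at h1
  have h2 := h1 q (by simp only [q]; omega)
  rw [(jetFrame c fr k).co_e hx, Pi.single_eq_same] at h2
  exact one_ne_zero h2

theorem jets_isVectorBundle (hloc : HasCharts p A ι) : (jets p A k).IsVectorBundle := by
  intro x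
  obtain ⟨U, hx, ⟨c⟩, ⟨fr⟩⟩ := hloc x
  exact ⟨_, _, (jetFrame c fr k).isFrameNear c.isOpen hx (Fintype.equivFin _).symm⟩

theorem jetKernel_isSubbundle (hloc : HasCharts p A ι) (i : ℕ) :
    (jets p A k).IsSubbundle (jetKernel p A k i) := by
  intro x
  obtain ⟨U, hx, ⟨c⟩, ⟨fr⟩⟩ := hloc x
  let σ : Fin (Fintype.card (Fin k × ι)) ≃ Fin k × ι := (Fintype.equivFin _).symm
  refine ⟨_, _, σ ⁻¹' {q | k - i ≤ q.1.1}, (jetFrame c fr k).isFrameNear c.isOpen hx σ, ?_⟩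
  filter_upwards [c.mem_nhds hx] with y hy
  rw [jetKernel_eq_span c fr hy]
  congr 1
  conv_lhs => rw [← Set.image_preimage_eq {q : Fin k × ι | k - i ≤ q.1.1} σ.surjective,
    Set.image_image]

/-! ### Jets of products -/

section Shift

variable (c : FibreCoord p U) (fr : Frame A U ι)

theorem jetFrame_co_shiftGerm_of_lt {x : X} (hx : x ∈ U) {j : ℕ} (f : Fin j → FunGerm B x)
    (s : A.germs x) (q : Fin k × ι) (hq : q.1.1 < j) :
    (jetFrame c fr k).co x (jetAt p A k x (shiftGerm A f s)) q = 0 := by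
  rw [jetFrame_co_jetAt c fr k hx]
  have h := c.flat_prod_mul (g := fun a y => (f a).1 x - (f a).1 y) hx
    (fun a => (HolAt.const _ x).sub (f a).2) (fun a => sub_self _) (fr.hol_co hx s.2 q.2)
  have h1 : (fun z => fr.co z ((shiftGerm A f s).1 z) q.2) =
      fun z => (∏ a, ((f a).1 x - (f a).1 z)) * fr.co z (s.1 z) q.2 := by
    funext z
    simp [shiftGerm, SectionSheaf.mulGerm]
  rw [h1, h q.1 hq]

theorem jetFrame_co_shiftGerm {x : X} (hx : x ∈ U) {j : ℕ} (hj : j < k) (f : Fin j → FunGerm B x)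
    (s : A.germs x) (l : ι) :
    (jetFrame c fr k).co x (jetAt p A k x (shiftGerm A f s)) (⟨j, hj⟩, l) =
      (-1) ^ j * j.factorial * ((∏ a, c.D (f a).1 x) * fr.co x (s.1 x) l) := by
  rw [jetFrame_co_jetAt c fr k hx]
  have h := c.iter_prod_mul (g := fun a y => (f a).1 x - (f a).1 y) hx
    (fun a => (HolAt.const _ x).sub (f a).2) (fun a => sub_self _) (fr.hol_co hx s.2 l)
  have hD : ∀ a, c.D (fun y => (f a).1 x - (f a).1 y) x = - c.D (f a).1 x := by
    intro a
    have h1 := (c.D_add (HolAt.const ((f a).1 x) x) (f a).2.neg).eq_of_nhds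
    have h2 := (c.D_const_mul (-1) (f a).2).eq_of_nhds
    simp only [neg_one_mul] at h2
    rw [c.D_const, h2, zero_add] at h1
    simpa only [← sub_eq_add_neg] using h1
  simp only [hD, Finset.prod_neg, Finset.card_univ, Fintype.card_fin] at h
  have h3 : (fun z => fr.co z ((shiftGerm A f s).1 z) l) =
      fun z => (∏ a, ((f a).1 x - (f a).1 z)) * fr.co z (s.1 z) l := by
    funext z
    simp [shiftGerm, SectionSheaf.mulGerm]
  rw [h3, h]
  ring

theorem jetAt_shiftGerm_mem {x : X} (hloc : HasCharts p A ι) {i j : ℕ} (hij : i + j = k)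
    (f : Fin j → FunGerm B x) (s : A.germs x) :
    jetAt p A k x (shiftGerm A f s) ∈ jetKernel p A k i x := by
  obtain ⟨U, hx, ⟨c⟩, ⟨fr⟩⟩ := hloc x
  exact (mem_jetKernel_iff c fr hx i _).2 fun q hq =>
    jetFrame_co_shiftGerm_of_lt c fr hx f s q (by omega)

end Shift

/-- The subbundle `Symʲ Ω¹ ⊗ A` of `Jʲ(A)` is the first kernel. -/
theorem symSubbundle_eq (hloc : HasCharts p A ι) {j : ℕ} (hj : j + 1 = k) :
    symSubbundle p A k j = jetKernel p A k 1 := by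
  subst hj
  funext x
  refine le_antisymm (Submodule.span_le.2 ?_) ?_
  · rintro _ ⟨⟨f, s⟩, rfl⟩
    exact jetAt_shiftGerm_mem hloc (by omega) f s
  · obtain ⟨U, hx, ⟨c⟩, ⟨fr⟩⟩ := hloc x
    rw [jetKernel_eq_span c fr hx, Submodule.span_le]
    rintro _ ⟨⟨m, l⟩, hm, rfl⟩
    have hmj : m.1 = j := by
      have h1 := m.2
      have h2 : j + 1 - 1 ≤ m.1 := hm
      omega
    let e : A.germs x := ⟨fr.e l, fr.hol_e c.isOpen hx l⟩
    let t : FunGerm B x := ⟨c.t, c.t_hol x hx⟩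
    have h1 : monoGerm c fr hx (c.t x) m l =
        ((-1) ^ j * (j.factorial : ℂ)⁻¹) • shiftGerm A (fun _ : Fin j => t) e := by
      apply Subtype.ext
      funext z
      simp only [monoGerm, FibreCoord.mono, shiftGerm, SectionSheaf.mulGerm, t, e, hmj,
        Submodule.coe_smul, Pi.smul_apply, Finset.prod_const, Finset.card_univ, Fintype.card_fin,
        ← mul_smul]
      rw [← neg_sub (c.t z) (c.t x), neg_pow (c.t z - c.t x)]
      have h2 : ((-1 : ℂ) ^ j) * (-1) ^ j = 1 := by rw [← mul_pow]; simp
      congr 1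
      linear_combination (-((j.factorial : ℂ)⁻¹ * (c.t z - c.t x) ^ j)) * h2
    change (jetFrame c fr (j + 1)).e (m, l) x ∈ _
    rw [jetFrame_e c fr (j + 1) hx, h1, map_smul]
    exact Submodule.smul_mem _ _ (Submodule.subset_span ⟨(fun _ => t, e), rfl⟩)

/-! ### The graded pieces -/

section Graded

variable (c : FibreCoord p U) (fr : Frame A U ι)

/-- The coordinates of order `j` of the elements of `K_{i+1}`, for `i + 1 + j = k`. -/
def gradedCo (x : X) {i j : ℕ} (hij : i + 1 + j = k) :
    jetKernel p A k (i + 1) x →ₗ[ℂ] (ι → ℂ) :=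
  LinearMap.pi fun l => LinearMap.proj (⟨j, by omega⟩, l) ∘ₗ (jetFrame c fr k).co x ∘ₗ
    (jetKernel p A k (i + 1) x).subtype

theorem gradedCo_apply (x : X) {i j : ℕ} (hij : i + 1 + j = k)
    (a : jetKernel p A k (i + 1) x) (l : ι) :
    gradedCo c fr x hij a l = (jetFrame c fr k).co x a.1 (⟨j, by omega⟩, l) := rfl

theorem ker_gradedCo {x : X} (hx : x ∈ U) {i j : ℕ} (hij : i + 1 + j = k) :
    LinearMap.ker (gradedCo (A := A) (p := p) c fr x hij) =
      (jetKernel p A k i x).submoduleOf (jetKernel p A k (i + 1) x) := by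
  ext a
  rw [LinearMap.mem_ker, Submodule.submoduleOf, Submodule.mem_comap, Submodule.coe_subtype,
    mem_jetKernel_iff c fr hx]
  have ha := (mem_jetKernel_iff c fr hx (i + 1) a.1).1 a.2
  constructor
  · rintro h ⟨m, l⟩ hm
    by_cases hmj : m.1 = j
    · have h1 := congrFun h l
      rw [gradedCo_apply] at h1
      subst hmj
      exact h1
    · exact ha (m, l) (by simp only at hm ⊢; omega)
  · intro h
    funext l
    rw [gradedCo_apply]
    exact h _ (by simp only; omega)

theorem gradedCo_surjective {x : X} (hx : x ∈ U) {i j : ℕ} (hij : i + 1 + j = k) :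
    Function.Surjective (gradedCo (A := A) (p := p) c fr x hij) := by
  classical
  intro r
  let a : Fin k × ι → ℂ := fun q => if q.1.1 = j then r q.2 else 0
  have ha := (jetFrame c fr k).co_sum x hx a
  refine ⟨⟨∑ q, a q • (jetFrame c fr k).e q x, (mem_jetKernel_iff c fr hx _ _).2 fun q hq => ?_⟩,
    ?_⟩
  · rw [ha]
    exact if_neg (by omega)
  · funext l
    rw [gradedCo_apply, ha]
    exact if_pos rfl

/-- The coordinates on `K_{i+1} / K_i` given by the derivatives of order `j`, for
`i + 1 + j = k`. -/
def gradedEquiv {x : X} (hx : x ∈ U) {i j : ℕ} (hij : i + 1 + j = k) :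
    Graded (A := jets p A k) (jetKernel p A k) i x ≃ₗ[ℂ] (ι → ℂ) :=
  (Submodule.quotEquivOfEq _ _ (ker_gradedCo c fr hx hij).symm).trans
    (LinearMap.quotKerEquivOfSurjective _ (gradedCo_surjective c fr hx hij))

theorem gradedEquiv_mk {x : X} (hx : x ∈ U) {i j : ℕ} (hij : i + 1 + j = k)
    (a : jetKernel p A k (i + 1) x) (l : ι) :
    gradedEquiv c fr hx hij (Submodule.Quotient.mk a) l =
      (jetFrame c fr k).co x a.1 (⟨j, by omega⟩, l) := rfl

/-- The coordinates of a frame as a linear equivalence. -/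
def Frame.coEquiv {J : SectionSheaf.{uB, uX, w'} B X} (fr : Frame J U ι) {x : X} (hx : x ∈ U) :
    J.Fib x ≃ₗ[ℂ] (ι → ℂ) :=
  { fr.co x with
    invFun := fun a => ∑ i, a i • fr.e i x
    left_inv := fr.sum_co x hx
    right_inv := fr.co_sum x hx }

/-- In coordinates, the identification of `Symʲ Ω¹ ⊗ A` with a graded piece is `(-1)ʲ j!` times the
identity: the sign comes from the factors `f(x) - f`, and `j!` from the derivative of order `j`. -/
theorem IsGradedIdentification.gradedEquiv_apply {x : X} (hx : x ∈ U) {i j : ℕ}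
    (hij : i + 1 + j = k)
    {γ : (SymmetricPower ℂ (Fin j) (RelCotangent p x) ⊗[ℂ] A.Fib x) ≃ₗ[ℂ]
      Graded (A := jets p A k) (jetKernel p A k) i x}
    (hγ : IsGradedIdentification p A k i j x γ)
    (σ : SymmetricPower ℂ (Fin j) (RelCotangent p x) ⊗[ℂ] A.Fib x) (l : ι) :
    gradedEquiv c fr hx hij (γ σ) l =
      (-1) ^ j * j.factorial * (symFrame c fr j).co x σ l := by
  classical
  have hbasis : ∀ m, gradedEquiv c fr hx hij (γ ((symFrame c fr j).e m x)) l =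
      (-1) ^ j * j.factorial * (symFrame c fr j).co x ((symFrame c fr j).e m x) l := by
    intro m
    obtain ⟨h, h1⟩ := hγ (fun _ => ⟨c.t, c.t_hol x hx⟩) ⟨fr.e m, fr.hol_e c.isOpen hx m⟩
    have h2 : γ ((symFrame c fr j).e m x) = _ := h1
    rw [h2, gradedEquiv_mk, jetFrame_co_shiftGerm c fr hx (by omega), (symFrame c fr j).co_e hx,
      fr.co_e hx, (c.D_t hx).eq_of_nhds]
    simp
  have hext := (symFrame c fr j).linearMap_ext hx
    (f := LinearMap.proj l ∘ₗ (gradedEquiv c fr hx hij).toLinearMap ∘ₗ γ.toLinearMap)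
    (g := ((-1) ^ j * j.factorial : ℂ) • LinearMap.proj l ∘ₗ (symFrame c fr j).co x) hbasis
  exact LinearMap.congr_fun hext σ

end Graded

theorem existsUnique_isGradedIdentification (hloc : HasCharts p A ι) {i j : ℕ}
    (hij : i + 1 + j = k) (x : X) : ∃! γ, IsGradedIdentification p A k i j x γ := by
  obtain ⟨U, hx, ⟨c⟩, ⟨fr⟩⟩ := hloc x
  have hj : ((-1) ^ j * j.factorial : ℂ) ≠ 0 :=
    mul_ne_zero (pow_ne_zero _ (by norm_num)) (Nat.cast_ne_zero.2 j.factorial_ne_zero)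
  let γ : (SymmetricPower ℂ (Fin j) (RelCotangent p x) ⊗[ℂ] A.Fib x) ≃ₗ[ℂ]
      Graded (A := jets p A k) (jetKernel p A k) i x :=
    (((symFrame c fr j).coEquiv hx).trans (LinearEquiv.smulOfNeZero ℂ (ι → ℂ) _ hj)).trans
      (gradedEquiv c fr hx hij).symm
  refine ⟨γ, fun f s => ⟨jetAt_shiftGerm_mem hloc hij f s, ?_⟩, fun γ' hγ' => ?_⟩
  · apply (gradedEquiv c fr hx hij).injective
    funext l
    rw [gradedEquiv_mk, jetFrame_co_shiftGerm c fr hx (by omega)]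
    refine (congrFun ((gradedEquiv c fr hx hij).apply_symm_apply _) l).trans ?_
    change _ * (symFrame c fr j).co x _ l = _
    congr 1
    refine (tensorCo_tmul fr _ x _ _ l).trans ?_
    rw [symEval_tprod]
    rfl
  · ext σ
    apply (gradedEquiv c fr hx hij).injective
    funext l
    rw [hγ'.gradedEquiv_apply c fr hx hij]
    exact (congrFun ((gradedEquiv c fr hx hij).apply_symm_apply
      (((-1) ^ j * j.factorial : ℂ) • (symFrame c fr j).co x σ)) l).symm

end Filtration

/-! ### The filtration generated by the second fundamental form -/

section SecondFundamentalForm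

variable {B : Type uB} [NormedAddCommGroup B] [NormedSpace ℂ B]
  {X : Type uX} [TopologicalSpace X] [ChartedSpace B X]
  {C : Type uC} [NormedAddCommGroup C] [NormedSpace ℂ C]
  {S : Type uS} [TopologicalSpace S] [ChartedSpace C S]
  [IsManifold 𝓘(ℂ, B) ω X]
  {p : Family B X C S} {J : SectionSheaf.{uB, uX, w} B X} {U : Set X} {κ : Type} [Fintype κ]

omit [IsManifold 𝓘(ℂ, B) ω X] in
theorem Operator.app_of_hol {J' : SectionSheaf.{uB, uX, w'} B X} (P : Operator J J')
    {u : ∀ y, J.Fib y} {x : X} (hu : J.Hol u x) : P.app u x = P.val x ⟨u, hu⟩ :=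
  applyField_of_hol P.val hu

omit [IsManifold 𝓘(ℂ, B) ω X] in
theorem Frame.exists_hol_co_eq (fr : Frame J U κ) (hU : IsOpen U) {x : X} (hx : x ∈ U)
    {r : κ → X → ℂ} (hr : ∀ q, HolAt B (r q) x) :
    ∃ u, J.Hol u x ∧ ∀ y ∈ U, fr.co y (u y) = fun q => r q y :=
  ⟨fun z => ∑ q, r q z • fr.e q z, fr.hol_sum_smul_e hU hx hr, fun y hy => fr.co_sum y hy _⟩

/-- A step of the filtration stays inside a subbundle `W'` which is cut out by the vanishing of some
coordinates: the torsion causes no trouble, as the germs of functions form a domain. -/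
theorem sffStep_subset_sectionsIn [FiniteDimensional ℂ B] (D : Operator J (formsTensor p J))
    (c : FibreCoord p U) (fr : Frame J U κ) {x : X} (hx : x ∈ U) {W W' : ∀ y, Submodule ℂ (J.Fib y)}
    (I : Set κ) (hle : ∀ y ∈ U, W y ≤ W' y)
    (hW' : ∀ y ∈ U, ∀ a, a ∈ W' y ↔ ∀ q ∈ I, fr.co y a q = 0)
    (hD : ∀ y ∈ U, ∀ u : J.germs y, u.1 ∈ J.sectionsIn W y →
      contract p (J.Fib y) (c.v y) (D.val y u) ∈ W' y) :
    sffStep p D (J.sectionsIn W) x ⊆ J.sectionsIn W' x := by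
  rintro s ⟨hs, f, hf, hf0, t, ht, m, v, u, -, hu, heq⟩
  refine ⟨hs, ?_⟩
  have hmem : ∀ᶠ y in 𝓝 x, f y • s y ∈ W' y := by
    filter_upwards [heq, c.mem_nhds hx, ht.2,
      Filter.eventually_all.2 fun a => J.eventually (hu a).1,
      Filter.eventually_all.2 fun a => eventually_eventually_nhds.2 (hu a).2] with y h1 hy h2 h3 h4
    rw [h1]
    refine Submodule.add_mem _ (hle y hy h2) (Submodule.sum_mem _ fun a _ => ?_)
    rw [c.eq_smul_v y hy (v a y), contract_smul, Operator.app_of_hol D (h3 a)]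
    exact Submodule.smul_mem _ _ (hD y hy ⟨u a, h3 a⟩ ⟨h3 a, h4 a⟩)
  have hco : ∀ᶠ y in 𝓝 x, ∀ q, q ∈ I → fr.co y (s y) q = 0 := by
    refine Filter.eventually_all.2 fun q => ?_
    by_cases hq : q ∈ I
    · refine (hf.eventually_eq_zero_of_mul_eq_zero (fr.hol_co hx hs q) ?_ hf0).mono fun y h _ => h
      filter_upwards [hmem, c.mem_nhds hx] with y h1 hy
      have h2 := (hW' y hy _).1 h1 q hq
      rwa [map_smul] at h2
    · exact Filter.Eventually.of_forall fun y h => absurd h hq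
  filter_upwards [hco, c.mem_nhds hx] with y h1 hy
  exact (hW' y hy _).2 h1

/-- A section which a covariant derivative `∇_v u` of a section `u` of `W` corrects to a section
of `W` lies in the next step of the filtration. -/
theorem mem_sffStep_of_add_contract_mem (D : Operator J (formsTensor p J))
    (c : FibreCoord p U) (fr : Frame J U κ) {x : X} (hx : x ∈ U) {W : ∀ y, Submodule ℂ (J.Fib y)}
    {s u : ∀ y, J.Fib y} (hs : J.Hol s x) (hu : u ∈ J.sectionsIn W x)
    (h : ∀ᶠ z in 𝓝 x, ∀ hz : J.Hol u z,
      s z + contract p (J.Fib z) (c.v z) (D.val z ⟨u, hz⟩) ∈ W z) :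
    s ∈ sffStep p D (J.sectionsIn W) x := by
  let n : ∀ z, J.Fib z := fun z => contract p (J.Fib z) (c.v z) (D.app u z)
  have hn : J.Hol n x := by
    refine (fr.hol_iff x hx n).2 fun q => ?_
    refine ((formsFrame c fr).hol_co hx (D.hol x ⟨u, hu.1⟩) q).congr
      (Filter.Eventually.of_forall fun z => ?_)
    exact congrFun (formsFrame_co c fr z _) q
  refine ⟨hs, fun _ => 1, HolAt.const 1 x, fun h => one_ne_zero h.self_of_nhds,
    fun z => s z + n z, ⟨J.add hs hn, ?_⟩, 1, fun _ z => (-1 : ℂ) • c.v z, fun _ => u,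
    fun _ f hf => ?_, fun _ => hu, Filter.Eventually.of_forall fun z => ?_⟩
  · filter_upwards [h, J.eventually hu.1] with z h1 h2
    simp only [n]
    rw [Operator.app_of_hol D h2]
    exact h1 h2
  · have h6 := (c.v_hol x hx f hf).neg
    simpa only [neg_one_smul, map_neg] using h6
  · simp only [one_smul, Finset.univ_unique, Finset.sum_singleton, contract_smul]
    rw [neg_one_smul]
    exact (add_neg_cancel_right _ _).symm

end SecondFundamentalForm

section Oper

variable {B : Type uB} [NormedAddCommGroup B] [NormedSpace ℂ B]
  {X : Type uX} [TopologicalSpace X] [ChartedSpace B X]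
  {C : Type uC} [NormedAddCommGroup C] [NormedSpace ℂ C]
  {S : Type uS} [TopologicalSpace S] [ChartedSpace C S]
  [IsManifold 𝓘(ℂ, B) ω X] [IsManifold 𝓘(ℂ, C) ω S]
  {p : Family B X C S} {A : SectionSheaf.{uB, uX, w} B X} {U : Set X} {ι : Type} [Fintype ι]
  {k : ℕ}

/-! ### The oper structure -/

/-- In the jet frames, and up to the last coordinates, the connection `D` subtracts from the
derivative of each coordinate the next coordinate.  This is all that the oper structure depends
on. -/
def ShiftsCoordinates (ι : Type) [Fintype ι]
    (D : Operator (jets p A k) (formsTensor p (jets p A k))) : Prop :=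
  ∀ (U : Set X) (c : FibreCoord p U) (fr : Frame A U ι) (x : X), x ∈ U →
    ∀ (u : (jets p A k).germs x) (m : ℕ) (hm : m + 1 < k) (l : ι),
      (jetFrame c fr k).co x (contract p (JetFib p A k x) (c.v x) (D.val x u))
          (⟨m, m.lt_succ_self.trans hm⟩, l) =
        c.D (fun z => (jetFrame c fr k).co z (u.1 z) (⟨m, m.lt_succ_self.trans hm⟩, l)) x -
          (jetFrame c fr k).co x (u.1 x) (⟨m + 1, hm⟩, l)

theorem shiftsCoordinates_inducedConnection {P : Operator A (symFormsTensor p k A)}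
    (hP : IsRelDiffOp p k P) (hsymbol : HasIdentitySymbol p k P) (hloc : HasCharts p A ι) :
    ShiftsCoordinates ι (inducedConnection hP hsymbol hloc) := by
  intro U c fr x hx u m hm l
  have h := (isInducedAt_inducedConnection hP hsymbol hloc x).co_eq hP hsymbol hloc c fr hx u
    (⟨m, m.lt_succ_self.trans hm⟩, l)
  rw [formsFrame_co] at h
  rw [h]
  congr 1
  exact jetFrame_co_splitMap_castSucc hP hsymbol c fr hloc hx (u.1 x) ⟨m + 1, hm⟩ l

variable {D : Operator (jets p A k) (formsTensor p (jets p A k))}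

/-- The coordinates that vanish on a kernel have vanishing derivatives on its sections. -/
theorem D_co_eq_zero (c : FibreCoord p U) (fr : Frame A U ι) {x : X} (hx : x ∈ U) {i : ℕ}
    {u : ∀ z, JetFib p A k z} (hu : ∀ᶠ z in 𝓝 x, u z ∈ jetKernel p A k i z) {q : Fin k × ι}
    (hq : q.1.1 < k - i) : c.D (fun z => (jetFrame c fr k).co z (u z) q) x = 0 := by
  have h : (fun z => (jetFrame c fr k).co z (u z) q) =ᶠ[𝓝 x] fun _ => 0 := by
    filter_upwards [hu, c.mem_nhds hx] with z hz hzU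
    exact (mem_jetKernel_iff c fr hzU i _).1 hz q hq
  rw [(c.D_congr h).eq_of_nhds, c.D_const]

namespace ShiftsCoordinates

/-- Griffiths transversality for the filtration by the kernels. -/
theorem contract_mem (hD : ShiftsCoordinates ι D) (c : FibreCoord p U) (fr : Frame A U ι) {x : X}
    (hx : x ∈ U) {i : ℕ} {u : (jets p A k).germs x}
    (hu : u.1 ∈ (jets p A k).sectionsIn (jetKernel p A k i) x) :
    contract p (JetFib p A k x) (c.v x) (D.val x u) ∈ jetKernel p A k (i + 1) x := by
  refine (mem_jetKernel_iff c fr hx _ _).2 ?_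
  rintro ⟨m, l⟩ hm
  simp only at hm
  have h := hD U c fr x hx u m (by omega) l
  rw [D_co_eq_zero c fr hx hu.2 (by simp only; omega),
    (mem_jetKernel_iff c fr hx i _).1 hu.2.self_of_nhds _ (by simp only; omega), sub_zero] at h
  exact h

theorem mapsInto (hD : ShiftsCoordinates ι D) (hloc : HasCharts p A ι) (i : ℕ) :
    MapsInto p D (jetKernel p A k i) (jetKernel p A k (i + 1)) := by
  intro x s hs
  obtain ⟨U, hx, ⟨c⟩, ⟨fr⟩⟩ := hloc x
  refine ⟨relDiff p c.t x ⊗ₜ ⟨_, hD.contract_mem c fr hx hs⟩, ?_⟩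
  rw [LinearMap.lTensor_tmul]
  exact tmul_contract c hx (D.val x s)

/-- A germ with constant coordinates in the jet frame, with a given value at `x`. -/
theorem exists_const_germ (c : FibreCoord p U) (fr : Frame A U ι) {x : X} (hx : x ∈ U) {i : ℕ}
    {a : JetFib p A k x} (ha : a ∈ jetKernel p A k i x) :
    ∃ s : (jets p A k).germs x, s.1 x = a ∧ s.1 ∈ (jets p A k).sectionsIn (jetKernel p A k i) x ∧
      ∀ q, c.D (fun z => (jetFrame c fr k).co z (s.1 z) q) x = 0 := by
  have hs := (jetFrame c fr k).hol_sum_smul_e c.isOpen hx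
    (f := fun q _ => (jetFrame c fr k).co x a q) fun q => HolAt.const _ _
  have hco : ∀ᶠ z in 𝓝 x, (jetFrame c fr k).co z (∑ q, (jetFrame c fr k).co x a q •
      (jetFrame c fr k).e q z) = (jetFrame c fr k).co x a := by
    filter_upwards [c.mem_nhds hx] with z hz
    exact (jetFrame c fr k).co_sum z hz _
  refine ⟨⟨_, hs⟩, (jetFrame c fr k).sum_co x hx a, ⟨hs, ?_⟩, fun q => ?_⟩
  · filter_upwards [hco, c.mem_nhds hx] with z hz hzU
    refine (mem_jetKernel_iff c fr hzU i _).2 fun q hq => ?_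
    rw [hz]
    exact (mem_jetKernel_iff c fr hx i a).1 ha q hq
  · have h : (fun z => (jetFrame c fr k).co z (∑ q, (jetFrame c fr k).co x a q •
        (jetFrame c fr k).e q z) q) =ᶠ[𝓝 x] fun _ => (jetFrame c fr k).co x a q := by
      filter_upwards [hco] with z hz
      rw [hz]
    rw [(c.D_congr h).eq_of_nhds, c.D_const]

/-- A map induced by the connection on the graded pieces is, in coordinates, minus the identity. -/
theorem gradedEquiv_contract (hD : ShiftsCoordinates ι D) (c : FibreCoord p U)
    (fr : Frame A U ι) {x : X} (hx : x ∈ U) {i j : ℕ} (hij : i + 2 + j = k)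
    {α : ∀ x, Graded (A := jets p A k) (jetKernel p A k) i x →ₗ[ℂ]
      RelCotangent p x ⊗[ℂ] Graded (A := jets p A k) (jetKernel p A k) (i + 1) x}
    (hα : IsGradedMap p D (jetKernel p A k) i α)
    (g : Graded (A := jets p A k) (jetKernel p A k) i x) (l : ι) :
    gradedEquiv c fr hx (show i + 1 + 1 + j = k by omega) (contract p _ (c.v x) (α x g)) l =
      - gradedEquiv c fr hx (show i + 1 + (j + 1) = k by omega) g l := by
  obtain ⟨⟨a, ha⟩, rfl⟩ := Submodule.Quotient.mk_surjective _ g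
  obtain ⟨s, rfl, hs, hs0⟩ := exists_const_germ c fr hx ha
  have hmem := hD.contract_mem c fr hx hs
  rw [hα x s hs ha (relDiff p c.t x ⊗ₜ ⟨_, hmem⟩)
    (by rw [LinearMap.lTensor_tmul]; exact tmul_contract c hx (D.val x s)),
    LinearMap.lTensor_tmul, contract_tmul, c.relDiff_t x hx, one_smul, gradedEquiv_mk]
  refine (gradedEquiv_mk c fr hx _ _ l).trans ?_
  have h := hD U c fr x hx s j (by omega) l
  rw [hs0, zero_sub] at h
  exact h

/-- The map induced by `D` on the graded pieces exists, and is an isomorphism. -/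
theorem exists_gradedMap (hD : ShiftsCoordinates ι D) (hloc : HasCharts p A ι) {i : ℕ}
    (hi : i + 2 ≤ k) : ∃ α, IsGradedMap p D (jetKernel p A k) i α ∧
      ∀ x, Function.Bijective (α x) := by
  obtain ⟨j, hij⟩ := Nat.exists_eq_add_of_le hi
  have key : ∀ x, ∃ α : Graded (A := jets p A k) (jetKernel p A k) i x →ₗ[ℂ]
      RelCotangent p x ⊗[ℂ] Graded (A := jets p A k) (jetKernel p A k) (i + 1) x,
      (∀ s : (jets p A k).germs x, s.1 ∈ (jets p A k).sectionsIn (jetKernel p A k (i + 1)) x →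
        ∀ h : s.1 x ∈ jetKernel p A k (i + 1) x,
        ∀ τ : RelCotangent p x ⊗[ℂ] jetKernel p A k (i + 2) x,
        LinearMap.lTensor (RelCotangent p x) (jetKernel p A k (i + 2) x).subtype τ = D.val x s →
        α (Submodule.Quotient.mk ⟨s.1 x, h⟩) = LinearMap.lTensor (RelCotangent p x)
          ((jetKernel p A k (i + 1) x).submoduleOf (jetKernel p A k (i + 2) x)).mkQ τ) ∧
      Function.Bijective α := by
    intro x
    obtain ⟨U, hx, ⟨c⟩, ⟨fr⟩⟩ := hloc x
    let g₁ := gradedEquiv (A := A) c fr hx (show i + 1 + (j + 1) = k by omega)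
    let g₂ := gradedEquiv (A := A) c fr hx (show i + 1 + 1 + j = k by omega)
    obtain ⟨α, hα, hbij⟩ :=
      exists_bijective_contract_eq c hx ((g₁.trans (LinearEquiv.neg ℂ)).trans g₂.symm)
    have hα' : ∀ g, g₂ (contract p _ (c.v x) (α g)) = - g₁ g := fun g =>
      (congrArg g₂ (hα g)).trans (g₂.apply_symm_apply _)
    refine ⟨α, fun s hs h τ hτ => ?_, hbij⟩
    apply contract_injective c hx
    apply g₂.injective
    rw [hα', contract_lTensor]
    funext l
    have h1 : (contract p _ (c.v x) τ).1 = contract p (JetFib p A k x) (c.v x) (D.val x s) := by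
      rw [← hτ]
      exact (contract_lTensor (c.v x) (jetKernel p A k (i + 2) x).subtype τ).symm
    have h2 := hD U c fr x hx s j (by omega) l
    rw [D_co_eq_zero c fr hx hs.2 (by simp only; omega), zero_sub, ← h1] at h2
    exact (congrArg Neg.neg (gradedEquiv_mk c fr hx (show i + 1 + (j + 1) = k by omega) _ l)).trans
      (h2.symm.trans (gradedEquiv_mk c fr hx (show i + 1 + 1 + j = k by omega) _ l).symm)
  choose α h1 h2 using key
  exact ⟨α, fun x => h1 x, h2⟩

/-- With the canonical identifications, the maps induced by the connection on the graded pieces are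
the polarization isomorphisms. -/
theorem gradedMap_eq (hD : ShiftsCoordinates ι D) (hloc : HasCharts p A ι) {i j : ℕ}
    (hij : i + 2 + j = k)
    {α : ∀ x, Graded (A := jets p A k) (jetKernel p A k) i x →ₗ[ℂ]
      RelCotangent p x ⊗[ℂ] Graded (A := jets p A k) (jetKernel p A k) (i + 1) x}
    (hα : IsGradedMap p D (jetKernel p A k) i α) (x : X)
    {γ : (SymmetricPower ℂ (Fin (j + 1)) (RelCotangent p x) ⊗[ℂ] A.Fib x) ≃ₗ[ℂ]
      Graded (A := jets p A k) (jetKernel p A k) i x}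
    {γ' : (SymmetricPower ℂ (Fin j) (RelCotangent p x) ⊗[ℂ] A.Fib x) ≃ₗ[ℂ]
      Graded (A := jets p A k) (jetKernel p A k) (i + 1) x}
    (hγ : IsGradedIdentification p A k i (j + 1) x γ)
    (hγ' : IsGradedIdentification p A k (i + 1) j x γ')
    (η : Fin (j + 1) → RelCotangent p x) (e : A.Fib x) :
    α x (γ (SymmetricPower.tprod ℂ η ⊗ₜ[ℂ] e)) =
      ∑ a, η a ⊗ₜ[ℂ] γ' (SymmetricPower.tprod ℂ (fun b => η (a.succAbove b)) ⊗ₜ[ℂ] e) := by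
  obtain ⟨U, hx, ⟨c⟩, ⟨fr⟩⟩ := hloc x
  apply contract_injective c hx
  apply (gradedEquiv c fr hx (show i + 1 + 1 + j = k by omega)).injective
  funext l
  rw [hD.gradedEquiv_contract c fr hx hij hα,
    hγ.gradedEquiv_apply c fr hx (show i + 1 + (j + 1) = k by omega)]
  have hsym : ∀ (n : ℕ) (ξ : Fin n → RelCotangent p x),
      (symFrame c fr n).co x (SymmetricPower.tprod ℂ ξ ⊗ₜ[ℂ] e) l =
        (∏ a, ξ a (c.v x)) * fr.co x e l := by
    intro n ξ
    refine (tensorCo_tmul fr _ x _ _ l).trans ?_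
    rw [symEval_tprod]
    rfl
  have hterm : ∀ a, η a (c.v x) * gradedEquiv c fr hx (show i + 1 + 1 + j = k by omega)
      (γ' (SymmetricPower.tprod ℂ (fun b => η (a.succAbove b)) ⊗ₜ[ℂ] e)) l =
      (-1) ^ j * j.factorial * ((∏ b, η b (c.v x)) * fr.co x e l) := by
    intro a
    rw [hγ'.gradedEquiv_apply c fr hx (show i + 1 + 1 + j = k by omega), hsym,
      Fin.prod_univ_succAbove (fun b => η b (c.v x)) a]
    ring
  refine Eq.trans ?_ (coordinate_contract_sum _ (c.v x) η _ l).symm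
  rw [Finset.sum_congr rfl fun a _ => hterm a, hsym, Finset.sum_const, Finset.card_univ,
    Fintype.card_fin, nsmul_eq_mul, Nat.factorial_succ]
  push_cast
  ring

theorem sffStep_subset [FiniteDimensional ℂ B] (hD : ShiftsCoordinates ι D)
    (hloc : HasCharts p A ι) (i : ℕ) (x : X) :
    sffStep p D ((jets p A k).sectionsIn (jetKernel p A k i)) x ⊆
      (jets p A k).sectionsIn (jetKernel p A k (i + 1)) x := by
  obtain ⟨U, hx, ⟨c⟩, ⟨fr⟩⟩ := hloc x
  exact sffStep_subset_sectionsIn D c (jetFrame c fr k) hx {q | q.1.1 < k - (i + 1)}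
    (fun y _ => jetKernel_mono hloc i.le_succ y)
    (fun y hy a => mem_jetKernel_iff c fr hy (i + 1) a)
    (fun y hy u hu => hD.contract_mem c fr hy hu)

/-- Every section of the next kernel is reached by the second fundamental form. -/
theorem subset_sffStep (hD : ShiftsCoordinates ι D) (hloc : HasCharts p A ι) {i : ℕ}
    (hi : i + 2 ≤ k) (x : X) :
    (jets p A k).sectionsIn (jetKernel p A k (i + 2)) x ⊆
      sffStep p D ((jets p A k).sectionsIn (jetKernel p A k (i + 1))) x := by
  rintro s ⟨hs, hsK⟩
  obtain ⟨U, hx, ⟨c⟩, ⟨fr⟩⟩ := hloc x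
  obtain ⟨j, hij⟩ := Nat.exists_eq_add_of_le hi
  -- `u` is obtained from the lowest coordinates of `s` by raising their order by one
  let r : Fin k × ι → X → ℂ := fun q z =>
    if q.1.1 = j + 1 then (jetFrame c fr k).co z (s z) (⟨j, by omega⟩, q.2) else 0
  have hr : ∀ q, HolAt B (r q) x := by
    intro q
    by_cases hq : q.1.1 = j + 1
    · simpa only [r, if_pos hq] using (jetFrame c fr k).hol_co hx hs (⟨j, by omega⟩, q.2)
    · simpa only [r, if_neg hq] using HolAt.const 0 x
  obtain ⟨u, hu, huco⟩ := (jetFrame c fr k).exists_hol_co_eq c.isOpen hx hr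
  have huK : ∀ᶠ z in 𝓝 x, u z ∈ jetKernel p A k (i + 1) z := by
    filter_upwards [c.mem_nhds hx] with z hz
    refine (mem_jetKernel_iff c fr hz _ _).2 fun q hq => ?_
    rw [huco z hz]
    exact if_neg (by omega)
  refine mem_sffStep_of_add_contract_mem D c (jetFrame c fr k) hx hs ⟨hu, huK⟩ ?_
  filter_upwards [c.mem_nhds hx, hsK, eventually_eventually_nhds.2 huK] with z hz h1 h3 h2
  refine (mem_jetKernel_iff c fr hz _ _).2 ?_
  rintro ⟨m, l⟩ hm
  simp only at hm
  have h4 := hD U c fr z hz ⟨u, h2⟩ m (by omega) l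
  rw [D_co_eq_zero c fr hz h3 (by simp only; omega), zero_sub, huco z hz] at h4
  rw [map_add, Pi.add_apply]
  refine (congrArg _ h4).trans ?_
  change _ + -(r (⟨m.1 + 1, by omega⟩, l) z) = 0
  by_cases hmj : m.1 = j
  · have h5 : r (⟨m.1 + 1, by omega⟩, l) z = (jetFrame c fr k).co z (s z) (m, l) := by
      subst hmj
      exact if_pos rfl
    rw [h5, add_neg_cancel]
  · have h5 : r (⟨m.1 + 1, by omega⟩, l) z = 0 := if_neg (by simp only; omega)
    rw [h5, neg_zero, add_zero]
    exact (mem_jetKernel_iff c fr hz _ _).1 h1 (m, l) (by simp only; omega)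

theorem sffFiltration_eq [FiniteDimensional ℂ B] (hD : ShiftsCoordinates ι D)
    (hloc : HasCharts p A ι) {F : ∀ x, Submodule ℂ (JetFib p A k x)}
    (hF : F = jetKernel p A k 1) :
    ∀ i ≤ k, sffFiltration p D F i = (jets p A k).sectionsIn (jetKernel p A k i)
  | 0, _ => by
    have h : jetKernel p A k 0 = fun _ => ⊥ := funext fun x => jetKernel_zero x
    rw [h]
    rfl
  | 1, _ => by
    rw [hF]
    rfl
  | i + 2, hi => by
    have ih := sffFiltration_eq hD hloc hF (i + 1) (by omega)
    funext x
    change sffStep p D (sffFiltration p D F (i + 1)) x = _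
    rw [ih]
    exact Set.Subset.antisymm (hD.sffStep_subset hloc (i + 1) x) (hD.subset_sffStep hloc hi x)

theorem isOperOfSFF [FiniteDimensional ℂ B] (hD : ShiftsCoordinates ι D)
    (hconn : IsRelConnection p D) (hloc : HasCharts p A ι) {j : ℕ} (hj : j + 1 = k) :
    IsOperOfSFF p (jets p A k) D (symSubbundle p A k j) k (jetKernel p A k) where
  isRelativeOper :=
    { isVectorBundle := jets_isVectorBundle hloc
      isRelConnection := hconn
      isSubbundle := fun i _ => jetKernel_isSubbundle hloc i
      bot := jetKernel_zero
      top := jetKernel_self hloc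
      mono := fun i _ x => jetKernel_mono hloc i.le_succ x
      mapsInto := fun i _ => hD.mapsInto hloc (i + 1)
      graded_bijective := fun _ hi => hD.exists_gradedMap hloc hi }
  isSubbundle := by
    rw [symSubbundle_eq hloc hj]
    exact jetKernel_isSubbundle hloc 1
  filtration i hi x := congrFun (hD.sffFiltration_eq hloc (symSubbundle_eq hloc hj) i hi) x

end ShiftsCoordinates

end Oper

/-! ### Holomorphic vector bundles on families of curves -/

/-- The restriction of a fibre coordinate to a smaller open set. -/
def FibreCoord.restrict {B : Type uB} [NormedAddCommGroup B] [NormedSpace ℂ B]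
    {X : Type uX} [TopologicalSpace X] [ChartedSpace B X]
    {C : Type uC} [NormedAddCommGroup C] [NormedSpace ℂ C]
    {S : Type uS} [TopologicalSpace S] [ChartedSpace C S]
    {p : Family B X C S} {U V : Set X} (c : FibreCoord p U) (hV : IsOpen V) (h : V ⊆ U) :
    FibreCoord p V where
  t := c.t
  v := c.v
  isOpen := hV
  t_hol y hy := c.t_hol y (h hy)
  v_hol y hy := c.v_hol y (h hy)
  relDiff_t y hy := c.relDiff_t y (h hy)
  eq_smul_v y hy := c.eq_smul_v y (h hy)
  hadamard y hy := c.hadamard y (h hy)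

/-- A holomorphic vector bundle on a family of curves has fibre coordinates and frames around every
point. -/
theorem hasCharts_ofBundle {B : Type uB} [NormedAddCommGroup B] [NormedSpace ℂ B]
    [FiniteDimensional ℂ B] {C : Type uC} [NormedAddCommGroup C] [NormedSpace ℂ C]
    [FiniteDimensional ℂ C]
    {X : Type uX} [TopologicalSpace X] [ChartedSpace B X] [IsManifold 𝓘(ℂ, B) ω X]
    {S : Type uS} [TopologicalSpace S] [ChartedSpace C S]
    (p : Family B X C S) (hdim : Module.finrank ℂ B = Module.finrank ℂ C + 1)
    {F : Type uF} [NormedAddCommGroup F] [NormedSpace ℂ F] [FiniteDimensional ℂ F]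
    (V : X → Type w) [TopologicalSpace (TotalSpace F V)] [∀ x, AddCommGroup (V x)]
    [∀ x, Module ℂ (V x)] [∀ x, TopologicalSpace (V x)] [FiberBundle F V] [VectorBundle ℂ F V]
    [ContMDiffVectorBundle ω F V 𝓘(ℂ, B)] :
    HasCharts p (SectionSheaf.ofBundle (B := B) F V) (Fin (Module.finrank ℂ F)) := by
  intro x
  obtain ⟨U, hxU, ⟨c⟩⟩ := exists_fibreCoord p hdim x
  obtain ⟨U', hU', hxU', ⟨fr⟩⟩ := exists_frame_ofBundle (B := B) F V x
  exact ⟨U ∩ U', ⟨hxU, hxU'⟩, ⟨c.restrict (c.isOpen.inter hU') Set.inter_subset_left⟩,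
    ⟨fr.restrict Set.inter_subset_right⟩⟩

end RelOper

end

theorem theorem4p2
    {B : Type*} [NormedAddCommGroup B] [NormedSpace ℂ B] [FiniteDimensional ℂ B]
    {C : Type*} [NormedAddCommGroup C] [NormedSpace ℂ C] [FiniteDimensional ℂ C]
    {X : Type*} [TopologicalSpace X] [T2Space X] [ChartedSpace B X] [IsManifold 𝓘(ℂ, B) ω X]
    {S : Type*} [TopologicalSpace S] [T2Space S] [ChartedSpace C S] [IsManifold 𝓘(ℂ, C) ω S]
    (p : RelOper.Family B X C S)
    (hdim : Module.finrank ℂ B = Module.finrank ℂ C + 1)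
    {F : Type*} [NormedAddCommGroup F] [NormedSpace ℂ F] [FiniteDimensional ℂ F]
    (V : X → Type*) [TopologicalSpace (Bundle.TotalSpace F V)] [∀ x, AddCommGroup (V x)]
    [∀ x, Module ℂ (V x)] [∀ x, TopologicalSpace (V x)] [FiberBundle F V] [VectorBundle ℂ F V]
    [ContMDiffVectorBundle ω F V 𝓘(ℂ, B)]
    (k : ℕ) (hk : 1 ≤ k)
    (P : RelOper.Operator (RelOper.SectionSheaf.ofBundle (B := B) F V)
      (RelOper.symFormsTensor p k (RelOper.SectionSheaf.ofBundle F V)))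
    (hP : RelOper.IsRelDiffOp p k P)
    (hsymbol : RelOper.HasIdentitySymbol p k P) :
    let E : RelOper.SectionSheaf B X := RelOper.SectionSheaf.ofBundle F V
    let J := RelOper.jets p E k
    let K : ℕ → ∀ x, Submodule ℂ (J.Fib x) := RelOper.jetKernel p E k
    ∃ D : RelOper.Operator J (RelOper.formsTensor p J),
      -- `D` is the connection `∇_P` induced by `P`
      RelOper.IsInducedConnection p k P D ∧
      (∀ D', RelOper.IsInducedConnection p k P D' → D' = D) ∧
      -- the filtration by the kernels is generated by the second fundamental form, and is an oper
      RelOper.IsOperOfSFF p J D (RelOper.symSubbundle p E k (k - 1)) k K ∧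
      (∀ i < k, ∀ x, Nontrivial (V x) → K i x < K (i + 1) x) ∧
      -- the graded pieces are the bundles `Symʲ Ω¹ ⊗ E`
      (∀ i j, i + 1 + j = k → ∀ x, ∃! ι, RelOper.IsGradedIdentification p E k i j x ι) ∧
      -- the successive maps are the identity
      (∀ i j, i + 2 + j = k → ∀ α, RelOper.IsGradedMap p D K i α → ∀ x ι ι',
        RelOper.IsGradedIdentification p E k i (j + 1) x ι →
        RelOper.IsGradedIdentification p E k (i + 1) j x ι' →
        ∀ (η : Fin (j + 1) → RelOper.RelCotangent p x) (e : V x),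
          α x (ι (SymmetricPower.tprod ℂ η ⊗ₜ[ℂ] e)) =
            ∑ a, η a ⊗ₜ[ℂ] ι' (SymmetricPower.tprod ℂ (fun b => η (a.succAbove b)) ⊗ₜ[ℂ] e)) := by
  intro E J K
  have hloc := RelOper.hasCharts_ofBundle (F := F) p hdim V
  have hD := RelOper.shiftsCoordinates_inducedConnection hP hsymbol hloc
  exact ⟨RelOper.inducedConnection hP hsymbol hloc,
    RelOper.isInducedConnection_inducedConnection hP hsymbol hloc,
    fun D' hD' => hD'.eq_inducedConnection hP hsymbol hloc,
    hD.isOperOfSFF (RelOper.isRelConnection_inducedConnection hP hsymbol hloc) hloc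
      (Nat.sub_add_cancel hk),
    fun i hi x _ => RelOper.jetKernel_lt (A := E) hloc hi x,
    fun i j hij x => RelOper.existsUnique_isGradedIdentification hloc hij x,
    fun i j hij α hα x γ γ' hγ hγ' η e => hD.gradedMap_eq hloc hij hα x hγ hγ' η e⟩
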